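/- Let $q\ge 1$ be an integer, $\theta_k=e^{2\pi i k/q}$, and let $l=(l_1,\dots,l_{q-1})\in\mathbb N^{q-1}$, $|l|=l_1+\cdots+l_{q-1}$. For $m\in\mathbb N^{q}$ (indexed by $0,\dots,q-1$) with $|m|=\sum_j m[j]=d$, the multivariate Krawtchouk polynomial $Q_l(m)$ is the coefficient of $w_1^{l_1}\cdots w_{q-1}^{l_{q-1}}$ in $\prod_{j=0}^{q-1}\bigl(1+\sum_{k=1}^{q-1}w_k\theta_k^j\bigr)^{m[j]}$. Put $h_l=(d-|l|)!\,l_1!\cdots l_{q-1}!/d!$ and $\mathfrak p(n)=\frac{d!}{n[0]!\cdots n[q-1]!}q^{-d}$ for $|n|=d$. For a random vector $V=V^{(d)}$ in $\{v\in\mathbb N^q:|v|=d\}$ consider the transition function of the grouped random walk on $\mathbb Z_q^d$ from counts $m$ to counts $n$, $$P_d(n\mid m)=\mathfrak p(n)\,\mathbb E\Bigl[1+\sum_{0<|l|\le d}h_l^2\,Q_l(V)\,Q_l(m)\,\overline{Q_l(n)}\Bigr].$$ For $\mathfrak m_+=(\mathfrak m[1],\dots,\mathfrak m[q-1])\in\mathbb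 R^{q-1}$ put $\mathfrak m[0]=-\sum_{j\ge1}\mathfrak m[j]$, let $Q_l(\mathfrak m;\infty)$ be the coefficient of $w^l$ in $$\exp\Bigl\{-\frac1{2q}\sum_{j=0}^{q-1}\Bigl(\sum_{k=1}^{q-1}w_k\theta_k^j\Bigr)^2+\sum_{j=0}^{q-1}\mathfrak m[j]\sum_{k=1}^{q-1}w_k\theta_k^j\Bigr\},$$ and let $$\varphi(\mathfrak n_+;q)=\frac{q^{q/2}}{(2\pi)^{(q-1)/2}}\exp\Bigl\{-\frac q2\sum_{a,b=1}^{q-1}(\delta_{ab}+1)\mathfrak n[a]\mathfrak n[b]\Bigr\}.$$ Let $\mathfrak v=(\mathfrak v[0],\dots,\mathfrak v[q-1])$ be a probability vector, $|\mathfrak v|=\sum_{j=1}^{q-1}\mathfrak v[j]$ and $\lambda_k=1-|\mathfrak v|+\sum_{j=1}^{q-1}\mathfrak v[j]\theta_k^j$ for $1\le k\le q-1$. Suppose that $V^{(d)}/d\to\mathfrak v$ in probability as $d\to\infty$. Let $m^{(d)},n^{(d)}$ be count vectors of total $d$ with $(m^{(d)}[j]-d/q)/\sqrt d\to\mathfrak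 m[j]$ and $(n^{(d)}[j]-d/q)/\sqrt d\to\mathfrak n[j]$ for $1\le j\le q-1$. Then, as $d\to\infty$: 1. For every $l$, $d^{-|l|/2}Q_l(m^{(d)})\to Q_l(\mathfrak m;\infty)$. 2. $d^{(q-1)/2}\,\mathfrak p(n^{(d)})\to\varphi(\mathfrak n_+;q)$, and for every $l$, $$\mathbb E\bigl[h_l^2Q_l(V^{(d)})Q_l(m^{(d)})\overline{Q_l(n^{(d)})}\bigr]\to\prod_{k=1}^{q-1}\lambda_k^{l_k}\prod_{k=1}^{q-1}l_k!\;Q_l(\mathfrak m;\infty)\overline{Q_l(\mathfrak n;\infty)}.$$ 3. Suppose moreover that $|\lambda_k|<1$ for $1\le k\le q-1$. Then the series in $$p(\mathfrak n_+\mid\mathfrak m_+)=\varphi(\mathfrak n_+;q)\Bigl\{1+\sum_{l\in\mathbb N^{q-1},\,|l|>0}\ \prod_{k=1}^{q-1}\lambda_k^{l_k}\prod_{k=1}^{q-1}l_k!\;Q_l(\mathfrak m;\infty)\overline{Q_l(\mathfrak n;\infty)}\Bigr\}$$ converges absolutely for all $\mathfrak m_+,\mathfrak n_+\in\mathbb R^{q-1}$,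 and $p$ is a transition density: it is real, nonnegative and jointly measurable, and $\int_{\mathbb R^{q-1}}p(\mathfrak n_+\mid\mathfrak m_+)\,d\mathfrak n_+=1$ for every $\mathfrak m_+$. The transition functions converge weakly to it: for every bounded continuous $f:\mathbb R^{q-1}\to\mathbb R$, $$\sum_{|n|=d}f\Bigl(\Bigl(\tfrac{n[j]-d/q}{\sqrt d}\Bigr)_{j=1}^{q-1}\Bigr)P_d(n\mid m^{(d)})\to\int_{\mathbb R^{q-1}}f(\mathfrak n_+)\,p(\mathfrak n_+\mid\mathfrak m_+)\,d\mathfrak n_+ .$$ -/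

import Mathlib

open MeasureTheory Filter Topology
open scoped BigOperators

namespace GroupedWalk

noncomputable section

/-- The nonzero residues `1, …, q - 1` modulo `q`. -/
abbrev NZ (q : ℕ) : Type := {j : ZMod q // j ≠ 0}

/-- `θ_k ^ j`, where `θ_k = e^{2πik/q}`. -/
def theta (q : ℕ) (k j : ZMod q) : ℂ :=
  Complex.exp (2 * Real.pi * Complex.I * k.val / q) ^ j.val

variable {q : ℕ} [NeZero q]

/-- The linear form `∑_{k=1}^{q-1} w_k θ_k^j` in the indeterminates `w_k`. -/
def linForm (j : ZMod q) : MvPolynomial (NZ q) ℂ :=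
  ∑ k : NZ q, MvPolynomial.C (theta q k.1 j) * MvPolynomial.X k

/-- Generating function `∏_j (1 + ∑_k w_k θ_k^j)^{m[j]}` of the multivariate Krawtchouk
polynomials. -/
def krawtchoukGen (m : ZMod q → ℕ) : MvPolynomial (NZ q) ℂ :=
  ∏ j : ZMod q, (1 + linForm j) ^ m j

/-- The multivariate Krawtchouk polynomial `Q_l(m; (θ_k))`, the coefficient of `w^l`. -/
def krawtchouk (l : NZ q →₀ ℕ) (m : ZMod q → ℕ) : ℂ :=
  MvPolynomial.coeff l (krawtchoukGen m)

/-- `h_l = (d - |l|)! l_1! ⋯ l_{q-1}! / d!`, used for `|l| ≤ d`. -/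
def hNorm (d : ℕ) (l : NZ q →₀ ℕ) : ℝ :=
  (((d - l.degree).factorial : ℕ) * ∏ k : NZ q, ((l k).factorial : ℝ)) / (d.factorial : ℝ)

/-- The uniform multinomial probability `𝔭(n) = (d choose n) q^{-d}`, where `|n| = d`. -/
def multinomialProb (d : ℕ) (n : ZMod q → ℕ) : ℝ :=
  (Nat.multinomial Finset.univ n : ℝ) / (q : ℝ) ^ d

/-- The `l`-th summand `h_l² Q_l(v) Q_l(m) conj Q_l(n)` of the spectral expansion. -/
def spectralTerm (d : ℕ) (v m n : ZMod q → ℕ) (l : NZ q →₀ ℕ) : ℂ :=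
  (hNorm d l : ℂ) ^ 2 * krawtchouk l v * krawtchouk l m
    * (starRingEnd ℂ) (krawtchouk l n)

/-- The transition function from counts `m` to counts `n`,
`𝔭(n) 𝔼[1 + ∑_{0 < |l| ≤ d} h_l² Q_l(V) Q_l(m) conj Q_l(n)]`,
`V` being the random vector of counts of the increments of the `d` coordinates. -/
def groupedTransition {Ω : Type*} [MeasurableSpace Ω] (P : Measure Ω) (d : ℕ)
    (V : Ω → ZMod q → ℕ) (m n : ZMod q → ℕ) : ℂ :=
  (multinomialProb d n : ℂ) *
    ∫ ω, (1 + ∑ r ∈ Finset.Icc 1 d,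
      ∑ l ∈ Finset.finsuppAntidiag (Finset.univ : Finset (NZ q)) r,
        spectralTerm d (V ω) m n l) ∂P

/-- Coordinates `1, …, q - 1` of the centred and scaled counts `(n - d/q) / √d`. -/
def scaledCounts (d : ℕ) (n : ZMod q → ℕ) : NZ q → ℝ :=
  fun j => ((n j.1 : ℝ) - (d : ℝ) / q) / Real.sqrt d

/-- The vector of `ℝ^q` with sum zero whose coordinates `1, …, q - 1` are `x`. -/
def extend (x : NZ q → ℝ) : ZMod q → ℝ :=
  fun j => if h : j = 0 then - ∑ k : NZ q, x k else x ⟨j, h⟩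

/-- The exponent `-(1/2q) ∑_j (∑_k w_k θ_k^j)² + ∑_j 𝔪[j] ∑_k w_k θ_k^j`. -/
def limitExponent (x : ZMod q → ℝ) : MvPolynomial (NZ q) ℂ :=
  - MvPolynomial.C (1 / (2 * (q : ℂ))) * ∑ j : ZMod q, linForm j ^ 2
    + ∑ j : ZMod q, MvPolynomial.C (x j : ℂ) * linForm j

/-- The formal power series `G(𝔪, w; ∞) = exp (limitExponent 𝔪)`. -/
def limitGen (x : ZMod q → ℝ) : MvPowerSeries (NZ q) ℂ :=
  (PowerSeries.exp ℂ).subst (limitExponent x : MvPowerSeries (NZ q) ℂ)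

/-- The substitution in `limitGen` is legitimate. -/
theorem hasSubst_limitExponent (x : ZMod q → ℝ) :
    PowerSeries.HasSubst (limitExponent x : MvPowerSeries (NZ q) ℂ) := by
  apply PowerSeries.HasSubst.of_constantCoeff_zero
  rw [← MvPowerSeries.coeff_zero_eq_constantCoeff_apply, MvPolynomial.coeff_coe,
    ← MvPolynomial.constantCoeff_eq]
  simp [limitExponent, linForm]

/-- `Q_l(𝔪; ∞)`, the coefficient of `w^l` in `G(𝔪, w; ∞)`. -/
def limitQ (l : NZ q →₀ ℕ) (x : ZMod q → ℝ) : ℂ :=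
  MvPowerSeries.coeff l (limitGen x)

/-- `φ(x; q)`, the density on `ℝ^{q-1}` of the centred normal law with
covariance matrix `(1/q)(I - J/q)`. -/
def gaussianDensity (x : NZ q → ℝ) : ℝ :=
  (q : ℝ) ^ ((q : ℝ) / 2) / (2 * Real.pi) ^ (((q : ℝ) - 1) / 2) *
    Real.exp (-((q : ℝ) / 2) *
      ∑ a : NZ q, ∑ b : NZ q, ((if a = b then 1 else 0) + 1) * x a * x b)

/-- `1 - |𝔳| + ∑_{j=1}^{q-1} 𝔳[j] θ_k^j`, where `|𝔳| = 𝔳[1] + ⋯ + 𝔳[q-1]`. -/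
def limitEigen (v : ZMod q → ℝ) (k : NZ q) : ℂ :=
  1 - ∑ j : NZ q, (v j.1 : ℂ) + ∑ j : NZ q, (v j.1 : ℂ) * theta q k.1 j.1

/-- The `l`-th summand
`∏_k (1 - |𝔳| + ∑_j 𝔳[j] θ_k^j)^{l_k} ∏_k l_k! Q_l(𝔪; ∞) conj Q_l(𝔫; ∞)`. -/
def limitTerm (v : ZMod q → ℝ) (x y : NZ q → ℝ) (l : NZ q →₀ ℕ) : ℂ :=
  (∏ k : NZ q, limitEigen v k ^ l k) * (∏ k : NZ q, ((l k).factorial : ℂ))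
    * limitQ l (extend x) * (starRingEnd ℂ) (limitQ l (extend y))

/-- The limit transition density from `x = 𝔪_+` to `y = 𝔫_+`. -/
def limitDensity (v : ZMod q → ℝ) (x y : NZ q → ℝ) : ℂ :=
  (gaussianDensity y : ℂ) *
    (1 + ∑' l : {l : NZ q →₀ ℕ // l ≠ 0}, limitTerm v x y l.1)

end

end GroupedWalk

/-!
# Scaling limit of the grouped random walk on `ℤ_q^d`

All three claims are read off from generating functions in `w`.

*Coefficients.* A power series in several variables that converges absolutely on the unit torus is
determined by its values there, and bounded pointwise convergence of such series on the torus gives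
convergence of the coefficients (`coeff_unique`, `tendsto_coeff`, from the orthogonality of the
monomials). The first claim follows, because `∏_j (1 + ∑_k w_k θ_k^j / √d)^{m[j]}` tends to the
generating function of the limit polynomials: its logarithm has no divergent linear term, as
`∑_j θ_k^j = 0` (`tendsto_krawtchouk`). Cauchy's estimates also bound `d^{-|l|/2} Q_l(m)` by a
multiple of `ρ^{-|l|}` for every `ρ`, uniformly in `d` (`exists_bound_krawtchouk`). The same method
with `d` in place of `√d` gives `h_l Q_l(V) → ∏_k λ_k^{l_k}` along counts with `V / d → 𝔳`, and the
second claim follows by dominated convergence since `|h_l Q_l| ≤ 1` (`tendsto_meanEigen`). The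
prefactor is handled by Stirling's formula (`tendsto_multinomialProb`).

*The limit density.* With `τ_k` the discrete Fourier transform of `t ∈ ℝ^{q-1}`, Fourier inversion
for the Gaussian `φ` shows that `φ(y) conj Q_l(y; ∞)` is, up to a constant, the Fourier transform of
`∏_k (i τ_k)^{l_k} / l_k!` times `exp (-½ ∑_k |τ_k|²)` (`integral_fourierKernel_mul_prod`).
Inserting this into the series and summing under the integral, where the generating function of
`Q_l(x; ∞)` is evaluated at `w_k = i λ_k τ_k`, leaves the Fourier integral of
`exp (-½ ∑_k (1 - |λ_k|²) |τ_k|²)` times an oscillation. The interchange is legitimate because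
`|λ_k| < 1`. So the series sums to a normal density, whose mean depends linearly on `x`
(`hasSum_limitTerm`, `limitDensity_eq`); reality, positivity, measurability and total mass one are
then evident.

*Weak convergence.* For fixed increment counts the spectral sum is the transition probability of a
walk whose increments are randomly permuted (`walkProb_eq`), and the Krawtchouk polynomials are its
eigenfunctions (`sum_walkProb_mul_krawtchouk`). The exponential `exp (i t · s)` of the scaled counts
`s` of `n` is a multiple of the generating function `∏_j (1 + ∑_k w_k θ_k^j)^{n[j]}` for a suitable
`w` of order `1/√d`, so the characteristic function of the walk is a series in the `Q_l(m)`; it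
converges by dominated convergence to the characteristic function of the normal law above
(`tendsto_charFun_meanWalkProb`), and Lévy's continuity theorem concludes.
-/

namespace GroupedWalk

/-! ### Characters of the cyclic group -/

section Characters

variable {q : ℕ} [NeZero q]

theorem theta_eq_stdAddChar (k j : ZMod q) : theta q k j = ZMod.stdAddChar (k * j) := by
  have h : (k * j : ZMod q) = ((k.val * j.val : ℤ) : ZMod q) := by
    push_cast
    simp
  rw [h, ZMod.stdAddChar_coe, theta, ← Complex.exp_nat_mul]
  congr 1
  push_cast
  ring

theorem theta_comm (k j : ZMod q) : theta q k j = theta q j k := by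
  rw [theta_eq_stdAddChar, theta_eq_stdAddChar, mul_comm]

@[simp] theorem theta_zero_left (j : ZMod q) : theta q 0 j = 1 := by
  simp [theta_eq_stdAddChar]

@[simp] theorem theta_zero_right (k : ZMod q) : theta q k 0 = 1 := by
  simp [theta_eq_stdAddChar]

theorem theta_add_right (k i j : ZMod q) : theta q k (i + j) = theta q k i * theta q k j := by
  simp [theta_eq_stdAddChar, mul_add, AddChar.map_add_eq_mul]

theorem theta_add_left (k l j : ZMod q) : theta q (k + l) j = theta q k j * theta q l j := by
  simp [theta_eq_stdAddChar, add_mul, AddChar.map_add_eq_mul]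

@[simp] theorem norm_theta (k j : ZMod q) : ‖theta q k j‖ = 1 := by
  rw [theta_eq_stdAddChar, ZMod.stdAddChar_apply]
  exact Circle.norm_coe _

theorem theta_neg_left (k j : ZMod q) : theta q (-k) j = (starRingEnd ℂ) (theta q k j) := by
  rw [← Complex.inv_eq_conj (norm_theta k j)]
  simp only [theta_eq_stdAddChar, neg_mul, AddChar.map_neg_eq_inv]

theorem theta_neg_right (k j : ZMod q) : theta q k (-j) = (starRingEnd ℂ) (theta q k j) := by
  rw [theta_comm, theta_neg_left, theta_comm]

theorem sum_theta (k : ZMod q) : ∑ j, theta q k j = if k = 0 then (q : ℂ) else 0 := by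
  simp only [theta_eq_stdAddChar]
  have := AddChar.sum_mulShift (R' := ℂ) k (ZMod.isPrimitive_stdAddChar q)
  simp only [mul_comm k]
  rw [this]
  simp [ZMod.card]

theorem sum_theta_right (j : ZMod q) : ∑ k, theta q k j = if j = 0 then (q : ℂ) else 0 := by
  simp_rw [theta_comm _ j]
  exact sum_theta j

theorem sum_nonzero {M : Type*} [AddCommGroup M] (f : ZMod q → M) :
    ∑ k : NZ q, f k.1 = ∑ k, f k - f 0 := by
  have h : ∑ k : NZ q, f k.1 = ∑ k ∈ Finset.univ.erase 0, f k :=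
    (Finset.sum_subtype _ (by simp) f).symm
  rw [h, eq_sub_iff_add_eq, Finset.sum_erase_add _ _ (Finset.mem_univ 0)]

/-- The negative of a nonzero residue. -/
def negNZ (k : NZ q) : NZ q := ⟨-k.1, neg_ne_zero.mpr k.2⟩

/-- Negation as a permutation of the nonzero residues. -/
def negEquiv : NZ q ≃ NZ q where
  toFun := negNZ
  invFun := negNZ
  left_inv k := by simp [negNZ]
  right_inv k := by simp [negNZ]

theorem theta_negNZ (k : NZ q) (j : ZMod q) :
    theta q (negNZ k).1 j = (starRingEnd ℂ) (theta q k.1 j) := theta_neg_left _ _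

theorem sum_extend (x : NZ q → ℝ) : ∑ j, extend x j = 0 := by
  have h := sum_nonzero (extend x)
  have h1 : ∑ k : NZ q, extend x k.1 = ∑ k : NZ q, x k :=
    Finset.sum_congr rfl fun k _ => by simp [extend, k.2]
  rw [h1] at h
  have h2 : extend x (0 : ZMod q) = - ∑ k : NZ q, x k := by simp [extend]
  rw [h2] at h
  linarith

theorem extend_coe (x : NZ q → ℝ) (k : NZ q) : extend x k.1 = x k := by
  simp [extend, k.2]

theorem extend_zero (x : NZ q → ℝ) : extend x (0 : ZMod q) = - ∑ k : NZ q, x k := by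
  simp [extend]

theorem continuous_extend : Continuous (extend : (NZ q → ℝ) → ZMod q → ℝ) := by
  refine continuous_pi fun j => ?_
  by_cases h : j = 0
  · subst h
    simp only [extend_zero]
    fun_prop
  · simp only [extend, h, dite_false]
    fun_prop

/-- All `q` centred and scaled counts are recovered from the last `q - 1` of them. -/
theorem extend_scaledCounts {d : ℕ} {n : ZMod q → ℕ} (hn : ∑ j, n j = d) (j : ZMod q) :
    extend (scaledCounts d n) j = ((n j : ℝ) - (d : ℝ) / q) / Real.sqrt d := by
  by_cases h : j = 0
  · subst h
    rw [extend_zero]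
    simp only [scaledCounts]
    rw [sum_nonzero (fun j => ((n j : ℝ) - (d : ℝ) / q) / Real.sqrt d), ← Finset.sum_div,
      Finset.sum_sub_distrib]
    have hs : ∑ j, (n j : ℝ) = d := by exact_mod_cast hn
    have hq : (q : ℝ) ≠ 0 := by exact_mod_cast NeZero.ne q
    rw [hs]
    simp only [Finset.sum_const, Finset.card_univ, ZMod.card, nsmul_eq_mul]
    rw [mul_div_cancel₀ _ hq]
    ring
  · simp [extend, h, scaledCounts]

end Characters

/-! ### Second-order expansion of the logarithm -/

/-- If `√d u_d → z` then `d (log (1 + u_d) - u_d) → -z²/2`, along any sequence of scales `s = √d`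
tending to infinity. -/
theorem tendsto_sq_mul_log_one_add_sub {α : Type*} {F : Filter α} {s : α → ℝ} {u : α → ℂ} {z : ℂ}
    (hs : Tendsto s F atTop) (hu : Tendsto (fun a => (s a : ℂ) * u a) F (𝓝 z)) :
    Tendsto (fun a => (s a : ℂ) ^ 2 * (Complex.log (1 + u a) - u a)) F (𝓝 (-z ^ 2 / 2)) := by
  have hsinv : Tendsto (fun a => ((s a : ℂ))⁻¹) F (𝓝 0) := by
    have := (Complex.continuous_ofReal.tendsto 0).comp (tendsto_inv_atTop_zero.comp hs)
    simpa [Function.comp_def] using this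
  have hs0 : ∀ᶠ a in F, (s a : ℂ) ≠ 0 := by
    filter_upwards [hs.eventually_gt_atTop 0] with a ha
    exact_mod_cast ha.ne'
  have hu0 : Tendsto u F (𝓝 0) := by
    have h := hsinv.mul hu
    rw [zero_mul] at h
    refine h.congr' ?_
    filter_upwards [hs0] with a ha
    field_simp
  -- the remainder after two terms is at most `s² |u|³` once `|u| ≤ 1/2`
  have hrem : Tendsto (fun a => (s a : ℂ) ^ 2 * (Complex.log (1 + u a) - u a + u a ^ 2 / 2)) F
      (𝓝 0) := by
    have hb : Tendsto (fun a => ‖(s a : ℂ) * u a‖ ^ 2 * ‖u a‖) F (𝓝 0) := by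
      have := (hu.norm.pow 2).mul hu0.norm
      simpa using this
    refine squeeze_zero_norm' ?_ hb
    have hu1 : ∀ᶠ a in F, ‖u a‖ < 1 / 2 := by
      have := hu0.norm
      rw [norm_zero] at this
      exact this.eventually_lt_const (by norm_num)
    filter_upwards [hu1] with a ha
    have h := Complex.norm_log_sub_logTaylor_le 2 (z := u a) (by linarith)
    have hT : Complex.logTaylor 3 (u a) = u a - u a ^ 2 / 2 := by
      simp [Complex.logTaylor, Finset.sum_range_succ]
      ring
    rw [hT] at h
    have h1 : (1 - ‖u a‖)⁻¹ ≤ 2 := by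
      rw [inv_le_comm₀ (by linarith) (by norm_num)]
      linarith
    have h2 : ‖Complex.log (1 + u a) - u a + u a ^ 2 / 2‖ ≤ ‖u a‖ ^ 3 := by
      have e : Complex.log (1 + u a) - u a + u a ^ 2 / 2
          = Complex.log (1 + u a) - (u a - u a ^ 2 / 2) := by ring
      rw [e]
      refine h.trans ?_
      norm_num
      have h3 : 0 ≤ ‖u a‖ ^ 3 := by positivity
      nlinarith [mul_le_mul_of_nonneg_left h1 h3]
    rw [norm_mul, norm_pow, norm_mul, mul_pow]
    calc ‖(s a : ℂ)‖ ^ 2 * ‖Complex.log (1 + u a) - u a + u a ^ 2 / 2‖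
        ≤ ‖(s a : ℂ)‖ ^ 2 * ‖u a‖ ^ 3 := by gcongr
      _ = _ := by ring
  have h2 := hrem.sub ((hu.pow 2).div_const 2)
  rw [zero_sub, ← neg_div] at h2
  refine h2.congr fun a => ?_
  ring

/-! ### Coefficients of multivariate power series as integrals over a torus -/

section Torus

variable {ι : Type*}

/-- The circle carries its normalised Haar measure, the choice under which Mathlib develops Fourier
series on the torus. -/
noncomputable local instance : MeasureSpace UnitAddCircle := ⟨AddCircle.haarAddCircle⟩

local instance : IsProbabilityMeasure (volume : Measure UnitAddCircle) :=
  inferInstanceAs (IsProbabilityMeasure AddCircle.haarAddCircle)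

/-- The point `(e^{2πi t_k})_k` of the unit torus in `ℂ^ι`. -/
noncomputable def torusPoint (t : UnitAddTorus ι) : ι → ℂ := fun k => fourier 1 (t k)

theorem norm_torusPoint (t : UnitAddTorus ι) (k : ι) : ‖torusPoint t k‖ = 1 := by
  rw [torusPoint, fourier_one]
  exact Circle.norm_coe _

variable [Fintype ι]

theorem prod_torusPoint_pow (t : UnitAddTorus ι) (l : ι →₀ ℕ) :
    ∏ k, torusPoint t k ^ l k = UnitAddTorus.mFourier (fun k => (l k : ℤ)) t := by
  simp only [UnitAddTorus.mFourier, ContinuousMap.coe_mk, torusPoint]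
  refine Finset.prod_congr rfl fun k _ => ?_
  rw [fourier_one, fourier_apply, natCast_zsmul, AddCircle.toCircle_nsmul, Circle.coe_pow]

theorem integral_mFourier (n : ι → ℤ) :
    ∫ t, UnitAddTorus.mFourier n t = if n = 0 then 1 else 0 := by
  have h := (orthonormal_iff_ite.mp (UnitAddTorus.orthonormal_mFourier (d := ι))) 0 n
  simp only [ContinuousMap.inner_toLp, ← UnitAddTorus.mFourier_neg, ← UnitAddTorus.mFourier_add,
    UnitAddTorus.mFourierLp] at h
  simp only [neg_zero, add_zero, eq_comm (a := (0 : ι → ℤ))] at h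
  rw [← h]

/-- A coefficient of an absolutely convergent power series, as a Fourier coefficient of its
restriction to the unit torus. -/
theorem coeff_eq_integral_torus {a : (ι →₀ ℕ) → ℂ} {F : (ι → ℂ) → ℂ}
    (ha : Summable fun l => ‖a l‖)
    (hF : ∀ w : ι → ℂ, (∀ k, ‖w k‖ = 1) → HasSum (fun l => a l * ∏ k, w k ^ l k) (F w))
    (l : ι →₀ ℕ) :
    a l = ∫ t, UnitAddTorus.mFourier (fun k => -(l k : ℤ)) t * F (torusPoint t) := by
  classical
  have hint : ∀ l' : ι →₀ ℕ, ∀ t, UnitAddTorus.mFourier (fun k => -(l k : ℤ)) t *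
      (a l' * ∏ k, torusPoint t k ^ l' k)
      = a l' * UnitAddTorus.mFourier (fun k => (l' k : ℤ) - (l k : ℤ)) t := by
    intro l' t
    rw [prod_torusPoint_pow]
    have : (fun k => (l' k : ℤ) - (l k : ℤ)) = (fun k => -(l k : ℤ)) + fun k => (l' k : ℤ) := by
      ext k
      simp
      ring
    rw [this, UnitAddTorus.mFourier_add]
    ring
  have key : HasSum (fun l' => ∫ t, UnitAddTorus.mFourier (fun k => -(l k : ℤ)) t *
      (a l' * ∏ k, torusPoint t k ^ l' k))
      (∫ t, UnitAddTorus.mFourier (fun k => -(l k : ℤ)) t * F (torusPoint t)) := by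
    refine hasSum_integral_of_dominated_convergence (fun l' _ => ‖a l'‖) (fun l' => ?_)
      (fun l' => ?_) ?_ ?_ ?_
    · simp only [hint]
      exact (continuous_const.mul (ContinuousMap.continuous _)).aestronglyMeasurable
    · refine Eventually.of_forall fun t => ?_
      simp only [hint, norm_mul]
      refine mul_le_of_le_one_right (norm_nonneg _) ?_
      exact (ContinuousMap.norm_coe_le_norm _ t).trans UnitAddTorus.mFourier_norm.le
    · exact Eventually.of_forall fun t => ha
    · exact integrable_const _
    · exact Eventually.of_forall fun t => (hF _ (norm_torusPoint t)).mul_left _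
  have h2 : HasSum (fun l' => ∫ t, UnitAddTorus.mFourier (fun k => -(l k : ℤ)) t *
      (a l' * ∏ k, torusPoint t k ^ l' k)) (a l) := by
    have : (fun l' => ∫ t, UnitAddTorus.mFourier (fun k => -(l k : ℤ)) t *
      (a l' * ∏ k, torusPoint t k ^ l' k)) = fun l' => if l' = l then a l else 0 := by
      ext l'
      simp only [hint]
      rw [integral_const_mul, integral_mFourier]
      by_cases h : l' = l
      · subst h
        simp [← Pi.zero_def]
      · have h' : (fun k => (l' k : ℤ) - (l k : ℤ)) ≠ 0 := by
          intro h0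
          apply h
          ext k
          have := congrFun h0 k
          simp only [Pi.zero_apply] at this
          omega
        simp [h, h']
    rw [this]
    exact hasSum_ite_eq l (a l)
  exact h2.unique key

/-- Two absolutely convergent power series that agree on the unit torus have the same
coefficients. -/
theorem coeff_unique {a b : (ι →₀ ℕ) → ℂ} {F : (ι → ℂ) → ℂ}
    (ha : Summable fun l => ‖a l‖) (hb : Summable fun l => ‖b l‖)
    (hF : ∀ w : ι → ℂ, (∀ k, ‖w k‖ = 1) → HasSum (fun l => a l * ∏ k, w k ^ l k) (F w))
    (hG : ∀ w : ι → ℂ, (∀ k, ‖w k‖ = 1) → HasSum (fun l => b l * ∏ k, w k ^ l k) (F w)) :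
    a = b := by
  ext l
  rw [coeff_eq_integral_torus ha hF, coeff_eq_integral_torus hb hG]

/-- Cauchy's estimate on the polydisc of radius `r`. -/
theorem norm_coeff_mul_pow_le {a : (ι →₀ ℕ) → ℂ} {F : (ι → ℂ) → ℂ} {r : ℝ} (hr : 0 ≤ r) {M : ℝ}
    (ha : Summable fun l : ι →₀ ℕ => ‖a l‖ * r ^ l.degree)
    (hF : ∀ w : ι → ℂ, (∀ k, ‖w k‖ = r) → HasSum (fun l => a l * ∏ k, w k ^ l k) (F w))
    (hM : ∀ w : ι → ℂ, (∀ k, ‖w k‖ = r) → ‖F w‖ ≤ M) (l : ι →₀ ℕ) :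
    ‖a l‖ * r ^ l.degree ≤ M := by
  have hdeg : ∀ l : ι →₀ ℕ, ∏ k, (r : ℂ) ^ l k = (r : ℂ) ^ l.degree := fun l => by
    rw [Finset.prod_pow_eq_pow_sum, Finsupp.degree_eq_sum]
  have hnorm : ∀ w : ι → ℂ, (∀ k, ‖w k‖ = 1) → ∀ k, ‖(r : ℂ) * w k‖ = r := fun w hw k => by
    simp [hw k, abs_of_nonneg hr]
  have hc := coeff_eq_integral_torus (a := fun l => a l * (r : ℂ) ^ l.degree)
    (F := fun w => F fun k => r * w k) (by simpa [abs_of_nonneg hr] using ha)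
    (fun w hw => by
      refine (hF _ (hnorm w hw)).congr_fun fun l => ?_
      simp only [mul_pow, Finset.prod_mul_distrib, hdeg]
      ring) l
  have : ‖a l‖ * r ^ l.degree = ‖a l * (r : ℂ) ^ l.degree‖ := by simp [abs_of_nonneg hr]
  rw [this, hc]
  refine (norm_integral_le_of_norm_le_const (C := M) (Eventually.of_forall fun t => ?_)).trans ?_
  · rw [norm_mul]
    refine (mul_le_of_le_one_left (norm_nonneg _) ?_).trans (hM _ (hnorm _ (norm_torusPoint t)))
    exact (ContinuousMap.norm_coe_le_norm _ t).trans UnitAddTorus.mFourier_norm.le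
  · simp

/-- Bounded pointwise convergence on the unit torus implies convergence of all coefficients. -/
theorem tendsto_coeff {a : ℕ → (ι →₀ ℕ) → ℂ} {b : (ι →₀ ℕ) → ℂ} {F : ℕ → (ι → ℂ) → ℂ}
    {G : (ι → ℂ) → ℂ} {M : ℝ}
    (ha : ∀ᶠ i in atTop, Summable fun l => ‖a i l‖) (hb : Summable fun l => ‖b l‖)
    (hF : ∀ᶠ i in atTop, ∀ w : ι → ℂ, (∀ k, ‖w k‖ = 1) →
      HasSum (fun l => a i l * ∏ k, w k ^ l k) (F i w))
    (hG : ∀ w : ι → ℂ, (∀ k, ‖w k‖ = 1) → HasSum (fun l => b l * ∏ k, w k ^ l k) (G w))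
    (hcont : ∀ᶠ i in atTop, Continuous (F i))
    (hM : ∀ᶠ i in atTop, ∀ w : ι → ℂ, (∀ k, ‖w k‖ = 1) → ‖F i w‖ ≤ M)
    (hlim : ∀ w : ι → ℂ, (∀ k, ‖w k‖ = 1) → Tendsto (fun i => F i w) atTop (𝓝 (G w)))
    (l : ι →₀ ℕ) : Tendsto (fun i => a i l) atTop (𝓝 (b l)) := by
  rw [coeff_eq_integral_torus hb hG]
  have h : Tendsto (fun i => ∫ t, UnitAddTorus.mFourier (fun k => -(l k : ℤ)) t *
      F i (torusPoint t)) atTop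
      (𝓝 (∫ t, UnitAddTorus.mFourier (fun k => -(l k : ℤ)) t * G (torusPoint t))) := by
    refine tendsto_integral_filter_of_dominated_convergence (fun _ => M) ?_ ?_ ?_ ?_
    · filter_upwards [hcont] with i hi
      have h1 : Continuous (torusPoint : UnitAddTorus ι → ι → ℂ) :=
        continuous_pi fun k => (ContinuousMap.continuous _).comp (continuous_apply k)
      exact ((ContinuousMap.continuous _).mul (hi.comp h1)).aestronglyMeasurable
    · filter_upwards [hM] with i hi
      refine Eventually.of_forall fun t => ?_
      rw [norm_mul]
      refine (mul_le_of_le_one_left (norm_nonneg _) ?_).trans (hi _ (norm_torusPoint t))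
      exact (ContinuousMap.norm_coe_le_norm _ t).trans UnitAddTorus.mFourier_norm.le
    · exact integrable_const _
    · exact Eventually.of_forall fun t => (hlim _ (norm_torusPoint t)).const_mul _
  refine h.congr' ?_
  filter_upwards [ha, hF] with i hi hi'
  rw [coeff_eq_integral_torus hi hi']

end Torus

/-! ### Exponentials of polynomials as convergent power series -/

section ExpPolynomial

variable {ι : Type*} [Fintype ι]

/-- The weighted `ℓ¹` norm `∑_l |p_l| r^l` of a polynomial. -/
noncomputable def weightedNorm (r : ι → ℝ) (p : MvPolynomial ι ℂ) : ℝ :=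
  ∑ l ∈ p.support, ‖p.coeff l‖ * ∏ k, r k ^ l k

theorem weightedNorm_eq_sum {r : ι → ℝ} {p : MvPolynomial ι ℂ} {s : Finset (ι →₀ ℕ)}
    (hs : p.support ⊆ s) : weightedNorm r p = ∑ l ∈ s, ‖p.coeff l‖ * ∏ k, r k ^ l k := by
  refine Finset.sum_subset hs fun l _ hl => ?_
  rw [MvPolynomial.notMem_support_iff.mp hl]
  simp

theorem hasSum_weightedNorm (r : ι → ℝ) (p : MvPolynomial ι ℂ) :
    HasSum (fun l : ι →₀ ℕ => ‖p.coeff l‖ * ∏ k, r k ^ l k) (weightedNorm r p) := by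
  refine hasSum_sum_of_ne_finset_zero fun l hl => ?_
  rw [MvPolynomial.notMem_support_iff.mp hl]
  simp

theorem hasSum_eval (w : ι → ℂ) (p : MvPolynomial ι ℂ) :
    HasSum (fun l : ι →₀ ℕ => p.coeff l * ∏ k, w k ^ l k) (MvPolynomial.eval w p) := by
  rw [MvPolynomial.eval_eq']
  refine hasSum_sum_of_ne_finset_zero fun l hl => ?_
  rw [MvPolynomial.notMem_support_iff.mp hl]
  simp

theorem weightedNorm_nonneg {r : ι → ℝ} (hr : ∀ k, 0 ≤ r k) (p : MvPolynomial ι ℂ) :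
    0 ≤ weightedNorm r p :=
  Finset.sum_nonneg fun _ _ => mul_nonneg (norm_nonneg _)
    (Finset.prod_nonneg fun k _ => pow_nonneg (hr k) _)

theorem weightedNorm_zero (r : ι → ℝ) : weightedNorm r (0 : MvPolynomial ι ℂ) = 0 := by
  simp [weightedNorm]

theorem weightedNorm_add_le {r : ι → ℝ} (hr : ∀ k, 0 ≤ r k) (p p' : MvPolynomial ι ℂ) :
    weightedNorm r (p + p') ≤ weightedNorm r p + weightedNorm r p' := by
  classical
  refine hasSum_le (fun l => ?_) (hasSum_weightedNorm r (p + p'))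
    ((hasSum_weightedNorm r p).add (hasSum_weightedNorm r p'))
  rw [← add_mul, MvPolynomial.coeff_add]
  exact mul_le_mul_of_nonneg_right (norm_add_le _ _)
    (Finset.prod_nonneg fun k _ => pow_nonneg (hr k) _)

theorem weightedNorm_sum_le {α : Type*} {r : ι → ℝ} (hr : ∀ k, 0 ≤ r k) (s : Finset α)
    (f : α → MvPolynomial ι ℂ) :
    weightedNorm r (∑ a ∈ s, f a) ≤ ∑ a ∈ s, weightedNorm r (f a) :=
  Finset.le_sum_of_subadditive _ (weightedNorm_zero r).le (weightedNorm_add_le hr) s f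

theorem weightedNorm_monomial (r : ι → ℝ) (l : ι →₀ ℕ) (c : ℂ) :
    weightedNorm r (MvPolynomial.monomial l c) = ‖c‖ * ∏ k, r k ^ l k := by
  classical
  rw [weightedNorm_eq_sum MvPolynomial.support_monomial_subset]
  simp

theorem weightedNorm_mul_le {r : ι → ℝ} (hr : ∀ k, 0 ≤ r k) (p p' : MvPolynomial ι ℂ) :
    weightedNorm r (p * p') ≤ weightedNorm r p * weightedNorm r p' := by
  have h : p * p' = ∑ a ∈ p.support, ∑ b ∈ p'.support,
      MvPolynomial.monomial (a + b) (p.coeff a * p'.coeff b) := by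
    conv_lhs => rw [p.as_sum, p'.as_sum]
    rw [Finset.sum_mul_sum]
    simp [MvPolynomial.monomial_mul]
  rw [h]
  conv_rhs => rw [weightedNorm, weightedNorm, Finset.sum_mul_sum]
  refine (weightedNorm_sum_le hr _ _).trans (Finset.sum_le_sum fun a _ => ?_)
  refine (weightedNorm_sum_le hr _ _).trans (Finset.sum_le_sum fun b _ => ?_)
  rw [weightedNorm_monomial, norm_mul]
  simp only [Finsupp.add_apply, pow_add, Finset.prod_mul_distrib]
  exact le_of_eq (by ring)

theorem weightedNorm_pow_le {r : ι → ℝ} (hr : ∀ k, 0 ≤ r k) (p : MvPolynomial ι ℂ) (n : ℕ) :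
    weightedNorm r (p ^ n) ≤ weightedNorm r p ^ n := by
  induction n with
  | zero =>
    have h1 : (1 : MvPolynomial ι ℂ) = MvPolynomial.monomial 0 1 := rfl
    rw [pow_zero, pow_zero, h1, weightedNorm_monomial]
    simp
  | succ n ih =>
    rw [pow_succ, pow_succ]
    exact (weightedNorm_mul_le hr _ _).trans
      (mul_le_mul_of_nonneg_right ih (weightedNorm_nonneg hr _))

/-- The formal power series `exp p`, for a polynomial `p`. -/
noncomputable def expSeries (p : MvPolynomial ι ℂ) : MvPowerSeries ι ℂ :=
  (PowerSeries.exp ℂ).subst (p : MvPowerSeries ι ℂ)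

theorem summable_weightedNorm_pow {r : ι → ℝ} (hr : ∀ k, 0 ≤ r k) (p : MvPolynomial ι ℂ) :
    Summable fun a : ℕ × (ι →₀ ℕ) =>
      ((a.1.factorial : ℝ))⁻¹ * (‖(p ^ a.1).coeff a.2‖ * ∏ k, r k ^ a.2 k) := by
  have hs : ∀ n : ℕ, HasSum (fun l : ι →₀ ℕ => ((n.factorial : ℝ))⁻¹ *
      (‖(p ^ n).coeff l‖ * ∏ k, r k ^ l k)) (((n.factorial : ℝ))⁻¹ * weightedNorm r (p ^ n)) :=
    fun n => (hasSum_weightedNorm r (p ^ n)).mul_left _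
  rw [summable_prod_of_nonneg]
  · refine ⟨fun n => (hs n).summable, ?_⟩
    simp only [fun n => (hs n).tsum_eq]
    refine Summable.of_nonneg_of_le (fun n => ?_) (fun n => ?_)
      (Real.summable_pow_div_factorial (weightedNorm r p))
    · exact mul_nonneg (by positivity) (weightedNorm_nonneg hr _)
    · rw [div_eq_inv_mul]
      exact mul_le_mul_of_nonneg_left (weightedNorm_pow_le hr p n) (by positivity)
  · intro a
    exact mul_nonneg (by positivity) (mul_nonneg (norm_nonneg _)
      (Finset.prod_nonneg fun k _ => pow_nonneg (hr k) _))

theorem coeff_expSeries {ι : Type*} {p : MvPolynomial ι ℂ}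
    (hp : PowerSeries.HasSubst (p : MvPowerSeries ι ℂ)) (l : ι →₀ ℕ) :
    HasSum (fun n : ℕ => ((n.factorial : ℂ))⁻¹ * (p ^ n).coeff l)
      (MvPowerSeries.coeff l (expSeries p)) := by
  rw [expSeries, PowerSeries.coeff_subst hp]
  have he : (fun d : ℕ => PowerSeries.coeff d (PowerSeries.exp ℂ) •
      MvPowerSeries.coeff l ((p : MvPowerSeries ι ℂ) ^ d))
      = fun n : ℕ => ((n.factorial : ℂ))⁻¹ * (p ^ n).coeff l := by
    ext n
    rw [← MvPolynomial.coe_pow, MvPolynomial.coeff_coe, PowerSeries.coeff_exp]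
    simp
  have hfin := PowerSeries.coeff_subst_finite hp (PowerSeries.exp ℂ) l
  rw [he] at hfin ⊢
  rw [finsum_eq_sum _ hfin]
  refine hasSum_sum_of_ne_finset_zero fun n hn => ?_
  by_contra h
  exact hn ((Set.Finite.mem_toFinset _).mpr h)

/-- The weighted `ℓ¹` norm of `exp p` is at most the exponential of that of `p`. -/
theorem summable_norm_coeff_expSeries {p : MvPolynomial ι ℂ}
    (hp : PowerSeries.HasSubst (p : MvPowerSeries ι ℂ)) {r : ι → ℝ} (hr : ∀ k, 0 ≤ r k) :
    Summable (fun l : ι →₀ ℕ => ‖MvPowerSeries.coeff l (expSeries p)‖ * ∏ k, r k ^ l k) ∧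
    ∑' l : ι →₀ ℕ, ‖MvPowerSeries.coeff l (expSeries p)‖ * ∏ k, r k ^ l k
      ≤ Real.exp (weightedNorm r p) := by
  have hS := summable_weightedNorm_pow hr p
  have hS' := hS.prod_symm
  have hle : ∀ l : ι →₀ ℕ, ‖MvPowerSeries.coeff l (expSeries p)‖ * ∏ k, r k ^ l k ≤
      ∑' n : ℕ, ((n.factorial : ℝ))⁻¹ * (‖(p ^ n).coeff l‖ * ∏ k, r k ^ l k) := by
    intro l
    have hR : 0 ≤ ∏ k, r k ^ l k := Finset.prod_nonneg fun k _ => pow_nonneg (hr k) _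
    have h1 := ((coeff_expSeries hp l).mul_right ((∏ k, r k ^ l k : ℝ) : ℂ))
    have h2 : ∀ n : ℕ, ‖((n.factorial : ℂ))⁻¹ * (p ^ n).coeff l * ((∏ k, r k ^ l k : ℝ) : ℂ)‖
        = ((n.factorial : ℝ))⁻¹ * (‖(p ^ n).coeff l‖ * ∏ k, r k ^ l k) := by
      intro n
      rw [norm_mul, norm_mul, Complex.norm_real, Real.norm_of_nonneg hR]
      simp [mul_assoc]
    have h3 : Summable fun n : ℕ =>
        ‖((n.factorial : ℂ))⁻¹ * (p ^ n).coeff l * ((∏ k, r k ^ l k : ℝ) : ℂ)‖ := by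
      simp only [h2]
      exact hS'.prod_factor l
    have h4 := norm_tsum_le_tsum_norm h3
    rw [h1.tsum_eq, norm_mul, Complex.norm_real, Real.norm_of_nonneg hR] at h4
    simpa only [h2] using h4
  have hnn : ∀ l : ι →₀ ℕ, 0 ≤ ‖MvPowerSeries.coeff l (expSeries p)‖ * ∏ k, r k ^ l k := fun l =>
    mul_nonneg (norm_nonneg _) (Finset.prod_nonneg fun k _ => pow_nonneg (hr k) _)
  have hS2 : Summable fun l : ι →₀ ℕ =>
      ∑' n : ℕ, ((n.factorial : ℝ))⁻¹ * (‖(p ^ n).coeff l‖ * ∏ k, r k ^ l k) := hS'.prod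
  have hs1 := Summable.of_nonneg_of_le hnn hle hS2
  refine ⟨hs1, (hs1.tsum_le_tsum hle hS2).trans ?_⟩
  have hcomm : ∑' (l : ι →₀ ℕ) (n : ℕ),
      ((n.factorial : ℝ))⁻¹ * (‖(p ^ n).coeff l‖ * ∏ k, r k ^ l k)
      = ∑' (n : ℕ) (l : ι →₀ ℕ),
      ((n.factorial : ℝ))⁻¹ * (‖(p ^ n).coeff l‖ * ∏ k, r k ^ l k) := hS.tsum_comm
  rw [hcomm]
  have hs : ∀ n : ℕ, HasSum (fun l : ι →₀ ℕ => ((n.factorial : ℝ))⁻¹ *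
      (‖(p ^ n).coeff l‖ * ∏ k, r k ^ l k)) (((n.factorial : ℝ))⁻¹ * weightedNorm r (p ^ n)) :=
    fun n => (hasSum_weightedNorm r (p ^ n)).mul_left _
  have hprod := hS.prod
  simp only [fun n => (hs n).tsum_eq] at hprod ⊢
  rw [Real.exp_eq_exp_ℝ, NormedSpace.exp_eq_tsum_div]
  refine hprod.tsum_le_tsum (fun n => ?_) (Real.summable_pow_div_factorial _)
  rw [div_eq_inv_mul]
  exact mul_le_mul_of_nonneg_left (weightedNorm_pow_le hr p n) (by positivity)

/-- The power series `exp p` converges absolutely to the function `exp (p w)`. -/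
theorem hasSum_coeff_expSeries {p : MvPolynomial ι ℂ}
    (hp : PowerSeries.HasSubst (p : MvPowerSeries ι ℂ)) (w : ι → ℂ) :
    HasSum (fun l : ι →₀ ℕ => MvPowerSeries.coeff l (expSeries p) * ∏ k, w k ^ l k)
      (Complex.exp (MvPolynomial.eval w p)) := by
  have hS : Summable fun a : ℕ × (ι →₀ ℕ) =>
      ((a.1.factorial : ℂ))⁻¹ * (p ^ a.1).coeff a.2 * ∏ k, w k ^ a.2 k := by
    refine Summable.of_norm ((summable_weightedNorm_pow (r := fun k => ‖w k‖)
      (fun k => norm_nonneg _) p).congr fun a => ?_)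
    simp [mul_assoc]
  have h1 : HasSum (fun n : ℕ => ((n.factorial : ℂ))⁻¹ * MvPolynomial.eval w p ^ n)
      (∑' a : ℕ × (ι →₀ ℕ), ((a.1.factorial : ℂ))⁻¹ * (p ^ a.1).coeff a.2 * ∏ k, w k ^ a.2 k) := by
    refine hS.hasSum.prod_fiberwise fun n => ?_
    have := (hasSum_eval w (p ^ n)).mul_left ((n.factorial : ℂ))⁻¹
    simpa only [map_pow, mul_assoc] using this
  have h2 : Complex.exp (MvPolynomial.eval w p)
      = ∑' a : ℕ × (ι →₀ ℕ), ((a.1.factorial : ℂ))⁻¹ * (p ^ a.1).coeff a.2 * ∏ k, w k ^ a.2 k := by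
    rw [← h1.tsum_eq, Complex.exp_eq_exp_ℂ, NormedSpace.exp_eq_tsum_div]
    simp only [div_eq_inv_mul]
  rw [h2]
  have h3 : HasSum (fun a : (ι →₀ ℕ) × ℕ =>
      ((a.2.factorial : ℂ))⁻¹ * (p ^ a.2).coeff a.1 * ∏ k, w k ^ a.1 k)
      (∑' a : ℕ × (ι →₀ ℕ), ((a.1.factorial : ℂ))⁻¹ * (p ^ a.1).coeff a.2 * ∏ k, w k ^ a.2 k) :=
    (Equiv.prodComm (ι →₀ ℕ) ℕ).hasSum_iff.mpr hS.hasSum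
  exact h3.prod_fiberwise fun l => (coeff_expSeries hp l).mul_right (∏ k, w k ^ l k)

end ExpPolynomial

/-! ### The limit polynomials and their generating function -/

section LimitPolynomials

variable {q : ℕ} [NeZero q]

/-- The value `∑_k θ_k^j w_k` of the linear form `linForm j`. -/
noncomputable def formValue (w : NZ q → ℂ) (j : ZMod q) : ℂ := ∑ k : NZ q, theta q k.1 j * w k

/-- The character sums `∑_j x_j θ_k^j` of a vector `x` indexed by the residues. -/
noncomputable def charSum (x : ZMod q → ℝ) (k : ZMod q) : ℂ := ∑ j, (x j : ℂ) * theta q k j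

theorem eval_linForm (w : NZ q → ℂ) (j : ZMod q) :
    MvPolynomial.eval w (linForm j) = formValue w j := by
  simp [linForm, formValue]

theorem continuous_charSum (k : ZMod q) : Continuous fun x : ZMod q → ℝ => charSum x k := by
  unfold charSum
  fun_prop

theorem continuous_formValue (j : ZMod q) : Continuous fun w : NZ q → ℂ => formValue w j := by
  unfold formValue
  fun_prop

theorem formValue_const_mul (c : ℂ) (w : NZ q → ℂ) (j : ZMod q) :
    formValue (fun k => c * w k) j = c * formValue w j := by
  simp only [formValue, Finset.mul_sum]
  exact Finset.sum_congr rfl fun k _ => by ring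

theorem norm_formValue_le (w : NZ q → ℂ) (j : ZMod q) : ‖formValue w j‖ ≤ ∑ k, ‖w k‖ := by
  refine (norm_sum_le _ _).trans (Finset.sum_le_sum fun k _ => ?_)
  simp

theorem sum_mul_formValue (x : ZMod q → ℝ) (w : NZ q → ℂ) :
    ∑ j, (x j : ℂ) * formValue w j = ∑ k : NZ q, w k * charSum x k.1 := by
  simp only [formValue, charSum, Finset.mul_sum]
  rw [Finset.sum_comm]
  exact Finset.sum_congr rfl fun k _ => Finset.sum_congr rfl fun j _ => by ring

theorem sum_formValue (w : NZ q → ℂ) : ∑ j, formValue w j = 0 := by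
  simp only [formValue]
  rw [Finset.sum_comm]
  refine Finset.sum_eq_zero fun k _ => ?_
  rw [← Finset.sum_mul, sum_theta, if_neg k.2, zero_mul]

/-- Orthogonality of the characters, for elements of an arbitrary commutative `ℂ`-algebra. -/
theorem sum_sq_sum_theta {A : Type*} [CommRing A] [Algebra ℂ A] (w : NZ q → A) :
    ∑ j : ZMod q, (∑ k : NZ q, algebraMap ℂ A (theta q k.1 j) * w k) ^ 2
      = algebraMap ℂ A q * ∑ k : NZ q, w k * w (negNZ k) := by
  simp only [sq, Finset.sum_mul_sum]
  rw [Finset.sum_comm, Finset.mul_sum]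
  refine Finset.sum_congr rfl fun k _ => ?_
  rw [Finset.sum_comm, Finset.sum_eq_single (negNZ k)]
  · have : ∀ j : ZMod q, algebraMap ℂ A (theta q k.1 j) * w k *
        (algebraMap ℂ A (theta q (negNZ k).1 j) * w (negNZ k)) = w k * w (negNZ k) := by
      intro j
      have h : theta q k.1 j * theta q (negNZ k).1 j = 1 := by
        rw [← theta_add_left]
        simp [negNZ]
      calc _ = algebraMap ℂ A (theta q k.1 j * theta q (negNZ k).1 j) * (w k * w (negNZ k)) := by
            rw [map_mul]
            ring
        _ = _ := by rw [h, map_one, one_mul]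
    simp [this, ZMod.card]
  · intro k' _ hk'
    have : ∀ j : ZMod q, algebraMap ℂ A (theta q k.1 j) * w k *
        (algebraMap ℂ A (theta q k'.1 j) * w k')
        = algebraMap ℂ A (theta q (k.1 + k'.1) j) * (w k * w k') := by
      intro j
      rw [theta_add_left, map_mul]
      ring
    simp only [this]
    rw [← Finset.sum_mul, ← map_sum, sum_theta, if_neg, map_zero, zero_mul]
    intro h
    exact hk' (Subtype.ext (eq_neg_of_add_eq_zero_right h))
  · simp

theorem sum_formValue_sq (w : NZ q → ℂ) :
    ∑ j, formValue w j ^ 2 = q * ∑ k : NZ q, w k * w (negNZ k) := sum_sq_sum_theta w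

theorem eval_limitExponent (w : NZ q → ℂ) (x : ZMod q → ℝ) :
    MvPolynomial.eval w (limitExponent x)
      = -(1 / 2) * ∑ k : NZ q, w k * w (negNZ k) + ∑ k : NZ q, w k * charSum x k.1 := by
  have hq : (q : ℂ) ≠ 0 := by exact_mod_cast NeZero.ne q
  rw [limitExponent, map_add, map_mul, map_neg, map_sum, map_sum]
  simp only [map_mul, map_pow, eval_linForm, MvPolynomial.eval_C]
  rw [sum_formValue_sq, sum_mul_formValue]
  field_simp

theorem limitExponent_eq (x : ZMod q → ℝ) :
    limitExponent x = MvPolynomial.C (-(1 / 2)) * ∑ k : NZ q,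
        MvPolynomial.X k * MvPolynomial.X (negNZ k)
      + ∑ k : NZ q, MvPolynomial.C (charSum x k.1) * MvPolynomial.X k :=
  MvPolynomial.funext fun w => by
    rw [eval_limitExponent]
    simp [mul_comm]

theorem weightedNorm_limitExponent_le {r : NZ q → ℝ} (hr : ∀ k, 0 ≤ r k) (x : ZMod q → ℝ) :
    weightedNorm r (limitExponent x)
      ≤ 1 / 2 * ∑ k : NZ q, r k * r (negNZ k) + ∑ k : NZ q, ‖charSum x k.1‖ * r k := by
  have hX : ∀ k : NZ q, weightedNorm r (MvPolynomial.X k : MvPolynomial (NZ q) ℂ) = r k := by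
    intro k
    rw [MvPolynomial.X, weightedNorm_monomial, Finset.prod_eq_single k]
    · simp
    · intro b _ hb
      simp [hb.symm]
    · simp
  have hC : ∀ (c : ℂ) (p : MvPolynomial (NZ q) ℂ),
      weightedNorm r (MvPolynomial.C c * p) ≤ ‖c‖ * weightedNorm r p := by
    intro c p
    refine (weightedNorm_mul_le hr _ _).trans (le_of_eq ?_)
    rw [MvPolynomial.C_apply, weightedNorm_monomial]
    simp
  rw [limitExponent_eq]
  refine (weightedNorm_add_le hr _ _).trans (add_le_add ?_ ?_)
  · refine (hC _ _).trans ?_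
    have : ‖(-(1 / 2) : ℂ)‖ = 1 / 2 := by norm_num
    rw [this]
    refine mul_le_mul_of_nonneg_left ?_ (by norm_num)
    refine (weightedNorm_sum_le hr _ _).trans (Finset.sum_le_sum fun k _ => ?_)
    refine (weightedNorm_mul_le hr _ _).trans (le_of_eq ?_)
    rw [hX, hX]
  · refine (weightedNorm_sum_le hr _ _).trans (Finset.sum_le_sum fun k _ => ?_)
    refine (hC _ _).trans (le_of_eq ?_)
    rw [hX]

/-- The value at `w` of the generating function of the limit polynomials. -/
noncomputable def limitGenValue (x : ZMod q → ℝ) (w : NZ q → ℂ) : ℂ :=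
  Complex.exp (-(1 / 2) * ∑ k : NZ q, w k * w (negNZ k) + ∑ k : NZ q, w k * charSum x k.1)

theorem hasSum_limitQ (x : ZMod q → ℝ) (w : NZ q → ℂ) :
    HasSum (fun l => limitQ l x * ∏ k, w k ^ l k) (limitGenValue x w) := by
  rw [limitGenValue, ← eval_limitExponent]
  exact hasSum_coeff_expSeries (hasSubst_limitExponent x) w

theorem summable_norm_limitQ (x : ZMod q → ℝ) {r : NZ q → ℝ} (hr : ∀ k, 0 ≤ r k) :
    Summable fun l : NZ q →₀ ℕ => ‖limitQ l x‖ * ∏ k, r k ^ l k :=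
  (summable_norm_coeff_expSeries (hasSubst_limitExponent x) hr).1

theorem tsum_norm_limitQ_le (x : ZMod q → ℝ) {r : NZ q → ℝ} (hr : ∀ k, 0 ≤ r k) :
    ∑' l : NZ q →₀ ℕ, ‖limitQ l x‖ * ∏ k, r k ^ l k
      ≤ Real.exp (1 / 2 * ∑ k : NZ q, r k * r (negNZ k) + ∑ k : NZ q, ‖charSum x k.1‖ * r k) :=
  (summable_norm_coeff_expSeries (hasSubst_limitExponent x) hr).2.trans
    (Real.exp_le_exp.mpr (weightedNorm_limitExponent_le hr x))

end LimitPolynomials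

/-! ### Scaling limit of the Krawtchouk polynomials -/

section Krawtchouk

variable {q : ℕ} [NeZero q]

theorem eval_krawtchoukGen (w : NZ q → ℂ) (m : ZMod q → ℕ) :
    MvPolynomial.eval w (krawtchoukGen m) = ∏ j, (1 + formValue w j) ^ m j := by
  simp [krawtchoukGen, map_prod, eval_linForm]

theorem totalDegree_krawtchoukGen_le (m : ZMod q → ℕ) :
    (krawtchoukGen m).totalDegree ≤ ∑ j, m j := by
  have h1 : ∀ j : ZMod q, (1 + linForm j : MvPolynomial (NZ q) ℂ).totalDegree ≤ 1 := by
    intro j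
    refine (MvPolynomial.totalDegree_add _ _).trans (max_le (by simp) ?_)
    refine (MvPolynomial.totalDegree_finsetSum _ _).trans (Finset.sup_le fun k _ => ?_)
    refine (MvPolynomial.totalDegree_mul _ _).trans ?_
    simp
  refine (MvPolynomial.totalDegree_finsetProd _ _).trans (Finset.sum_le_sum fun j _ => ?_)
  refine (MvPolynomial.totalDegree_pow _ _).trans ?_
  nlinarith [h1 j]

theorem krawtchouk_eq_zero {m : ZMod q → ℕ} {l : NZ q →₀ ℕ} (h : ∑ j, m j < l.degree) :
    krawtchouk l m = 0 :=
  MvPolynomial.coeff_eq_zero_of_totalDegree_lt ((totalDegree_krawtchoukGen_le m).trans_lt h)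

/-- The power series with coefficients `Q_l(m) / s^{|l|}`; it is a finite sum. -/
theorem hasSum_krawtchouk_div (s : ℝ) (w : NZ q → ℂ) (m : ZMod q → ℕ) :
    HasSum (fun l => krawtchouk l m / (s : ℂ) ^ l.degree * ∏ k, w k ^ l k)
      (∏ j, (1 + formValue w j / s) ^ m j) := by
  have h := hasSum_eval (fun k => (s : ℂ)⁻¹ * w k) (krawtchoukGen m)
  rw [eval_krawtchoukGen] at h
  simp only [formValue_const_mul] at h
  simp only [div_eq_inv_mul]
  refine h.congr_fun fun l => ?_
  rw [krawtchouk]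
  simp only [mul_pow, Finset.prod_mul_distrib]
  rw [Finset.prod_pow_eq_pow_sum, ← Finsupp.degree_eq_sum, inv_pow]
  ring

theorem summable_krawtchouk (c : (NZ q →₀ ℕ) → ℝ) (m : ZMod q → ℕ) (s : ℝ) :
    Summable fun l => ‖krawtchouk l m / (s : ℂ) ^ l.degree‖ * c l := by
  refine summable_of_ne_finset_zero (s := (krawtchoukGen m).support) fun l hl => ?_
  rw [krawtchouk, MvPolynomial.notMem_support_iff.mp hl]
  simp

theorem norm_one_add_le_exp (z : ℂ) : ‖1 + z‖ ≤ Real.exp (z.re + ‖z‖ ^ 2 / 2) := by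
  refine abs_le_of_sq_le_sq' ?_ (Real.exp_pos _).le |>.2
  rw [← Real.exp_nat_mul, Complex.sq_norm, Complex.sq_norm, Complex.normSq_apply,
    Complex.normSq_apply]
  refine le_trans (le_of_eq ?_) (Real.add_one_le_exp _)
  simp
  ring

/-- The centring of the counts removes the divergent linear term: `∑_j m_j ℓ_j / √d` only involves
the centred and scaled counts. -/
theorem sum_count_mul_formValue {d : ℕ} {m : ZMod q → ℕ} (hm : ∑ j, m j = d) (w : NZ q → ℂ) :
    ∑ j, (m j : ℂ) * (formValue w j / (Real.sqrt d : ℝ))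
      = ∑ k : NZ q, w k * charSum (extend (scaledCounts d m)) k.1 := by
  rw [← sum_mul_formValue]
  simp only [extend_scaledCounts hm]
  have h : ∀ j : ZMod q, (((((m j : ℝ) - (d : ℝ) / q) / Real.sqrt d : ℝ)) : ℂ) * formValue w j
      = (m j : ℂ) * (formValue w j / (Real.sqrt d : ℝ))
        - ((d : ℂ) / q / (Real.sqrt d : ℝ)) * formValue w j := by
    intro j
    push_cast
    ring
  simp only [h]
  rw [Finset.sum_sub_distrib, ← Finset.mul_sum, sum_formValue, mul_zero, sub_zero]

/-- A bound on the Krawtchouk generating function that is uniform in `d`: the first-order terms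
only see the scaled counts, and the second-order terms add up to `∑_j m_j / d = 1`. -/
theorem norm_prod_one_add_le {d : ℕ} (hd : 0 < d) {m : ZMod q → ℕ} (hm : ∑ j, m j = d)
    (w : NZ q → ℂ) :
    ‖∏ j, (1 + formValue w j / (Real.sqrt d : ℝ)) ^ m j‖
      ≤ Real.exp (∑ k : NZ q, ‖w k‖ * ‖charSum (extend (scaledCounts d m)) k.1‖
          + (∑ k, ‖w k‖) ^ 2 / 2) := by
  set u : ZMod q → ℂ := fun j => formValue w j / (Real.sqrt d : ℝ) with hu
  have h1 : ‖∏ j, (1 + u j) ^ m j‖ ≤ ∏ j, Real.exp (m j * ((u j).re + ‖u j‖ ^ 2 / 2)) := by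
    rw [norm_prod]
    refine Finset.prod_le_prod (fun _ _ => norm_nonneg _) fun j _ => ?_
    rw [norm_pow, Real.exp_nat_mul]
    exact pow_le_pow_left₀ (norm_nonneg _) (norm_one_add_le_exp _) _
  refine h1.trans ?_
  rw [← Real.exp_sum, Real.exp_le_exp]
  simp only [mul_add]
  rw [Finset.sum_add_distrib]
  refine add_le_add ?_ ?_
  · have h2 : ∑ j, (m j : ℝ) * (u j).re = (∑ j, (m j : ℂ) * u j).re := by
      rw [Complex.re_sum]
      exact Finset.sum_congr rfl fun j _ => by simp
    rw [h2, hu, sum_count_mul_formValue hm]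
    refine (Complex.re_le_norm _).trans ((norm_sum_le _ _).trans (le_of_eq ?_))
    simp only [norm_mul]
  · have h3 : ∀ j, ‖u j‖ ^ 2 ≤ (∑ k, ‖w k‖) ^ 2 / d := by
      intro j
      rw [hu]
      simp only [norm_div, div_pow, Complex.norm_real, Real.norm_eq_abs, sq_abs]
      rw [Real.sq_sqrt (Nat.cast_nonneg d)]
      gcongr
      exact norm_formValue_le w j
    have hd' : (0 : ℝ) < d := by exact_mod_cast hd
    calc ∑ j, (m j : ℝ) * (‖u j‖ ^ 2 / 2)
        ≤ ∑ j, (m j : ℝ) * ((∑ k, ‖w k‖) ^ 2 / d / 2) := by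
          refine Finset.sum_le_sum fun j _ => ?_
          gcongr
          exact h3 j
      _ = (∑ j, (m j : ℝ)) * ((∑ k, ‖w k‖) ^ 2 / d / 2) := by rw [Finset.sum_mul]
      _ = _ := by
          have : ∑ j, (m j : ℝ) = d := by exact_mod_cast hm
          rw [this]
          field_simp

variable {x : NZ q → ℝ} {m : ℕ → ZMod q → ℕ}

theorem tendsto_sqrt_natCast : Tendsto (fun d : ℕ => Real.sqrt d) atTop atTop :=
  Real.tendsto_sqrt_atTop.comp tendsto_natCast_atTop_atTop

theorem tendsto_charSum (hx : Tendsto (fun d => scaledCounts d (m d)) atTop (𝓝 x)) (k : ZMod q) :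
    Tendsto (fun d => charSum (extend (scaledCounts d (m d))) k) atTop
      (𝓝 (charSum (extend x) k)) :=
  (((continuous_charSum k).comp continuous_extend).tendsto x).comp hx

theorem exists_bound_charSum (hx : Tendsto (fun d => scaledCounts d (m d)) atTop (𝓝 x)) :
    ∃ B : ℝ, ∀ᶠ d in atTop, ∀ k : NZ q, ‖charSum (extend (scaledCounts d (m d))) k.1‖ ≤ B := by
  refine ⟨∑ k : NZ q, (‖charSum (extend x) k.1‖ + 1), eventually_all.mpr fun k => ?_⟩
  filter_upwards [(tendsto_charSum hx k.1).norm.eventually_le_const (lt_add_one _)] with d hd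
  exact hd.trans (Finset.single_le_sum (f := fun k : NZ q => ‖charSum (extend x) k.1‖ + 1)
    (fun k _ => by positivity) (Finset.mem_univ k))

theorem exists_bound_prod_one_add (hm : ∀ d, ∑ j, m d j = d)
    (hx : Tendsto (fun d => scaledCounts d (m d)) atTop (𝓝 x)) (ρ : ℝ) :
    ∃ C : ℝ, ∀ᶠ d : ℕ in atTop, ∀ w : NZ q → ℂ, (∀ k, ‖w k‖ = ρ) →
      ‖∏ j, (1 + formValue w j / (Real.sqrt d : ℝ)) ^ m d j‖ ≤ C := by
  obtain ⟨B, hB⟩ := exists_bound_charSum hx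
  refine ⟨Real.exp (∑ k : NZ q, |ρ| * B + (∑ k : NZ q, ρ) ^ 2 / 2), ?_⟩
  filter_upwards [hB, eventually_gt_atTop 0] with d hd hd0 w hw
  refine (norm_prod_one_add_le hd0 (hm d) w).trans (Real.exp_le_exp.mpr ?_)
  simp only [hw]
  gcongr with k
  · exact le_abs_self ρ
  · exact hd k

/-- Uniformly in `d`, the scaled polynomials `d^{-|l|/2} Q_l(m^{(d)})` decay in `l` faster than any
geometric sequence. -/
theorem exists_bound_krawtchouk (hm : ∀ d, ∑ j, m d j = d)
    (hx : Tendsto (fun d => scaledCounts d (m d)) atTop (𝓝 x)) {ρ : ℝ} (hρ : 0 ≤ ρ) :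
    ∃ C : ℝ, ∀ᶠ d : ℕ in atTop, ∀ l : NZ q →₀ ℕ,
      ‖krawtchouk l (m d) / ((Real.sqrt d : ℝ) : ℂ) ^ l.degree‖ * ρ ^ l.degree ≤ C := by
  obtain ⟨C, hC⟩ := exists_bound_prod_one_add hm hx ρ
  refine ⟨C, ?_⟩
  filter_upwards [hC] with d hd l
  exact norm_coeff_mul_pow_le hρ (summable_krawtchouk _ _ _)
    (fun w _ => hasSum_krawtchouk_div _ w (m d)) hd l

theorem tendsto_count_div (hm : ∀ d, ∑ j, m d j = d)
    (hx : Tendsto (fun d => scaledCounts d (m d)) atTop (𝓝 x)) (j : ZMod q) :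
    Tendsto (fun d : ℕ => (m d j : ℝ) / d) atTop (𝓝 (1 / q)) := by
  have h1 : Tendsto (fun d => extend (scaledCounts d (m d)) j) atTop (𝓝 (extend x j)) :=
    ((continuous_apply j).tendsto _).comp ((continuous_extend.tendsto x).comp hx)
  have h2 := (h1.mul (tendsto_inv_atTop_zero.comp tendsto_sqrt_natCast)).const_add (1 / (q : ℝ))
  rw [mul_zero, add_zero] at h2
  refine h2.congr' ?_
  filter_upwards [eventually_gt_atTop 0] with d hd
  have hd' : (0 : ℝ) < d := by exact_mod_cast hd
  have hq : (q : ℝ) ≠ 0 := by exact_mod_cast NeZero.ne q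
  simp only [extend_scaledCounts (hm d), Function.comp]
  rw [div_mul_eq_mul_div, ← div_eq_mul_inv, div_div, Real.mul_self_sqrt hd'.le]
  field_simp
  ring

/-- If `u_j → 0` with `s u_j → z_j` and `m_j / s² → p_j`, then `∏ (1 + u_j)^{m_j}` behaves like
`exp (∑ m_j u_j - ½ ∑ p_j z_j²)`. -/
theorem tendsto_prod_one_add_pow {α J : Type*} [Fintype J] {F : Filter α} {s : α → ℝ}
    (hs : Tendsto s F atTop) {N : α → J → ℕ} {u : α → J → ℂ} {p : J → ℝ} {z : J → ℂ} {a : ℂ}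
    (hN : ∀ j, Tendsto (fun i => (N i j : ℝ) / s i ^ 2) F (𝓝 (p j)))
    (hu : ∀ j, Tendsto (fun i => (s i : ℂ) * u i j) F (𝓝 (z j)))
    (ha : Tendsto (fun i => ∑ j, (N i j : ℂ) * u i j) F (𝓝 a)) :
    Tendsto (fun i => ∏ j, (1 + u i j) ^ N i j) F
      (𝓝 (Complex.exp (a + ∑ j, (p j : ℂ) * (-z j ^ 2 / 2)))) := by
  have hs0 : ∀ᶠ i in F, s i ≠ 0 := (hs.eventually_gt_atTop 0).mono fun i hi => hi.ne'
  have h1 : ∀ j, Tendsto (fun i => ((((N i j : ℝ) / s i ^ 2 : ℝ)) : ℂ) *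
      ((s i : ℂ) ^ 2 * (Complex.log (1 + u i j) - u i j))) F (𝓝 ((p j : ℂ) * (-z j ^ 2 / 2))) :=
    fun j => ((Complex.continuous_ofReal.tendsto _).comp (hN j)).mul
      (tendsto_sq_mul_log_one_add_sub hs (hu j))
  have h2 := (Complex.continuous_exp.tendsto _).comp
    (ha.add (tendsto_finsetSum Finset.univ fun j _ => h1 j))
  refine h2.congr' ?_
  have hu0 : ∀ᶠ i in F, ∀ j, 1 + u i j ≠ 0 := by
    refine eventually_all.mpr fun j => ?_
    have hinv : Tendsto (fun i => ((s i : ℂ))⁻¹) F (𝓝 0) := by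
      have := (Complex.continuous_ofReal.tendsto 0).comp (tendsto_inv_atTop_zero.comp hs)
      simpa [Function.comp_def] using this
    have h3 : Tendsto (fun i => 1 + ((s i : ℂ))⁻¹ * ((s i : ℂ) * u i j)) F (𝓝 1) := by
      simpa using (hinv.mul (hu j)).const_add 1
    filter_upwards [h3.eventually_ne one_ne_zero, hs0] with i hi hi0
    rwa [inv_mul_cancel_left₀ (by exact_mod_cast hi0)] at hi
  filter_upwards [hs0, hu0] with i hi hi'
  have hi0 : (s i : ℂ) ≠ 0 := by exact_mod_cast hi
  simp only [Function.comp]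
  rw [← Finset.sum_add_distrib, Complex.exp_sum]
  refine Finset.prod_congr rfl fun j _ => ?_
  have : (N i j : ℂ) * u i j + (((N i j : ℝ) / s i ^ 2 : ℝ) : ℂ) *
      ((s i : ℂ) ^ 2 * (Complex.log (1 + u i j) - u i j)) = N i j * Complex.log (1 + u i j) := by
    push_cast
    field_simp
    ring
  rw [this, Complex.exp_nat_mul, Complex.exp_log (hi' j)]

theorem tendsto_prod_one_add_limitGenValue (hm : ∀ d, ∑ j, m d j = d)
    (hx : Tendsto (fun d => scaledCounts d (m d)) atTop (𝓝 x)) (w : NZ q → ℂ) :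
    Tendsto (fun d : ℕ => ∏ j, (1 + formValue w j / (Real.sqrt d : ℝ)) ^ m d j) atTop
      (𝓝 (limitGenValue (extend x) w)) := by
  have hq : (q : ℂ) ≠ 0 := by exact_mod_cast NeZero.ne q
  have h := tendsto_prod_one_add_pow (F := atTop) (s := fun d : ℕ => Real.sqrt d)
    tendsto_sqrt_natCast (N := m) (u := fun d j => formValue w j / (Real.sqrt d : ℝ))
    (p := fun _ => 1 / q) (z := formValue w) (a := ∑ k : NZ q, w k * charSum (extend x) k.1)
    (fun j => by
      refine (tendsto_count_div hm hx j).congr fun d => ?_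
      rw [Real.sq_sqrt (Nat.cast_nonneg d)])
    (fun j => by
      refine tendsto_const_nhds.congr' ?_
      filter_upwards [tendsto_sqrt_natCast.eventually_gt_atTop 0] with d hd
      have : ((Real.sqrt d : ℝ) : ℂ) ≠ 0 := by exact_mod_cast hd.ne'
      field_simp)
    (by
      simp only [fun d => sum_count_mul_formValue (hm d) w]
      exact tendsto_finsetSum _ fun k _ => (tendsto_charSum hx k.1).const_mul _)
  convert h using 2
  rw [limitGenValue]
  congr 1
  rw [add_comm]
  congr 1
  have : ∀ j : ZMod q, ((1 / q : ℝ) : ℂ) * (-formValue w j ^ 2 / 2)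
      = (-(1 / (2 * (q : ℂ)))) * formValue w j ^ 2 := by
    intro j
    push_cast
    field_simp
  simp only [this]
  rw [← Finset.mul_sum, sum_formValue_sq]
  field_simp

/-- The scaled Krawtchouk polynomials converge to the limit polynomials. -/
theorem tendsto_krawtchouk (hm : ∀ d, ∑ j, m d j = d)
    (hx : Tendsto (fun d => scaledCounts d (m d)) atTop (𝓝 x)) (l : NZ q →₀ ℕ) :
    Tendsto (fun d : ℕ => krawtchouk l (m d) / ((Real.sqrt d : ℝ) : ℂ) ^ l.degree) atTop
      (𝓝 (limitQ l (extend x))) := by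
  obtain ⟨C, hC⟩ := exists_bound_prod_one_add hm hx 1
  refine tendsto_coeff (a := fun d l => krawtchouk l (m d) / ((Real.sqrt d : ℝ) : ℂ) ^ l.degree)
    (b := fun l => limitQ l (extend x))
    (F := fun d w => ∏ j, (1 + formValue w j / (Real.sqrt d : ℝ)) ^ m d j)
    (Eventually.of_forall fun d => by
      simpa using summable_krawtchouk (fun _ => 1) (m d) (Real.sqrt d))
    (by simpa using summable_norm_limitQ (extend x) (r := fun _ => 1) (fun _ => zero_le_one))
    (Eventually.of_forall fun d w _ => hasSum_krawtchouk_div _ w (m d))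
    (fun w _ => hasSum_limitQ (extend x) w)
    (Eventually.of_forall fun d => ?_) hC
    (fun w _ => tendsto_prod_one_add_limitGenValue hm hx w) l
  refine continuous_finsetProd _ fun j _ => ?_
  exact (continuous_const.add ((continuous_formValue j).div_const _)).pow _

end Krawtchouk

/-! ### The walk on `ℤ_q^d` and its grouping by counts -/

section Combinatorics

variable {q : ℕ} [NeZero q] {d : ℕ}

/-- The vector of counts of a configuration `x ∈ ℤ_q^d`. -/
def counts (x : Fin d → ZMod q) (j : ZMod q) : ℕ := (Finset.univ.filter fun i => x i = j).card

/-- The counts of the nonzero residues, as a multi-index. -/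
noncomputable def countsIndex (r : Fin d → ZMod q) : NZ q →₀ ℕ :=
  Finsupp.equivFunOnFinite.symm fun k => counts r k.1

/-- The character of `ℤ_q^d` with frequency `r`. -/
noncomputable def chi (r x : Fin d → ZMod q) : ℂ := ∏ i, theta q (r i) (x i)

theorem sum_counts (x : Fin d → ZMod q) : ∑ j, counts x j = d := by
  have h := Finset.card_eq_sum_card_fiberwise (f := x) (s := Finset.univ) (t := Finset.univ)
    (fun _ _ => Finset.mem_coe.mpr (Finset.mem_univ _))
  simpa [counts] using h.symm

theorem countsIndex_apply (r : Fin d → ZMod q) (k : NZ q) : countsIndex r k = counts r k.1 := rfl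

theorem degree_countsIndex (r : Fin d → ZMod q) : (countsIndex r).degree + counts r 0 = d := by
  rw [Finsupp.degree_eq_sum]
  have h := sum_nonzero fun j => (counts r j : ℤ)
  have hs : ∑ j, (counts r j : ℤ) = d := by exact_mod_cast sum_counts r
  rw [hs] at h
  have h' : ((∑ k : NZ q, countsIndex r k : ℕ) : ℤ) = d - counts r 0 := by
    rw [← h]
    push_cast
    rfl
  omega

theorem counts_eq_of_countsIndex_eq {r r' : Fin d → ZMod q} (h : countsIndex r = countsIndex r') :
    counts r = counts r' := by
  ext j
  by_cases hj : j = 0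
  · subst hj
    have h1 := degree_countsIndex r
    have h2 := degree_countsIndex r'
    rw [h] at h1
    omega
  · exact DFunLike.congr_fun h ⟨j, hj⟩

theorem countsIndex_eq_of_counts_eq {r r' : Fin d → ZMod q} (h : counts r = counts r') :
    countsIndex r = countsIndex r' := by
  ext k
  rw [countsIndex_apply, countsIndex_apply, h]

theorem counts_comp {q d : ℕ} (x : Fin d → ZMod q) (σ : Equiv.Perm (Fin d)) :
    counts (x ∘ σ) = counts x := by
  ext j
  refine Finset.card_bij (fun i _ => σ i) ?_ ?_ ?_
  · intro i hi
    simpa using hi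
  · intro a _ b _ h
    exact σ.injective h
  · intro b hb
    exact ⟨σ.symm b, by simpa using hb, by simp⟩

/-- Configurations with the same counts differ by a permutation of the coordinates. -/
theorem exists_comp_eq_of_counts_eq {q d : ℕ} {x y : Fin d → ZMod q} (h : counts y = counts x) :
    ∃ σ : Equiv.Perm (Fin d), x ∘ σ = y := by
  have e : ∀ j : ZMod q, Nonempty ({i // y i = j} ≃ {i // x i = j}) := fun j => by
    rw [← Fintype.card_eq, Fintype.card_subtype, Fintype.card_subtype]
    exact congrFun h j
  let e := fun j => (e j).some
  refine ⟨(Equiv.sigmaFiberEquiv y).symm.trans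
    ((Equiv.sigmaCongrRight e).trans (Equiv.sigmaFiberEquiv x)), ?_⟩
  funext i
  exact (e (y i) ⟨i, rfl⟩).2

/-- Every vector of counts of total `d` is the vector of counts of a configuration. -/
theorem exists_counts_eq {n : ZMod q → ℕ} (hn : ∑ j, n j = d) :
    ∃ x : Fin d → ZMod q, counts x = n := by
  have hc : Fintype.card (Fin d) = Fintype.card (Σ j : ZMod q, Fin (n j)) := by
    simp [hn]
  let e := Fintype.equivOfCardEq hc
  refine ⟨fun i => (e i).1, ?_⟩
  ext j
  have : (Finset.univ.filter fun i => (e i).1 = j).card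
      = (Finset.univ : Finset (Fin (n j))).card := by
    symm
    refine Finset.card_bij (fun a _ => e.symm ⟨j, a⟩) ?_ ?_ ?_
    · intro a _
      simp
    · intro a _ b _ h
      simpa using h
    · intro i hi
      simp only [Finset.mem_filter, Finset.mem_univ, true_and] at hi
      subst hi
      exact ⟨(e i).2, Finset.mem_univ _, by simp⟩
  rw [counts, this]
  simp

theorem card_comp_eq {x y : Fin d → ZMod q} (h : counts y = counts x) :
    (Finset.univ.filter fun σ : Equiv.Perm (Fin d) => x ∘ σ = y).card
      = ∏ j, (counts x j).factorial := by
  obtain ⟨τ, rfl⟩ := exists_comp_eq_of_counts_eq h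
  have h1 : (Finset.univ.filter fun σ : Equiv.Perm (Fin d) => x ∘ σ = x ∘ τ).card
      = (Finset.univ.filter fun σ : Equiv.Perm (Fin d) => x ∘ σ = x).card := by
    refine Finset.card_bij (fun σ _ => σ * τ⁻¹) ?_ ?_ ?_
    · intro σ hσ
      simp only [Finset.mem_filter, Finset.mem_univ, true_and] at hσ ⊢
      ext i
      have := congrFun hσ (τ⁻¹ i)
      simpa using this
    · intro a _ b _ hab
      simpa using hab
    · intro σ hσ
      simp only [Finset.mem_filter, Finset.mem_univ, true_and] at hσ
      refine ⟨σ * τ, ?_, by simp⟩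
      simp only [Finset.mem_filter, Finset.mem_univ, true_and]
      ext i
      exact congrFun hσ (τ i)
  rw [h1, ← Fintype.card_subtype, DomMulAct.stabilizer_card]
  refine Finset.prod_congr rfl fun j _ => ?_
  rw [Fintype.card_subtype, counts]

/-- Summing over all permutations of a configuration is summing over its orbit, with the order of
the stabilizer as multiplicity. -/
theorem sum_perm_comp (x : Fin d → ZMod q) (g : (Fin d → ZMod q) → ℂ) :
    ∑ σ : Equiv.Perm (Fin d), g (x ∘ σ)
      = (∏ j, ((counts x j).factorial : ℂ)) *
        ∑ y ∈ Finset.univ.filter (fun y => counts y = counts x), g y := by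
  rw [← Finset.sum_fiberwise_of_maps_to (s := Finset.univ)
    (t := Finset.univ.filter fun y => counts y = counts x)
    (g := fun σ : Equiv.Perm (Fin d) => x ∘ σ)
    (fun σ _ => by simp [counts_comp]), Finset.mul_sum]
  refine Finset.sum_congr rfl fun y hy => ?_
  have hy' : counts y = counts x := by simpa using hy
  rw [Finset.sum_congr rfl (g := fun _ => g y)
    (fun σ hσ => by rw [(Finset.mem_filter.mp hσ).2]), Finset.sum_const, card_comp_eq hy',
    nsmul_eq_mul]
  push_cast
  rfl

theorem prod_comp_eq_prod_pow_counts {M : Type*} [CommMonoid M] (f : ZMod q → M)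
    (x : Fin d → ZMod q) : ∏ i, f (x i) = ∏ j, f j ^ counts x j := by
  rw [← Finset.prod_fiberwise (s := Finset.univ) (g := x) (f := fun i => f (x i))]
  refine Finset.prod_congr rfl fun j _ => ?_
  rw [Finset.prod_congr rfl (g := fun _ => f j)
    (fun i hi => by rw [(Finset.mem_filter.mp hi).2]), Finset.prod_const, counts]

/-- The exponent of the indeterminate `w_k`, where `w_0 = 1`. -/
noncomputable def unitIndex (k : ZMod q) : NZ q →₀ ℕ :=
  if h : k = 0 then 0 else Finsupp.single ⟨k, h⟩ 1

theorem sum_unitIndex (r : Fin d → ZMod q) : ∑ i, unitIndex (r i) = countsIndex r := by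
  ext k
  rw [Finsupp.finsetSum_apply, countsIndex_apply, counts, Finset.card_filter]
  refine Finset.sum_congr rfl fun i _ => ?_
  by_cases h : r i = 0
  · have : (0 : ZMod q) ≠ k.1 := fun h => k.2 h.symm
    simp [unitIndex, h, this]
  · simp only [unitIndex, h, dite_false, Finsupp.single_apply]
    congr 1
    simp [Subtype.ext_iff]

theorem one_add_linForm (j : ZMod q) :
    1 + linForm j = ∑ k : ZMod q, MvPolynomial.monomial (unitIndex k) (theta q k j) := by
  have h := sum_nonzero fun k : ZMod q =>
    (MvPolynomial.monomial (unitIndex k) (theta q k j) : MvPolynomial (NZ q) ℂ)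
  have h0 : (MvPolynomial.monomial (unitIndex 0) (theta q 0 j) : MvPolynomial (NZ q) ℂ) = 1 := by
    simp [unitIndex]
  rw [h0] at h
  rw [eq_sub_iff_add_eq'.mp h.symm.symm |>.symm, linForm]
  congr 1
  refine Finset.sum_congr rfl fun k _ => ?_
  simp only [unitIndex, k.2, dite_false]
  rw [MvPolynomial.C_mul_X_eq_monomial]

theorem krawtchoukGen_counts (x : Fin d → ZMod q) :
    krawtchoukGen (counts x)
      = ∑ r : Fin d → ZMod q, MvPolynomial.monomial (countsIndex r) (chi r x) := by
  rw [krawtchoukGen, ← prod_comp_eq_prod_pow_counts (fun j => 1 + linForm j) x]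
  simp only [one_add_linForm]
  rw [Finset.prod_univ_sum, Fintype.piFinset_univ]
  refine Finset.sum_congr rfl fun r _ => ?_
  rw [← sum_unitIndex, MvPolynomial.monomial_sum_index, chi, map_prod, ← Finset.prod_mul_distrib]
  refine Finset.prod_congr rfl fun i _ => ?_
  rw [MvPolynomial.C_mul_monomial, mul_one]

/-- The Krawtchouk polynomial `Q_l` at the counts of `x` is the sum of the characters of type `l`
at `x`. -/
theorem krawtchouk_counts (l : NZ q →₀ ℕ) (x : Fin d → ZMod q) :
    krawtchouk l (counts x) = ∑ r ∈ Finset.univ.filter (fun r => countsIndex r = l), chi r x := by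
  classical
  rw [krawtchouk, krawtchoukGen_counts, MvPolynomial.coeff_sum, Finset.sum_filter]
  exact Finset.sum_congr rfl fun r _ => by rw [MvPolynomial.coeff_monomial]

theorem chi_add (r x y : Fin d → ZMod q) : chi r (x + y) = chi r x * chi r y := by
  simp [chi, theta_add_right, Finset.prod_mul_distrib]

theorem norm_chi (r x : Fin d → ZMod q) : ‖chi r x‖ = 1 := by
  simp [chi, norm_prod]

theorem chi_comp {q d : ℕ} (r x : Fin d → ZMod q) (σ : Equiv.Perm (Fin d)) :
    chi r (x ∘ σ) = chi (r ∘ ⇑σ⁻¹) x := by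
  rw [chi, chi, ← Equiv.prod_comp σ (fun i => theta q ((r ∘ ⇑σ⁻¹) i) (x i))]
  simp

theorem prod_factorial_counts (r : Fin d → ZMod q) :
    ∏ j, ((counts r j).factorial : ℂ) = d.factorial * hNorm d (countsIndex r) := by
  have hd : (d.factorial : ℂ) ≠ 0 := by exact_mod_cast d.factorial_ne_zero
  have h0 : d - (countsIndex r).degree = counts r 0 := by
    have := degree_countsIndex r
    omega
  have h1 : ∏ j ∈ Finset.univ.erase (0 : ZMod q), ((counts r j).factorial : ℂ)
      = ∏ k : NZ q, ((countsIndex r k).factorial : ℂ) :=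
    Finset.prod_subtype _ (by simp) fun j => ((counts r j).factorial : ℂ)
  rw [hNorm, h0, ← Finset.mul_prod_erase _ _ (Finset.mem_univ (0 : ZMod q)), h1]
  push_cast
  field_simp

theorem sum_perm_chi (r x : Fin d → ZMod q) :
    ∑ σ : Equiv.Perm (Fin d), chi r (x ∘ σ)
      = d.factorial * (hNorm d (countsIndex r) * krawtchouk (countsIndex r) (counts x)) := by
  simp only [chi_comp]
  have hinv : ∑ σ : Equiv.Perm (Fin d), chi (r ∘ ⇑σ⁻¹) x
      = ∑ σ : Equiv.Perm (Fin d), chi (r ∘ σ) x :=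
    Equiv.sum_comp (Equiv.inv (Equiv.Perm (Fin d))) fun σ => chi (r ∘ σ) x
  rw [hinv, sum_perm_comp r fun s => chi s x, prod_factorial_counts, krawtchouk_counts, mul_assoc]
  congr 3
  ext s
  simp only [Finset.mem_filter, Finset.mem_univ, true_and]
  exact ⟨countsIndex_eq_of_counts_eq, counts_eq_of_countsIndex_eq⟩

theorem exists_countsIndex_eq {l : NZ q →₀ ℕ} (hl : l.degree ≤ d) :
    ∃ r : Fin d → ZMod q, countsIndex r = l := by
  let n : ZMod q → ℕ := fun j => if h : j = 0 then d - l.degree else l ⟨j, h⟩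
  have hn : ∑ j, n j = d := by
    have h := sum_nonzero fun j => (n j : ℤ)
    have h1 : ∑ k : NZ q, (n k.1 : ℤ) = l.degree := by
      rw [Finsupp.degree_eq_sum]
      push_cast
      exact Finset.sum_congr rfl fun k _ => by simp [n, k.2]
    have h0 : n 0 = d - l.degree := by simp [n]
    rw [h1, h0] at h
    have : ((∑ j, n j : ℕ) : ℤ) = d := by
      push_cast
      omega
    exact_mod_cast this
  obtain ⟨r, hr⟩ := exists_counts_eq hn
  refine ⟨r, ?_⟩
  ext k
  rw [countsIndex_apply, hr]
  simp [n, k.2]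

/-- `h_l Q_l` is an average of characters, hence bounded by one. -/
theorem norm_hNorm_mul_krawtchouk_le {n : ZMod q → ℕ} (hn : ∑ j, n j = d) (l : NZ q →₀ ℕ) :
    ‖(hNorm d l : ℂ) * krawtchouk l n‖ ≤ 1 := by
  rcases lt_or_ge d l.degree with hl | hl
  · rw [krawtchouk_eq_zero (hn.trans_lt hl)]
    simp
  · obtain ⟨r, rfl⟩ := exists_countsIndex_eq hl
    obtain ⟨x, rfl⟩ := exists_counts_eq hn
    have h := congrArg norm (sum_perm_chi r x)
    have hd : (0 : ℝ) < d.factorial := by exact_mod_cast d.factorial_pos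
    have h1 : ‖∑ σ : Equiv.Perm (Fin d), chi r (x ∘ σ)‖ ≤ d.factorial := by
      refine (norm_sum_le _ _).trans (le_of_eq ?_)
      simp [norm_chi, Fintype.card_perm]
    rw [h, norm_mul, Complex.norm_natCast] at h1
    exact le_of_mul_le_mul_left (by linarith) hd

/-- A chosen configuration with counts `n`, when `n` has total `d`. -/
noncomputable def configuration (d : ℕ) (n : ZMod q → ℕ) : Fin d → ZMod q :=
  open Classical in
  if h : ∑ j, n j = d then (exists_counts_eq h).choose else 0

theorem counts_configuration {n : ZMod q → ℕ} (hn : ∑ j, n j = d) :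
    counts (configuration d n) = n := by
  rw [configuration, dif_pos hn]
  exact (exists_counts_eq hn).choose_spec

/-- The probability that a configuration with counts `m`, moved by a uniformly random rearrangement
of increments with counts `v`, has counts `n`. -/
noncomputable def walkProb (d : ℕ) (v m n : ZMod q → ℕ) : ℝ :=
  open Classical in
  ((Finset.univ.filter fun σ : Equiv.Perm (Fin d) =>
    counts (configuration d m + configuration d v ∘ σ) = n).card : ℝ) / d.factorial

theorem walkProb_nonneg (d : ℕ) (v m n : ZMod q → ℕ) : 0 ≤ walkProb d v m n := by
  unfold walkProb
  positivity

theorem sum_walkProb_mul (d : ℕ) (v m : ZMod q → ℕ) (g : (ZMod q → ℕ) → ℂ) :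
    ∑ n ∈ Finset.piAntidiag Finset.univ d, (walkProb d v m n : ℂ) * g n
      = (∑ σ : Equiv.Perm (Fin d), g (counts (configuration d m + configuration d v ∘ σ)))
        / d.factorial := by
  classical
  rw [← Finset.sum_fiberwise_of_maps_to (s := Finset.univ)
    (t := Finset.piAntidiag Finset.univ d)
    (g := fun σ : Equiv.Perm (Fin d) => counts (configuration d m + configuration d v ∘ σ))
    (fun σ _ => by simp [Finset.mem_piAntidiag, sum_counts]), Finset.sum_div]
  refine Finset.sum_congr rfl fun n _ => ?_
  rw [Finset.sum_congr rfl (g := fun _ => g n)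
    (fun σ hσ => by rw [(Finset.mem_filter.mp hσ).2]), Finset.sum_const, walkProb, nsmul_eq_mul]
  push_cast
  ring_nf

theorem sum_walkProb (d : ℕ) (v m : ZMod q → ℕ) :
    ∑ n ∈ Finset.piAntidiag Finset.univ d, walkProb d v m n = 1 := by
  have h := sum_walkProb_mul d v m fun _ => 1
  have hd : (d.factorial : ℂ) ≠ 0 := by exact_mod_cast d.factorial_ne_zero
  simp only [mul_one, Finset.sum_const, Finset.card_univ, Fintype.card_perm, Fintype.card_fin,
    nsmul_eq_mul] at h
  rw [div_self hd] at h
  exact_mod_cast h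

/-- The Krawtchouk polynomials are eigenfunctions of the walk. -/
theorem sum_walkProb_mul_krawtchouk {v m : ZMod q → ℕ} (hv : ∑ j, v j = d) (hm : ∑ j, m j = d)
    (l : NZ q →₀ ℕ) :
    ∑ n ∈ Finset.piAntidiag Finset.univ d, (walkProb d v m n : ℂ) * krawtchouk l n
      = hNorm d l * krawtchouk l v * krawtchouk l m := by
  have hd : (d.factorial : ℂ) ≠ 0 := by exact_mod_cast d.factorial_ne_zero
  rw [sum_walkProb_mul]
  simp only [krawtchouk_counts, chi_add]
  rw [Finset.sum_comm, div_eq_iff hd]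
  have h : ∀ r ∈ Finset.univ.filter (fun r : Fin d → ZMod q => countsIndex r = l),
      ∑ σ : Equiv.Perm (Fin d), chi r (configuration d m) * chi r (configuration d v ∘ σ)
      = d.factorial * (hNorm d l * krawtchouk l v) * chi r (configuration d m) := by
    intro r hr
    have hr' : countsIndex r = l := by simpa using hr
    rw [← Finset.mul_sum, sum_perm_chi, hr', counts_configuration hv]
    ring
  rw [Finset.sum_congr rfl h, ← Finset.mul_sum, ← krawtchouk_counts, counts_configuration hm]
  ring

/-- Orthogonality of the characters of `ℤ_q^d`. -/
theorem sum_chi_mul_conj (x y : Fin d → ZMod q) :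
    ∑ r, chi r x * (starRingEnd ℂ) (chi r y) = if y = x then (q : ℂ) ^ d else 0 := by
  have h1 : ∀ r, chi r x * (starRingEnd ℂ) (chi r y) = ∏ i, theta q (r i) (x i - y i) := by
    intro r
    simp only [chi, map_prod, ← theta_neg_right, ← Finset.prod_mul_distrib, ← theta_add_right,
      sub_eq_add_neg]
  simp only [h1]
  have h2 := Finset.prod_univ_sum (fun _ : Fin d => (Finset.univ : Finset (ZMod q)))
    fun i k => theta q k (x i - y i)
  rw [Fintype.piFinset_univ] at h2
  rw [← h2]
  simp only [sum_theta_right, sub_eq_zero]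
  split_ifs with h
  · simp [h]
  · obtain ⟨i, hi⟩ := Function.ne_iff.mp h
    exact Finset.prod_eq_zero (Finset.mem_univ i) (by simp [Ne.symm hi])

theorem sum_levels (f : (NZ q →₀ ℕ) → ℂ) (g : (Fin d → ZMod q) → ℂ) :
    ∑ s ∈ Finset.range (d + 1), ∑ l ∈ Finset.finsuppAntidiag (Finset.univ : Finset (NZ q)) s,
      f l * ∑ r ∈ Finset.univ.filter (fun r => countsIndex r = l), g r
      = ∑ r, f (countsIndex r) * g r := by
  have h : ∀ l : NZ q →₀ ℕ, f l * ∑ r ∈ Finset.univ.filter (fun r => countsIndex r = l), g r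
      = ∑ r, if countsIndex r = l then f (countsIndex r) * g r else 0 := by
    intro l
    rw [Finset.mul_sum, Finset.sum_filter]
    refine Finset.sum_congr rfl fun r _ => ?_
    split_ifs with hr
    · rw [hr]
    · rfl
  simp only [h]
  rw [Finset.sum_congr rfl fun s _ => Finset.sum_comm, Finset.sum_comm]
  refine Finset.sum_congr rfl fun r _ => ?_
  have hdeg : (countsIndex r).degree < d + 1 := by
    have := degree_countsIndex r
    omega
  simp only [Finset.sum_ite_eq, Finset.mem_finsuppAntidiag, Finset.subset_univ, and_true,
    ← Finsupp.degree_eq_sum]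
  simp [hdeg]

/-- The spectral expansion of the grouped walk, for fixed increment counts. -/
theorem walkProb_eq {v m n : ZMod q → ℕ} (hv : ∑ j, v j = d) (hm : ∑ j, m j = d)
    (hn : ∑ j, n j = d) :
    (walkProb d v m n : ℂ) = (multinomialProb d n : ℂ) *
      ∑ s ∈ Finset.range (d + 1), ∑ l ∈ Finset.finsuppAntidiag (Finset.univ : Finset (NZ q)) s,
        spectralTerm d v m n l := by
  classical
  have hd : (d.factorial : ℂ) ≠ 0 := by exact_mod_cast d.factorial_ne_zero
  have hq : (q : ℂ) ^ d ≠ 0 := pow_ne_zero _ (by exact_mod_cast NeZero.ne q)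
  set x := configuration d m with hx
  set u := configuration d v with hu
  set y := configuration d n with hy
  have hcx : counts x = m := counts_configuration hm
  have hcu : counts u = v := counts_configuration hv
  have hcy : counts y = n := counts_configuration hn
  have hfac : (∏ j, ((n j).factorial : ℂ)) ≠ 0 :=
    Finset.prod_ne_zero_iff.mpr fun j _ => by exact_mod_cast (n j).factorial_ne_zero
  have hmult : (multinomialProb d n : ℂ) = d.factorial / (∏ j, ((n j).factorial : ℂ)) / q ^ d := by
    have h := Nat.multinomial_spec Finset.univ n
    rw [hn] at h
    rw [multinomialProb]
    push_cast
    congr 1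
    rw [eq_div_iff hfac, mul_comm]
    exact_mod_cast h
  -- both sides count, up to constants, pairs of permutations with `y ∘ τ = x + u ∘ σ`
  have hcount : (∏ j, ((n j).factorial : ℂ)) * (walkProb d v m n * d.factorial)
      = ∑ σ : Equiv.Perm (Fin d), ∑ τ : Equiv.Perm (Fin d),
        if y ∘ τ = x + u ∘ σ then (1 : ℂ) else 0 := by
    have h1 : ∀ σ : Equiv.Perm (Fin d), ∑ τ : Equiv.Perm (Fin d),
        (if y ∘ τ = x + u ∘ σ then (1 : ℂ) else 0)
        = (∏ j, ((n j).factorial : ℂ)) * if counts (x + u ∘ σ) = n then 1 else 0 := by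
      intro σ
      rw [sum_perm_comp y fun z => if z = x + u ∘ σ then (1 : ℂ) else 0, hcy]
      simp
    simp only [h1]
    rw [← Finset.mul_sum, walkProb, Finset.sum_boole]
    push_cast
    rw [div_mul_cancel₀ _ hd]
  have hspec : (q : ℂ) ^ d * ∑ σ : Equiv.Perm (Fin d), ∑ τ : Equiv.Perm (Fin d),
        (if y ∘ τ = x + u ∘ σ then (1 : ℂ) else 0)
      = (d.factorial : ℂ) ^ 2 * ∑ r, (hNorm d (countsIndex r) : ℂ) ^ 2 *
          krawtchouk (countsIndex r) v * (starRingEnd ℂ) (krawtchouk (countsIndex r) n)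
          * chi r x := by
    have h1 : ∀ σ τ : Equiv.Perm (Fin d), (q : ℂ) ^ d *
        (if y ∘ τ = x + u ∘ σ then (1 : ℂ) else 0)
        = ∑ r, chi r x * chi r (u ∘ σ) * (starRingEnd ℂ) (chi r (y ∘ τ)) := by
      intro σ τ
      simp only [← chi_add]
      rw [sum_chi_mul_conj]
      simp
    simp only [Finset.mul_sum, h1]
    rw [Finset.sum_congr rfl fun σ _ => Finset.sum_comm, Finset.sum_comm]
    refine Finset.sum_congr rfl fun r _ => ?_
    have h2 : ∑ σ : Equiv.Perm (Fin d), ∑ τ : Equiv.Perm (Fin d),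
        chi r x * chi r (u ∘ σ) * (starRingEnd ℂ) (chi r (y ∘ τ))
        = chi r x * (∑ σ : Equiv.Perm (Fin d), chi r (u ∘ σ)) *
          (starRingEnd ℂ) (∑ τ : Equiv.Perm (Fin d), chi r (y ∘ τ)) := by
      rw [map_sum, mul_assoc, Finset.sum_mul_sum, Finset.mul_sum]
      refine Finset.sum_congr rfl fun σ _ => ?_
      rw [Finset.mul_sum]
      exact Finset.sum_congr rfl fun τ _ => by ring
    rw [h2, sum_perm_chi, sum_perm_chi, hcu, hcy]
    simp only [map_mul, Complex.conj_ofReal, map_natCast]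
    ring
  have hlev := sum_levels (d := d) (fun l => (hNorm d l : ℂ) ^ 2 * krawtchouk l v *
    (starRingEnd ℂ) (krawtchouk l n)) fun r => chi r x
  simp only [← krawtchouk_counts, hcx] at hlev
  have hterm : ∀ l, (hNorm d l : ℂ) ^ 2 * krawtchouk l v * (starRingEnd ℂ) (krawtchouk l n)
      * krawtchouk l m = spectralTerm d v m n l := by
    intro l
    rw [spectralTerm]
    ring
  simp only [hterm] at hlev
  rw [← hcount, ← hlev] at hspec
  rw [hmult]
  field_simp
  refine mul_left_cancel₀ hd ?_
  linear_combination hspec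

end Combinatorics

/-! ### Products of absolutely convergent series -/

section ProductSeries

variable {ι : Type*} [Fintype ι]

theorem summable_norm_prod {f : ι → ℕ → ℂ} (hf : ∀ k, Summable fun n => ‖f k n‖) :
    Summable fun l : ι → ℕ => ‖∏ k, f k (l k)‖ := by
  classical
  refine summable_of_sum_le (c := ∏ k, ∑' n, ‖f k n‖) (fun _ => norm_nonneg _) fun u => ?_
  have hN : ∃ N : ℕ, u ⊆ Fintype.piFinset fun _ : ι => Finset.range N := by
    refine ⟨∑ l ∈ u, ∑ k, (l k) + 1, fun l hl => ?_⟩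
    simp only [Fintype.mem_piFinset, Finset.mem_range]
    intro k
    have h1 : l k ≤ ∑ k, l k := Finset.single_le_sum (fun _ _ => Nat.zero_le _) (Finset.mem_univ k)
    have h2 : ∑ k, l k ≤ ∑ l ∈ u, ∑ k, l k :=
      Finset.single_le_sum (f := fun l : ι → ℕ => ∑ k, l k) (fun _ _ => Nat.zero_le _) hl
    omega
  obtain ⟨N, hN⟩ := hN
  calc ∑ l ∈ u, ‖∏ k, f k (l k)‖
      ≤ ∑ l ∈ Fintype.piFinset fun _ : ι => Finset.range N, ‖∏ k, f k (l k)‖ :=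
        Finset.sum_le_sum_of_subset_of_nonneg hN fun _ _ _ => norm_nonneg _
    _ = ∏ k, ∑ n ∈ Finset.range N, ‖f k n‖ := by
        rw [Finset.prod_univ_sum]
        simp only [norm_prod]
    _ ≤ ∏ k, ∑' n, ‖f k n‖ :=
        Finset.prod_le_prod (fun _ _ => Finset.sum_nonneg fun _ _ => norm_nonneg _)
          fun k _ => (hf k).sum_le_tsum _ fun _ _ => norm_nonneg _

theorem hasSum_prod_pi {f : ι → ℕ → ℂ} (hf : ∀ k, Summable fun n => ‖f k n‖) :
    HasSum (fun l : ι → ℕ => ∏ k, f k (l k)) (∏ k, ∑' n, f k n) := by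
  classical
  have hs := (summable_norm_prod hf).of_norm.hasSum
  have hbox : Tendsto (fun N : ℕ => Fintype.piFinset fun _ : ι => Finset.range N) atTop atTop := by
    refine tendsto_atTop_finset_of_monotone (fun M N h => ?_) fun l => ?_
    · exact Fintype.piFinset_subset _ _ fun _ => Finset.range_mono h
    · refine ⟨∑ k, l k + 1, ?_⟩
      simp only [Fintype.mem_piFinset, Finset.mem_range]
      intro k
      have h1 : l k ≤ ∑ k, l k :=
        Finset.single_le_sum (fun _ _ => Nat.zero_le _) (Finset.mem_univ k)
      omega
  have h1 : Tendsto (fun N : ℕ => ∏ k, ∑ n ∈ Finset.range N, f k n) atTop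
      (𝓝 (∏ k, ∑' n, f k n)) :=
    tendsto_finsetProd _ fun k _ => ((hf k).of_norm.hasSum.tendsto_sum_nat)
  have h2 := hs.comp hbox
  have h3 : (fun N : ℕ => ∏ k, ∑ n ∈ Finset.range N, f k n)
      = (fun s : Finset (ι → ℕ) => ∑ l ∈ s, ∏ k, f k (l k)) ∘
        fun N : ℕ => Fintype.piFinset fun _ : ι => Finset.range N := by
    ext N
    rw [Function.comp, Finset.prod_univ_sum]
  rw [h3] at h1
  rw [tendsto_nhds_unique h1 h2]
  exact hs

theorem summable_norm_prod_finsupp {f : ι → ℕ → ℂ} (hf : ∀ k, Summable fun n => ‖f k n‖) :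
    Summable fun l : ι →₀ ℕ => ‖∏ k, f k (l k)‖ :=
  ((Finsupp.equivFunOnFinite (α := ι) (M := ℕ)).summable_iff
    (f := fun l : ι → ℕ => ‖∏ k, f k (l k)‖)).mpr (summable_norm_prod hf)

theorem hasSum_prod_finsupp {f : ι → ℕ → ℂ} (hf : ∀ k, Summable fun n => ‖f k n‖) :
    HasSum (fun l : ι →₀ ℕ => ∏ k, f k (l k)) (∏ k, ∑' n, f k n) :=
  (Finsupp.equivFunOnFinite (α := ι) (M := ℕ)).hasSum_iff.mpr (hasSum_prod_pi hf)

theorem summable_geometric_degree {r : ℝ} (h0 : 0 ≤ r) (h1 : r < 1) :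
    Summable fun l : ι →₀ ℕ => r ^ l.degree := by
  have h := summable_norm_prod_finsupp (ι := ι) (f := fun _ n => (r : ℂ) ^ n) fun _ => by
    simpa [abs_of_nonneg h0] using summable_geometric_of_lt_one h0 h1
  refine h.congr fun l => ?_
  rw [Finset.prod_pow_eq_pow_sum, ← Finsupp.degree_eq_sum, norm_pow, Complex.norm_real,
    Real.norm_of_nonneg h0]

/-- The exponential series of a linear form. -/
theorem hasSum_exp_linear (c w : ι → ℂ) :
    HasSum (fun l : ι →₀ ℕ => (∏ k, c k ^ l k / ((l k).factorial : ℂ)) * ∏ k, w k ^ l k)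
      (Complex.exp (∑ k, w k * c k)) := by
  have h := hasSum_prod_finsupp (f := fun k n => (w k * c k) ^ n / (n.factorial : ℂ)) fun k => by
    simpa using Real.summable_pow_div_factorial ‖w k * c k‖
  have h2 : ∏ k, ∑' n : ℕ, (w k * c k) ^ n / (n.factorial : ℂ)
      = Complex.exp (∑ k, w k * c k) := by
    rw [Complex.exp_sum]
    refine Finset.prod_congr rfl fun k _ => ?_
    rw [Complex.exp_eq_exp_ℂ, NormedSpace.exp_eq_tsum_div]
  rw [h2] at h
  refine h.congr_fun fun l => ?_
  rw [← Finset.prod_mul_distrib]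
  exact Finset.prod_congr rfl fun k _ => by rw [mul_pow]; ring

theorem summable_exp_linear (c : ι → ℂ) :
    Summable fun l : ι →₀ ℕ => ‖∏ k, c k ^ l k / ((l k).factorial : ℂ)‖ :=
  summable_norm_prod_finsupp (f := fun k n => c k ^ n / (n.factorial : ℂ)) fun k => by
    simpa using Real.summable_pow_div_factorial ‖c k‖

end ProductSeries

/-! ### Law of large numbers for the eigenvalues -/

section Eigenvalues

variable {q : ℕ} [NeZero q]

theorem limitEigen_eq_charSum {v : ZMod q → ℝ} (hv : v ∈ stdSimplex ℝ (ZMod q)) (k : NZ q) :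
    limitEigen v k = charSum v k.1 := by
  have h1 := sum_nonzero fun j => (v j : ℂ)
  have h2 := sum_nonzero fun j => (v j : ℂ) * theta q k.1 j
  have h3 : ∑ j, (v j : ℂ) = 1 := by exact_mod_cast hv.2
  rw [limitEigen, h1, h2, h3, charSum, theta_zero_right]
  ring

/-- If the proportions `u / D` converge to `v`, then `∏_j (1 + ∑_k w_k θ_k^j / D)^{u_j}` tends to
`exp (∑_k w_k λ_k)`, and the coefficients follow. -/
theorem tendsto_krawtchouk_of_tendsto_div {D : ℕ → ℕ} (hD : Tendsto D atTop atTop)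
    {u : ℕ → ZMod q → ℕ} (hu : ∀ i, ∑ j, u i j = D i) {v : ZMod q → ℝ}
    (hv : v ∈ stdSimplex ℝ (ZMod q))
    (hlim : Tendsto (fun i j => (u i j : ℝ) / D i) atTop (𝓝 v)) (l : NZ q →₀ ℕ) :
    Tendsto (fun i => krawtchouk l (u i) / ((D i : ℝ) : ℂ) ^ l.degree) atTop
      (𝓝 (∏ k, limitEigen v k ^ l k / ((l k).factorial : ℂ))) := by
  have hs : Tendsto (fun i => Real.sqrt (D i)) atTop atTop := tendsto_sqrt_natCast.comp hD
  have hDpos : ∀ᶠ i in atTop, 0 < D i := hD.eventually_gt_atTop 0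
  have hN : ∀ j, Tendsto (fun i => (u i j : ℝ) / D i) atTop (𝓝 (v j)) := fun j =>
    (tendsto_pi_nhds.mp hlim) j
  have hF : ∀ w : NZ q → ℂ, Tendsto (fun i => ∏ j, (1 + formValue w j / (D i : ℝ)) ^ u i j) atTop
      (𝓝 (Complex.exp (∑ k, w k * limitEigen v k))) := by
    intro w
    have h := tendsto_prod_one_add_pow hs (N := u) (u := fun i j => formValue w j / (D i : ℝ))
      (p := v) (z := fun _ => 0) (a := ∑ j, (v j : ℂ) * formValue w j)
      (fun j => by simpa [Real.sq_sqrt] using hN j)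
      (fun j => by
        have h0 := (Complex.continuous_ofReal.tendsto 0).comp (tendsto_inv_atTop_zero.comp hs)
        have h1 := (h0.mul_const (formValue w j))
        simp only [Complex.ofReal_zero, zero_mul] at h1
        refine h1.congr' ?_
        filter_upwards [hDpos] with i hi
        have hi' : (0 : ℝ) < D i := by exact_mod_cast hi
        have hsq : ((Real.sqrt (D i) : ℝ) : ℂ) * ((Real.sqrt (D i) : ℝ) : ℂ) = ((D i : ℝ) : ℂ) := by
          rw [← Complex.ofReal_mul, Real.mul_self_sqrt hi'.le]
        have hs0 : ((Real.sqrt (D i) : ℝ) : ℂ) ≠ 0 := by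
          exact_mod_cast (Real.sqrt_pos.mpr hi').ne'
        simp only [Function.comp, Complex.ofReal_inv]
        rw [← hsq]
        field_simp)
      (tendsto_finsetSum _ fun j _ => by
        have h0 := ((Complex.continuous_ofReal.tendsto _).comp (hN j)).mul_const (formValue w j)
        refine h0.congr fun i => ?_
        simp only [Function.comp]
        push_cast
        ring)
    convert h using 2
    rw [sum_mul_formValue]
    simp [limitEigen_eq_charSum hv]
  refine tendsto_coeff (a := fun i l => krawtchouk l (u i) / ((D i : ℝ) : ℂ) ^ l.degree)
    (b := fun l => ∏ k, limitEigen v k ^ l k / ((l k).factorial : ℂ))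
    (F := fun i w => ∏ j, (1 + formValue w j / (D i : ℝ)) ^ u i j)
    (G := fun w => Complex.exp (∑ k, w k * limitEigen v k))
    (M := Real.exp (∑ _k : NZ q, 1))
    (Eventually.of_forall fun i => by
      simpa using summable_krawtchouk (fun _ => 1) (u i) (D i))
    (summable_exp_linear _)
    (Eventually.of_forall fun i w _ => hasSum_krawtchouk_div _ w (u i))
    (fun w _ => hasSum_exp_linear _ w)
    (Eventually.of_forall fun i => ?_) ?_ (fun w _ => hF w) l
  · refine continuous_finsetProd _ fun j _ => ?_
    exact (continuous_const.add ((continuous_formValue j).div_const _)).pow _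
  · filter_upwards [hDpos] with i hi w hw
    have hi' : (0 : ℝ) < D i := by exact_mod_cast hi
    have h1 : ∀ j, ‖1 + formValue w j / (D i : ℝ)‖ ≤ Real.exp ((∑ _k : NZ q, 1) / D i) := by
      intro j
      refine (norm_add_le _ _).trans ?_
      rw [norm_one, norm_div, Complex.norm_real, Real.norm_of_nonneg hi'.le, add_comm]
      refine le_trans ?_ (Real.add_one_le_exp _)
      gcongr
      simpa [hw] using norm_formValue_le w j
    rw [norm_prod]
    calc ∏ j, ‖(1 + formValue w j / (D i : ℝ)) ^ u i j‖
        ≤ ∏ j, Real.exp ((∑ _k : NZ q, 1) / D i) ^ u i j := by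
          refine Finset.prod_le_prod (fun _ _ => norm_nonneg _) fun j _ => ?_
          rw [norm_pow]
          exact pow_le_pow_left₀ (norm_nonneg _) (h1 j) _
      _ = Real.exp (∑ _k : NZ q, 1) := by
          rw [Finset.prod_pow_eq_pow_sum, hu i, ← Real.exp_nat_mul, mul_div_cancel₀ _ hi'.ne']

theorem tendsto_pow_mul_hNorm (l : NZ q →₀ ℕ) :
    Tendsto (fun d : ℕ => (d : ℝ) ^ l.degree * hNorm d l) atTop
      (𝓝 (∏ k, ((l k).factorial : ℝ))) := by
  have hne : ∀ᶠ d : ℕ in atTop, (d.descFactorial l.degree : ℝ) ≠ 0 := by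
    filter_upwards [eventually_ge_atTop l.degree] with d hd
    exact_mod_cast (Nat.descFactorial_pos.mpr hd).ne'
  have h := (Asymptotics.isEquivalent_iff_tendsto_one hne).mp
    (isEquivalent_descFactorial l.degree).symm
  have h2 := h.mul_const (∏ k, ((l k).factorial : ℝ))
  rw [one_mul] at h2
  refine h2.congr' ?_
  filter_upwards [eventually_ge_atTop l.degree, hne] with d hd hd0
  have hf : (((d - l.degree).factorial : ℕ) : ℝ) * (d.descFactorial l.degree : ℝ)
      = (d.factorial : ℝ) := by exact_mod_cast Nat.factorial_mul_descFactorial hd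
  have h0 : (((d - l.degree).factorial : ℕ) : ℝ) ≠ 0 := by
    exact_mod_cast (Nat.factorial_ne_zero _)
  simp only [Pi.div_apply]
  rw [hNorm, ← hf]
  field_simp

theorem tendsto_hNorm_mul_krawtchouk {D : ℕ → ℕ} (hD : Tendsto D atTop atTop)
    {u : ℕ → ZMod q → ℕ} (hu : ∀ i, ∑ j, u i j = D i) {v : ZMod q → ℝ}
    (hv : v ∈ stdSimplex ℝ (ZMod q))
    (hlim : Tendsto (fun i j => (u i j : ℝ) / D i) atTop (𝓝 v)) (l : NZ q →₀ ℕ) :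
    Tendsto (fun i => (hNorm (D i) l : ℂ) * krawtchouk l (u i)) atTop
      (𝓝 (∏ k, limitEigen v k ^ l k)) := by
  have h1 := (((Complex.continuous_ofReal.tendsto _).comp
    ((tendsto_pow_mul_hNorm l).comp hD))).mul (tendsto_krawtchouk_of_tendsto_div hD hu hv hlim l)
  have h2 : ((∏ k, ((l k).factorial : ℝ) : ℝ) : ℂ) *
      ∏ k, limitEigen v k ^ l k / ((l k).factorial : ℂ) = ∏ k, limitEigen v k ^ l k := by
    push_cast
    rw [← Finset.prod_mul_distrib]
    refine Finset.prod_congr rfl fun k _ => mul_div_cancel₀ _ ?_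
    exact_mod_cast (l k).factorial_ne_zero
  rw [h2] at h1
  refine h1.congr' ?_
  filter_upwards [hD.eventually_gt_atTop 0] with i hi
  have hi' : ((D i : ℝ) : ℂ) ^ l.degree ≠ 0 := pow_ne_zero _ (by exact_mod_cast hi.ne')
  simp only [Function.comp, Complex.ofReal_mul, Complex.ofReal_pow]
  field_simp

variable {Ω : Type*} [MeasurableSpace Ω] {P : Measure Ω} [IsProbabilityMeasure P]
  {V : ℕ → Ω → ZMod q → ℕ}

/-- Every function of the counts `V d` is integrable, as they take finitely many values. -/
theorem integrable_comp_counts (hVmeas : ∀ d, Measurable (V d)) (hVsum : ∀ d ω, ∑ j, V d ω j = d)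
    (d : ℕ) {g : (ZMod q → ℕ) → ℂ} : Integrable (fun ω => g (V d ω)) P := by
  refine Integrable.of_bound (C := ∑ n ∈ Finset.piAntidiag Finset.univ d, ‖g n‖)
    ((Measurable.of_discrete (f := g)).comp (hVmeas d)).aestronglyMeasurable
    (Eventually.of_forall fun ω => ?_)
  exact Finset.single_le_sum (f := fun n => ‖g n‖) (fun _ _ => norm_nonneg _)
    (by simp [Finset.mem_piAntidiag, hVsum])

/-- The mean of `h_l Q_l(V)`. -/
noncomputable def meanEigen (P : Measure Ω) (d : ℕ) (V : Ω → ZMod q → ℕ) (l : NZ q →₀ ℕ) : ℂ :=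
  ∫ ω, (hNorm d l : ℂ) * krawtchouk l (V ω) ∂P

theorem norm_meanEigen_le (hVsum : ∀ d ω, ∑ j, V d ω j = d) (d : ℕ) (l : NZ q →₀ ℕ) :
    ‖meanEigen P d (V d) l‖ ≤ 1 := by
  refine (norm_integral_le_of_norm_le_const (C := 1) (Eventually.of_forall fun ω => ?_)).trans
    (by simp)
  exact norm_hNorm_mul_krawtchouk_le (hVsum d ω) l

theorem tendsto_meanEigen (hVmeas : ∀ d, Measurable (V d)) (hVsum : ∀ d ω, ∑ j, V d ω j = d)
    {v : ZMod q → ℝ} (hv : v ∈ stdSimplex ℝ (ZMod q))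
    (hV : TendstoInMeasure P (fun (d : ℕ) ω (j : ZMod q) => (V d ω j : ℝ) / d) atTop
      (fun _ => v)) (l : NZ q →₀ ℕ) :
    Tendsto (fun d => meanEigen P d (V d) l) atTop (𝓝 (∏ k, limitEigen v k ^ l k)) := by
  refine tendsto_of_subseq_tendsto fun ns hns => ?_
  have h1 : TendstoInMeasure P (fun (i : ℕ) ω (j : ZMod q) => (V (ns i) ω j : ℝ) / ns i) atTop
      (fun _ => v) := fun ε hε => (hV ε hε).comp hns
  obtain ⟨ms, hms, hae⟩ := h1.exists_seq_tendsto_ae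
  refine ⟨ms, ?_⟩
  have h2 : ∫ _ω, (∏ k, limitEigen v k ^ l k) ∂P = ∏ k, limitEigen v k ^ l k := by simp
  rw [← h2]
  refine tendsto_integral_of_dominated_convergence (fun _ => 1) (fun i => ?_)
    (integrable_const _) (fun i => Eventually.of_forall fun ω => ?_) ?_
  · exact (integrable_comp_counts hVmeas hVsum (ns (ms i))
      (g := fun n => (hNorm (ns (ms i)) l : ℂ) * krawtchouk l n)).aestronglyMeasurable
  · exact norm_hNorm_mul_krawtchouk_le (hVsum _ ω) l
  · filter_upwards [hae] with ω hω
    exact tendsto_hNorm_mul_krawtchouk (hns.comp hms.tendsto_atTop)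
      (u := fun i => V (ns (ms i)) ω) (fun i => hVsum _ ω) hv hω l

theorem integral_spectralTerm {P : Measure Ω} (d : ℕ) (m n : ZMod q → ℕ) (l : NZ q →₀ ℕ) :
    ∫ ω, spectralTerm d (V d ω) m n l ∂P
      = meanEigen P d (V d) l * (hNorm d l * krawtchouk l m * (starRingEnd ℂ) (krawtchouk l n)) := by
  rw [meanEigen, ← integral_mul_const]
  congr 1
  ext ω
  rw [spectralTerm]
  ring

/-- Every term of the spectral expansion converges. -/
theorem tendsto_integral_spectralTerm (hVmeas : ∀ d, Measurable (V d))
    (hVsum : ∀ d ω, ∑ j, V d ω j = d) {v : ZMod q → ℝ} (hv : v ∈ stdSimplex ℝ (ZMod q))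
    (hV : TendstoInMeasure P (fun (d : ℕ) ω (j : ZMod q) => (V d ω j : ℝ) / d) atTop
      (fun _ => v)) {x y : NZ q → ℝ} {m n : ℕ → ZMod q → ℕ} (hm : ∀ d, ∑ j, m d j = d)
    (hn : ∀ d, ∑ j, n d j = d) (hx : Tendsto (fun d => scaledCounts d (m d)) atTop (𝓝 x))
    (hy : Tendsto (fun d => scaledCounts d (n d)) atTop (𝓝 y)) (l : NZ q →₀ ℕ) :
    Tendsto (fun d : ℕ => ∫ ω, spectralTerm d (V d ω) (m d) (n d) l ∂P) atTop
      (𝓝 (limitTerm v x y l)) := by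
  have h1 := (tendsto_meanEigen hVmeas hVsum hv hV l).mul
    ((((Complex.continuous_ofReal.tendsto _).comp (tendsto_pow_mul_hNorm l)).mul
      (tendsto_krawtchouk hm hx l)).mul
      ((Complex.continuous_conj.tendsto _).comp (tendsto_krawtchouk hn hy l)))
  have h2 : (∏ k, limitEigen v k ^ l k) * (((∏ k, ((l k).factorial : ℝ) : ℝ) : ℂ) *
      limitQ l (extend x) * (starRingEnd ℂ) (limitQ l (extend y))) = limitTerm v x y l := by
    rw [limitTerm]
    push_cast
    ring
  rw [h2] at h1
  refine h1.congr' ?_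
  filter_upwards [eventually_gt_atTop 0] with d hd
  rw [integral_spectralTerm]
  congr 1
  have hd' : (0 : ℝ) < d := by exact_mod_cast hd
  have hs0 : ((Real.sqrt d : ℝ) : ℂ) ≠ 0 := by exact_mod_cast (Real.sqrt_pos.mpr hd').ne'
  have hsq : (((d : ℝ) ^ l.degree : ℝ) : ℂ)
      = ((Real.sqrt d : ℝ) : ℂ) ^ l.degree * ((Real.sqrt d : ℝ) : ℂ) ^ l.degree := by
    rw [← mul_pow, ← Complex.ofReal_mul, Real.mul_self_sqrt hd'.le, Complex.ofReal_pow]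
  simp only [Function.comp, Complex.ofReal_mul, map_div₀, map_pow, Complex.conj_ofReal]
  rw [hsq]
  field_simp

end Eigenvalues

/-! ### Local limit of the multinomial distribution -/

section Multinomial

variable {q : ℕ} [NeZero q]

theorem sum_extend_sq (y : NZ q → ℝ) :
    ∑ j, extend y j ^ 2
      = ∑ a : NZ q, ∑ b : NZ q, ((if a = b then 1 else 0) + 1) * y a * y b := by
  have h := sum_nonzero fun j => extend y j ^ 2
  simp only [extend_coe, extend_zero] at h
  have h2 : ∑ a : NZ q, ∑ b : NZ q, ((if a = b then 1 else 0) + 1) * y a * y b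
      = ∑ a : NZ q, y a ^ 2 + (∑ a : NZ q, y a) ^ 2 := by
    rw [sq (∑ a : NZ q, y a), Finset.sum_mul_sum, ← Finset.sum_add_distrib]
    refine Finset.sum_congr rfl fun a _ => ?_
    simp only [add_mul, one_mul, Finset.sum_add_distrib, ite_mul, zero_mul, Finset.sum_ite_eq,
      Finset.mem_univ, if_true, sq]
  rw [h2]
  linarith [neg_sq (∑ k : NZ q, y k)]

theorem gaussianDensity_eq (y : NZ q → ℝ) :
    gaussianDensity y = (q : ℝ) ^ ((q : ℝ) / 2) / (2 * Real.pi) ^ (((q : ℝ) - 1) / 2) *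
      Real.exp (-((q : ℝ) / 2) * ∑ j, extend y j ^ 2) := by
  rw [gaussianDensity, sum_extend_sq]

theorem gaussianDensity_pos (y : NZ q → ℝ) : 0 < gaussianDensity y := by
  have hq : (0 : ℝ) < q := by exact_mod_cast NeZero.pos q
  have hpi := Real.pi_pos
  rw [gaussianDensity]
  positivity

/-- The ratio of `n!` to Stirling's approximation. -/
noncomputable def stirlingRatio (n : ℕ) : ℝ :=
  (n.factorial : ℝ) / (Real.sqrt (2 * Real.pi * n) * (n / Real.exp 1) ^ n)

theorem tendsto_stirlingRatio : Tendsto stirlingRatio atTop (𝓝 1) := by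
  have h := Stirling.factorial_isEquivalent_stirling
  rw [Asymptotics.isEquivalent_iff_tendsto_one] at h
  · refine h.congr fun n => ?_
    simp only [Pi.div_apply, stirlingRatio]
    ring_nf
  · filter_upwards [eventually_gt_atTop 0] with n hn
    have hn' : (0 : ℝ) < n := by exact_mod_cast hn
    have hpi := Real.pi_pos
    positivity

theorem factorial_eq_stirlingRatio_mul {n : ℕ} (hn : 0 < n) :
    (n.factorial : ℝ)
      = stirlingRatio n * (Real.sqrt (2 * Real.pi) * Real.sqrt n * (n ^ n / Real.exp n)) := by
  have hn' : (0 : ℝ) < n := by exact_mod_cast hn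
  have hpi := Real.pi_pos
  have h : Real.sqrt (2 * Real.pi * n) * (n / Real.exp 1) ^ n
      = Real.sqrt (2 * Real.pi) * Real.sqrt n * (n ^ n / Real.exp n) := by
    rw [Real.sqrt_mul (by positivity), div_pow, ← Real.exp_nat_mul, mul_one]
  rw [stirlingRatio, h, div_mul_cancel₀]
  positivity

variable {y : NZ q → ℝ} {n : ℕ → ZMod q → ℕ}

theorem tendsto_extend_scaledCounts
    (hy : Tendsto (fun d => scaledCounts d (n d)) atTop (𝓝 y)) (j : ZMod q) :
    Tendsto (fun d => extend (scaledCounts d (n d)) j) atTop (𝓝 (extend y j)) :=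
  ((continuous_apply j).tendsto _).comp ((continuous_extend.tendsto y).comp hy)

/-- The relative entropy of the counts with respect to the uniform distribution, times `d`,
converges to `(q/2) ∑_j y_j²`. -/
theorem tendsto_prod_relative_counts (hn : ∀ d, ∑ j, n d j = d)
    (hy : Tendsto (fun d => scaledCounts d (n d)) atTop (𝓝 y)) :
    Tendsto (fun d : ℕ => ∏ j, ((q : ℝ) * n d j / d) ^ n d j) atTop
      (𝓝 (Real.exp ((q : ℝ) / 2 * ∑ j, extend y j ^ 2))) := by
  have hq : (q : ℝ) ≠ 0 := by exact_mod_cast NeZero.ne q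
  have hqc : (q : ℂ) ≠ 0 := by exact_mod_cast NeZero.ne q
  set s : ℕ → ZMod q → ℝ := fun d j => extend (scaledCounts d (n d)) j with hsdef
  have hs : ∀ j, Tendsto (fun d => s d j) atTop (𝓝 (extend y j)) := tendsto_extend_scaledCounts hy
  have hrel : ∀ᶠ d : ℕ in atTop, ∀ j, (q : ℝ) * n d j / d = 1 + q * s d j / Real.sqrt d := by
    filter_upwards [eventually_gt_atTop 0] with d hd j
    have hd' : (0 : ℝ) < d := by exact_mod_cast hd
    simp only [hsdef, extend_scaledCounts (hn d)]
    rw [mul_div_assoc', div_div, Real.mul_self_sqrt hd'.le]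
    field_simp
    ring
  have hlin : ∀ᶠ d : ℕ in atTop, ∑ j, (n d j : ℂ) * ((q * s d j / Real.sqrt d : ℝ) : ℂ)
      = ((q * ∑ j, s d j ^ 2 : ℝ) : ℂ) := by
    filter_upwards [eventually_gt_atTop 0, hrel] with d hd hr
    have hd' : (0 : ℝ) < d := by exact_mod_cast hd
    have hsd := Real.sqrt_pos.mpr hd'
    have h0 : ∑ j, s d j = 0 := sum_extend _
    have h1 : ∀ j, (n d j : ℝ) * (q * s d j / Real.sqrt d)
        = Real.sqrt d * s d j + q * s d j ^ 2 := by
      intro j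
      have h2 : (n d j : ℝ) = d / q * (1 + q * s d j / Real.sqrt d) := by
        rw [← hr j]
        field_simp
      rw [h2]
      have hdd : (d : ℝ) = Real.sqrt d * Real.sqrt d := (Real.mul_self_sqrt hd'.le).symm
      field_simp
      rw [Real.sq_sqrt hd'.le]
      ring
    have h3 : ∑ j, (n d j : ℝ) * (q * s d j / Real.sqrt d) = q * ∑ j, s d j ^ 2 := by
      simp only [h1]
      rw [Finset.sum_add_distrib, ← Finset.mul_sum, ← Finset.mul_sum, h0]
      ring
    rw [← h3]
    push_cast
    rfl
  have hcont := Complex.continuous_ofReal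
  have h := tendsto_prod_one_add_pow (F := atTop) (s := fun d : ℕ => Real.sqrt d)
    tendsto_sqrt_natCast (N := n) (u := fun d j => ((q * s d j / Real.sqrt d : ℝ) : ℂ))
    (p := fun _ => 1 / q) (z := fun j => ((q * extend y j : ℝ) : ℂ))
    (a := ((q * ∑ j, extend y j ^ 2 : ℝ) : ℂ))
    (fun j => by
      refine (tendsto_count_div hn hy j).congr fun d => ?_
      rw [Real.sq_sqrt (Nat.cast_nonneg d)])
    (fun j => by
      refine ((hcont.tendsto _).comp ((hs j).const_mul (q : ℝ))).congr' ?_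
      filter_upwards [tendsto_sqrt_natCast.eventually_gt_atTop 0] with d hd
      have : ((Real.sqrt d : ℝ) : ℂ) ≠ 0 := by exact_mod_cast hd.ne'
      simp only [Function.comp]
      push_cast
      field_simp)
    (by
      have h1 := (hcont.tendsto _).comp
        ((tendsto_finsetSum Finset.univ fun j _ => (hs j).pow 2).const_mul (q : ℝ))
      refine h1.congr' ?_
      filter_upwards [hlin] with d hd
      rw [hd]
      rfl)
  have h2 := (Complex.continuous_re.tendsto _).comp h
  have hval : (Complex.exp (((q * ∑ j, extend y j ^ 2 : ℝ) : ℂ) + ∑ j : ZMod q,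
      ((1 / q : ℝ) : ℂ) * (-((q * extend y j : ℝ) : ℂ) ^ 2 / 2))).re
      = Real.exp ((q : ℝ) / 2 * ∑ j, extend y j ^ 2) := by
    have : ((q * ∑ j, extend y j ^ 2 : ℝ) : ℂ) + ∑ j : ZMod q,
        ((1 / q : ℝ) : ℂ) * (-((q * extend y j : ℝ) : ℂ) ^ 2 / 2)
        = (((q : ℝ) / 2 * ∑ j, extend y j ^ 2 : ℝ) : ℂ) := by
      push_cast
      rw [Finset.mul_sum, Finset.mul_sum, ← Finset.sum_add_distrib]
      refine Finset.sum_congr rfl fun j _ => ?_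
      field_simp
      ring
    rw [this, ← Complex.ofReal_exp, Complex.ofReal_re]
  rw [hval] at h2
  refine h2.congr' ?_
  filter_upwards [hrel] with d hd
  simp only [Function.comp, hd]
  rw [← Complex.ofReal_re (∏ j, _)]
  push_cast
  rfl

/-- The local limit theorem for the uniform multinomial distribution. -/
theorem tendsto_multinomialProb (hn : ∀ d, ∑ j, n d j = d)
    (hy : Tendsto (fun d => scaledCounts d (n d)) atTop (𝓝 y)) :
    Tendsto (fun d : ℕ => (d : ℝ) ^ (((q : ℝ) - 1) / 2) * multinomialProb d (n d)) atTop
      (𝓝 (gaussianDensity y)) := by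
  have hq : (0 : ℝ) < q := by exact_mod_cast NeZero.pos q
  have hpi := Real.pi_pos
  have hdiv : ∀ j, Tendsto (fun d : ℕ => (n d j : ℝ) / d) atTop (𝓝 (1 / q)) :=
    tendsto_count_div hn hy
  have hnat : ∀ j, Tendsto (fun d => n d j) atTop atTop := by
    intro j
    rw [← tendsto_natCast_atTop_iff (R := ℝ)]
    refine ((hdiv j).pos_mul_atTop (by positivity) tendsto_natCast_atTop_atTop).congr' ?_
    filter_upwards [eventually_gt_atTop 0] with d hd
    have hd' : (d : ℝ) ≠ 0 := by exact_mod_cast hd.ne'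
    field_simp
  have hA : Tendsto (fun d => stirlingRatio d / ∏ j, stirlingRatio (n d j)) atTop (𝓝 1) := by
    have h1 := tendsto_finsetProd Finset.univ fun j _ => tendsto_stirlingRatio.comp (hnat j)
    have h2 := tendsto_stirlingRatio.div h1 (by simp)
    simp only [Finset.prod_const_one, div_one] at h2
    exact h2
  have hB : Tendsto (fun d : ℕ => ∏ j, (Real.sqrt ((n d j : ℝ) / d))⁻¹) atTop
      (𝓝 (∏ _j : ZMod q, (Real.sqrt (1 / q))⁻¹)) :=
    tendsto_finsetProd _ fun j _ => ((Real.continuous_sqrt.tendsto _).comp (hdiv j)).inv₀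
      (by positivity)
  have hC := (tendsto_prod_relative_counts hn hy).inv₀ (Real.exp_ne_zero _)
  have hlim := ((hA.mul_const (Real.sqrt (2 * Real.pi) / Real.sqrt (2 * Real.pi) ^ q)).mul hB).mul hC
  have hval : 1 * (Real.sqrt (2 * Real.pi) / Real.sqrt (2 * Real.pi) ^ q) *
      (∏ _j : ZMod q, (Real.sqrt (1 / q))⁻¹) * (Real.exp ((q : ℝ) / 2 * ∑ j, extend y j ^ 2))⁻¹
      = gaussianDensity y := by
    rw [gaussianDensity_eq, ← Real.exp_neg, neg_mul, one_mul, Finset.prod_const, Finset.card_univ,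
      ZMod.card]
    congr 1
    have h1 : ((Real.sqrt (1 / q))⁻¹) ^ q = (q : ℝ) ^ ((q : ℝ) / 2) := by
      rw [one_div, Real.sqrt_inv, inv_inv, Real.sqrt_eq_rpow, ← Real.rpow_natCast, ← Real.rpow_mul
        hq.le]
      congr 1
      ring
    have h2 : Real.sqrt (2 * Real.pi) / Real.sqrt (2 * Real.pi) ^ q
        = 1 / (2 * Real.pi) ^ (((q : ℝ) - 1) / 2) := by
      rw [Real.sqrt_eq_rpow, ← Real.rpow_natCast, ← Real.rpow_mul (by positivity),
        ← Real.rpow_sub (by positivity), one_div (_ ^ (((q : ℝ) - 1) / 2)), ← Real.rpow_neg (by positivity)]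
      congr 1
      ring
    rw [h1, h2]
    ring
  rw [hval] at hlim
  refine hlim.congr' ?_
  filter_upwards [eventually_gt_atTop 0, eventually_all.mpr fun j => (hnat j).eventually_gt_atTop 0]
    with d hd hnj
  have hd' : (0 : ℝ) < d := by exact_mod_cast hd
  have hnj' : ∀ j, (0 : ℝ) < n d j := fun j => by exact_mod_cast hnj j
  have hsum : ∑ j, (n d j : ℝ) = d := by exact_mod_cast hn d
  have hmult : multinomialProb d (n d)
      = (d.factorial : ℝ) / (∏ j, ((n d j).factorial : ℝ)) / q ^ d := by
    have h := Nat.multinomial_spec Finset.univ (n d)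
    rw [hn d] at h
    rw [multinomialProb]
    congr 1
    rw [eq_div_iff (by positivity), mul_comm]
    exact_mod_cast h
  have hprodfac : ∏ j, ((n d j).factorial : ℝ) = (∏ j, stirlingRatio (n d j)) *
      (Real.sqrt (2 * Real.pi) ^ q * (∏ j, Real.sqrt (n d j)) *
        ((∏ j, (n d j : ℝ) ^ n d j) / Real.exp d)) := by
    rw [Finset.prod_congr rfl fun j _ => factorial_eq_stirlingRatio_mul (hnj j)]
    rw [Finset.prod_mul_distrib, Finset.prod_mul_distrib, Finset.prod_mul_distrib,
      Finset.prod_div_distrib, ← Real.exp_sum, hsum, Finset.prod_const, Finset.card_univ, ZMod.card]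
  have hrel : ∏ j, ((q : ℝ) * n d j / d) ^ n d j
      = q ^ d * (∏ j, (n d j : ℝ) ^ n d j) / d ^ d := by
    simp only [div_pow, mul_pow]
    rw [Finset.prod_div_distrib, Finset.prod_mul_distrib, Finset.prod_pow_eq_pow_sum,
      Finset.prod_pow_eq_pow_sum, hn d]
  have hroot : ∏ j, (Real.sqrt ((n d j : ℝ) / d))⁻¹
      = (d : ℝ) ^ (((q : ℝ) - 1) / 2) * Real.sqrt d / ∏ j, Real.sqrt (n d j) := by
    have h1 : (d : ℝ) ^ (((q : ℝ) - 1) / 2) * Real.sqrt d = Real.sqrt d ^ q := by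
      rw [Real.sqrt_eq_rpow, ← Real.rpow_natCast, ← Real.rpow_mul hd'.le, ← Real.rpow_add hd']
      congr 1
      ring
    rw [h1]
    simp only [Real.sqrt_div' _ hd'.le, inv_div]
    rw [Finset.prod_div_distrib, Finset.prod_const, Finset.card_univ, ZMod.card]
  have hsr : ∀ k : ℕ, 0 < k → stirlingRatio k ≠ 0 := by
    intro k hk
    have hk' : (0 : ℝ) < k := by exact_mod_cast hk
    unfold stirlingRatio
    positivity
  have h1 : (∏ j, stirlingRatio (n d j)) ≠ 0 :=
    Finset.prod_ne_zero_iff.mpr fun j _ => hsr _ (hnj j)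
  have h2 : (∏ j, Real.sqrt (n d j)) ≠ 0 :=
    Finset.prod_ne_zero_iff.mpr fun j _ => (Real.sqrt_pos.mpr (hnj' j)).ne'
  have h3 : (∏ j, (n d j : ℝ) ^ n d j) ≠ 0 :=
    Finset.prod_ne_zero_iff.mpr fun j _ => (pow_pos (hnj' j) _).ne'
  have h4 : Real.sqrt (2 * Real.pi) ≠ 0 := by positivity
  have h5 : Real.exp d ≠ 0 := Real.exp_ne_zero _
  rw [hmult, hprodfac, hrel, hroot, factorial_eq_stirlingRatio_mul hd]
  field_simp

end Multinomial

/-! ### Gaussian integrals -/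

section Gaussian

open Matrix
open scoped MatrixOrder

variable {ι : Type*}

/-- A real vector, viewed in `ℂ^ι`. -/
def toComplex (y : ι → ℝ) : ι → ℂ := fun i => (y i : ℂ)

variable [Fintype ι]

/-- The quadratic form `uᵀ A u` of a real matrix at a complex vector. -/
noncomputable def quadForm (A : Matrix ι ι ℝ) (u : ι → ℂ) : ℂ := u ⬝ᵥ (A.map Complex.ofReal *ᵥ u)

theorem quadForm_toComplex (A : Matrix ι ι ℝ) (y : ι → ℝ) :
    quadForm A (toComplex y) = ((y ⬝ᵥ (A *ᵥ y) : ℝ) : ℂ) := by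
  simp [quadForm, toComplex, dotProduct, mulVec]

theorem quadForm_smul (A : Matrix ι ι ℝ) (c : ℂ) (u : ι → ℂ) :
    quadForm A (c • u) = c ^ 2 * quadForm A u := by
  rw [quadForm, quadForm, mulVec_smul, smul_dotProduct, dotProduct_smul, smul_eq_mul, smul_eq_mul]
  ring

theorem quadForm_transpose_mul (B : Matrix ι ι ℝ) (u : ι → ℂ) :
    quadForm (Bᵀ * B) u = ∑ i, (B.map Complex.ofReal *ᵥ u) i ^ 2 := by
  have h : (Bᵀ * B).map Complex.ofReal = (B.map Complex.ofReal)ᵀ * B.map Complex.ofReal := by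
    rw [← transpose_map]
    exact Matrix.map_mul (f := Complex.ofRealHom)
  rw [quadForm, h, ← mulVec_mulVec, dotProduct_mulVec, vecMul_transpose]
  simp only [dotProduct, sq]

theorem mulVec_toComplex (B : Matrix ι ι ℝ) (y : ι → ℝ) :
    B.map Complex.ofReal *ᵥ toComplex y = toComplex (B *ᵥ y) := by
  ext i
  simp [toComplex, mulVec, dotProduct]

variable [DecidableEq ι]

theorem exists_eq_transpose_mul {A : Matrix ι ι ℝ} (hA : A.PosDef) :
    ∃ B : Matrix ι ι ℝ, A = Bᵀ * B ∧ IsUnit B.det ∧ |B.det| = Real.sqrt A.det := by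
  obtain ⟨B, hB⟩ := CStarAlgebra.nonneg_iff_eq_star_mul_self.mp hA.posSemidef.nonneg
  have hB' : A = Bᵀ * B := by
    rw [hB, star_eq_conjTranspose, conjTranspose_eq_transpose_of_trivial]
  have hdet : A.det = B.det ^ 2 := by
    rw [hB', det_mul, det_transpose, sq]
  refine ⟨B, hB', ?_, ?_⟩
  · rw [isUnit_iff_ne_zero]
    intro h
    have := hA.det_pos
    rw [hdet, h] at this
    simp at this
  · rw [hdet, Real.sqrt_sq_eq_abs]

/-- The Gaussian integral with a complex linear term, for a positive definite real form. -/
theorem gaussian_integral {A : Matrix ι ι ℝ} (hA : A.PosDef) (z : ι → ℂ) :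
    Integrable (fun y : ι → ℝ =>
      Complex.exp (-(1 / 2) * quadForm A (toComplex y) + z ⬝ᵥ toComplex y)) ∧
    ∫ y : ι → ℝ, Complex.exp (-(1 / 2) * quadForm A (toComplex y) + z ⬝ᵥ toComplex y)
      = ((Real.sqrt ((2 * Real.pi) ^ Fintype.card ι) / Real.sqrt A.det : ℝ) : ℂ) *
        Complex.exp (1 / 2 * quadForm A⁻¹ z) := by
  obtain ⟨B, hB, hunit, habs⟩ := exists_eq_transpose_mul hA
  have hdet : B.det ≠ 0 := hunit.ne_zero
  set c : ι → ℂ := ((B⁻¹)ᵀ.map Complex.ofReal) *ᵥ z with hc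
  set g : (ι → ℝ) → ℂ := fun u =>
    Complex.exp (-(1 / 2) * ∑ i, (u i : ℂ) ^ 2 + ∑ i, c i * u i) with hg
  have hgc : Continuous g := by
    rw [hg]
    fun_prop
  have hlin : ∀ y : ι → ℝ, z ⬝ᵥ toComplex y = ∑ i, c i * ((B *ᵥ y) i : ℂ) := by
    intro y
    have h1 : ∑ i, c i * ((B *ᵥ y) i : ℂ) = c ⬝ᵥ toComplex (B *ᵥ y) := rfl
    have h2 : (B⁻¹).map Complex.ofReal * B.map Complex.ofReal = 1 := by
      have := (Matrix.map_mul (f := Complex.ofRealHom) (L := B⁻¹) (M := B)).symm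
      rw [nonsing_inv_mul B hunit] at this
      refine this.trans ?_
      exact Matrix.map_one _ (map_zero _) (map_one _)
    rw [h1, ← mulVec_toComplex, hc, transpose_map, mulVec_transpose, ← dotProduct_mulVec,
      mulVec_mulVec, h2, one_mulVec]
  have hquad : ∀ y : ι → ℝ, quadForm A (toComplex y) = ∑ i, ((B *ᵥ y) i : ℂ) ^ 2 := by
    intro y
    rw [hB, quadForm_transpose_mul, mulVec_toComplex]
    rfl
  have hfg : (fun y : ι → ℝ =>
      Complex.exp (-(1 / 2) * quadForm A (toComplex y) + z ⬝ᵥ toComplex y))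
      = fun y => g (toLin' B y) := by
    ext y
    rw [hquad, hlin, toLin'_apply]
  have hinv : ∑ i, c i ^ 2 = quadForm A⁻¹ z := by
    have : A⁻¹ = ((B⁻¹)ᵀ)ᵀ * (B⁻¹)ᵀ := by
      rw [hB, Matrix.mul_inv_rev, transpose_transpose, transpose_nonsing_inv]
    rw [this, quadForm_transpose_mul]
  have hmap := Real.map_matrix_volume_pi_eq_smul_volume_pi hdet
  have hmeas : AEMeasurable (toLin' B) (volume : Measure (ι → ℝ)) :=
    (LinearMap.continuous_of_finiteDimensional _).measurable.aemeasurable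
  have hgint : Integrable g := by
    have := GaussianFourier.integrable_cexp_neg_mul_sum_add (b := (1 / 2 : ℂ)) (by norm_num) c
    exact this
  have hgmap : Integrable g (Measure.map (toLin' B) volume) := by
    rw [hmap]
    exact hgint.smul_measure ENNReal.ofReal_ne_top
  rw [hfg]
  refine ⟨(integrable_map_measure hgc.aestronglyMeasurable hmeas).mp hgmap, ?_⟩
  rw [← integral_map hmeas hgc.aestronglyMeasurable, hmap, integral_smul_measure,
    ENNReal.toReal_ofReal (abs_nonneg _), hg,
    GaussianFourier.integral_cexp_neg_mul_sum_add (b := (1 / 2 : ℂ)) (by norm_num) c, hinv, abs_inv,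
    habs]
  have h3 : (Real.pi / (1 / 2 : ℂ)) ^ (Fintype.card ι / 2 : ℂ)
      = ((Real.sqrt ((2 * Real.pi) ^ Fintype.card ι) : ℝ) : ℂ) := by
    have hpi := Real.pi_pos
    rw [Real.sqrt_eq_rpow, ← Real.rpow_natCast, ← Real.rpow_mul (by positivity),
      Complex.ofReal_cpow (by positivity)]
    push_cast
    congr 1 <;> ring
  have h4 : (4 * (1 / 2 : ℂ)) = 2 := by norm_num
  rw [h3, h4, Complex.real_smul]
  push_cast
  ring_nf

/-- The density of the centred normal law on `ℝ^ι` with covariance matrix `A`. -/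
noncomputable def gaussPdf (A : Matrix ι ι ℝ) (y : ι → ℝ) : ℝ :=
  (Real.sqrt ((2 * Real.pi) ^ Fintype.card ι * A.det))⁻¹ * Real.exp (-(1 / 2) * (y ⬝ᵥ (A⁻¹ *ᵥ y)))

theorem gaussPdf_nonneg (A : Matrix ι ι ℝ) (y : ι → ℝ) : 0 ≤ gaussPdf A y := by
  unfold gaussPdf
  positivity

theorem continuous_gaussPdf (A : Matrix ι ι ℝ) : Continuous (gaussPdf A) := by
  unfold gaussPdf
  refine continuous_const.mul (Real.continuous_exp.comp (continuous_const.mul ?_))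
  simp only [dotProduct, mulVec]
  fun_prop

theorem sqrt_div_sqrt_det {A : Matrix ι ι ℝ} (hA : A.PosDef) :
    Real.sqrt ((2 * Real.pi) ^ Fintype.card ι) / Real.sqrt A.det = (2 * Real.pi) ^ Fintype.card ι *
      (Real.sqrt ((2 * Real.pi) ^ Fintype.card ι * A.det))⁻¹ := by
  have hpi := Real.pi_pos
  have hN : (0 : ℝ) < (2 * Real.pi) ^ Fintype.card ι := by positivity
  rw [Real.sqrt_mul hN.le]
  have hs := Real.sqrt_pos.mpr hN
  have hs' := Real.sqrt_pos.mpr hA.det_pos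
  field_simp
  rw [Real.sq_sqrt hN.le]

theorem gaussPdf_neg (A : Matrix ι ι ℝ) (y : ι → ℝ) : gaussPdf A (-y) = gaussPdf A y := by
  simp [gaussPdf, mulVec_neg]

/-- Fourier inversion for a Gaussian: the oscillatory integral of `exp (-½ tᵀ A t)`. -/
theorem integral_gaussian_fourier {A : Matrix ι ι ℝ} (hA : A.PosDef) (b : ι → ℝ) :
    ∫ t : ι → ℝ, Complex.exp (-(1 / 2) * quadForm A (toComplex t)
        + (Complex.I • toComplex b) ⬝ᵥ toComplex t)
      = ((2 * Real.pi) ^ Fintype.card ι * gaussPdf A b : ℝ) := by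
  rw [(gaussian_integral hA _).2, quadForm_smul, quadForm_toComplex, gaussPdf, Complex.I_sq]
  have h2 : (1 / 2 : ℂ) * (-1 * ((b ⬝ᵥ (A⁻¹ *ᵥ b) : ℝ) : ℂ))
      = ((-(1 / 2) * (b ⬝ᵥ (A⁻¹ *ᵥ b)) : ℝ) : ℂ) := by
    push_cast
    ring
  rw [sqrt_div_sqrt_det hA, h2, ← Complex.ofReal_exp, ← Complex.ofReal_mul]
  congr 1
  ring

/-- The characteristic function of a normal law with mean `μ` and covariance matrix `A`. -/
theorem charFun_gaussPdf {A : Matrix ι ι ℝ} (hA : A.PosDef) (μ s : ι → ℝ) :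
    Integrable (fun y : ι → ℝ => (gaussPdf A (y - μ) : ℂ) *
      Complex.exp (Complex.I * (toComplex s ⬝ᵥ toComplex y))) ∧
    ∫ y : ι → ℝ, (gaussPdf A (y - μ) : ℂ) *
      Complex.exp (Complex.I * (toComplex s ⬝ᵥ toComplex y))
      = Complex.exp (Complex.I * (toComplex s ⬝ᵥ toComplex μ)
          - 1 / 2 * quadForm A (toComplex s)) := by
  have hdet := hA.det_pos
  have hpi := Real.pi_pos
  have hN : (0 : ℝ) < (2 * Real.pi) ^ Fintype.card ι := by positivity
  obtain ⟨hint, hval⟩ := gaussian_integral hA.inv (Complex.I • toComplex s)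
  set K : ℝ := (Real.sqrt ((2 * Real.pi) ^ Fintype.card ι * A.det))⁻¹ with hK
  set G : (ι → ℝ) → ℂ := fun x =>
    (K : ℂ) * Complex.exp (Complex.I * (toComplex s ⬝ᵥ toComplex μ)) *
      Complex.exp (-(1 / 2) * quadForm A⁻¹ (toComplex x)
        + (Complex.I • toComplex s) ⬝ᵥ toComplex x) with hG
  have hshift : ∀ y : ι → ℝ, (gaussPdf A (y - μ) : ℂ) *
      Complex.exp (Complex.I * (toComplex s ⬝ᵥ toComplex y))
      = G (y - μ) := by
    intro y
    have h1 : toComplex s ⬝ᵥ toComplex y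
        = toComplex s ⬝ᵥ toComplex μ + toComplex s ⬝ᵥ toComplex (y - μ) := by
      rw [← dotProduct_add]
      congr 1
      ext i
      simp [toComplex]
    rw [h1]
    simp only [hG, gaussPdf, quadForm_toComplex, smul_dotProduct, smul_eq_mul]
    rw [Complex.ofReal_mul, Complex.ofReal_exp, mul_assoc, mul_assoc, ← Complex.exp_add,
      ← Complex.exp_add]
    congr 2
    push_cast
    ring
  simp only [hshift]
  refine ⟨(hint.const_mul _).comp_sub_right μ, ?_⟩
  rw [integral_sub_right_eq_self G μ, hG, integral_const_mul, hval, quadForm_smul, Complex.I_sq,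
    Matrix.nonsing_inv_nonsing_inv _ (isUnit_iff_ne_zero.mpr hdet.ne')]
  have h2 : (K : ℂ) * ((Real.sqrt ((2 * Real.pi) ^ Fintype.card ι) / Real.sqrt (A⁻¹).det : ℝ) : ℂ)
      = 1 := by
    rw [← Complex.ofReal_mul, hK, det_nonsing_inv, Ring.inverse_eq_inv', Real.sqrt_inv,
      Real.sqrt_mul hN.le]
    have hs := Real.sqrt_pos.mpr hN
    have hs' := Real.sqrt_pos.mpr hdet
    rw [← Complex.ofReal_one]
    congr 1
    field_simp
  rw [sub_eq_add_neg, Complex.exp_add]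
  calc _ = ((K : ℂ) * ((Real.sqrt ((2 * Real.pi) ^ Fintype.card ι)
        / Real.sqrt (A⁻¹).det : ℝ) : ℂ)) * (Complex.exp (Complex.I * (toComplex s ⬝ᵥ toComplex μ)) *
        Complex.exp (1 / 2 * (-1 * quadForm A (toComplex s)))) := by ring
    _ = _ := by
      rw [h2, one_mul]
      congr 2
      ring

end Gaussian

/-! ### Frequencies and covariance matrices -/

section Covariance

open Matrix

variable {q : ℕ} [NeZero q]

/-- The discrete Fourier transform `(1/q) ∑_j t_j θ_k^{-j}` of a vector indexed by the nonzero
residues, extended by `0`. -/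
noncomputable def freq (t : NZ q → ℝ) (k : ZMod q) : ℂ :=
  (q : ℂ)⁻¹ * ∑ j : NZ q, (t j : ℂ) * theta q (-k) j.1

theorem conj_freq (t : NZ q → ℝ) (k : ZMod q) :
    (starRingEnd ℂ) (freq t k) = (q : ℂ)⁻¹ * ∑ j : NZ q, (t j : ℂ) * theta q k j.1 := by
  simp [freq, theta_neg_left]

theorem freq_neg (t : NZ q → ℝ) (k : ZMod q) : freq t (-k) = (starRingEnd ℂ) (freq t k) := by
  rw [conj_freq, freq, neg_neg]

theorem charSum_neg (x : ZMod q → ℝ) (k : ZMod q) :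
    charSum x (-k) = (starRingEnd ℂ) (charSum x k) := by
  simp [charSum, theta_neg_left]

theorem continuous_freq (k : ZMod q) : Continuous fun t : NZ q → ℝ => freq t k := by
  unfold freq
  fun_prop

/-- Fourier inversion on the cyclic group. -/
theorem sum_freq_mul_theta (t : NZ q → ℝ) (j : ZMod q) :
    ∑ k, freq t k * theta q k j = if h : j = 0 then 0 else (t ⟨j, h⟩ : ℂ) := by
  have hq : (q : ℂ) ≠ 0 := by exact_mod_cast NeZero.ne q
  have h1 : ∑ k, freq t k * theta q k j
      = (q : ℂ)⁻¹ * ∑ i : NZ q, (t i : ℂ) * if i.1 = j then (q : ℂ) else 0 := by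
    simp only [freq, Finset.mul_sum, Finset.sum_mul]
    rw [Finset.sum_comm]
    refine Finset.sum_congr rfl fun i _ => ?_
    have h2 : ∀ k : ZMod q, (q : ℂ)⁻¹ * ((t i : ℂ) * theta q (-k) i.1) * theta q k j
        = (q : ℂ)⁻¹ * (t i : ℂ) * theta q k (j - i.1) := by
      intro k
      rw [sub_eq_add_neg, theta_add_right, theta_neg_left, theta_neg_right]
      ring
    simp only [h2]
    rw [← Finset.mul_sum, sum_theta_right]
    simp only [sub_eq_zero, eq_comm (a := j)]
    ring
  rw [h1]
  split_ifs with h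
  · subst h
    rw [Finset.sum_eq_zero, mul_zero]
    intro i _
    rw [if_neg i.2, mul_zero]
  · rw [Finset.sum_eq_single ⟨j, h⟩]
    · simp only [if_true]
      field_simp
    · intro i _ hi
      rw [if_neg, mul_zero]
      exact fun h' => hi (Subtype.ext h')
    · simp

theorem formValue_freq (t : NZ q → ℝ) (j : ZMod q) :
    formValue (fun k => freq t k.1) j
      = (if h : j = 0 then 0 else (t ⟨j, h⟩ : ℂ)) - freq t 0 := by
  have h := sum_nonzero fun k => freq t k * theta q k j
  rw [sum_freq_mul_theta] at h
  rw [formValue, Finset.sum_congr rfl fun k _ => mul_comm _ _, h, theta_zero_left, mul_one]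

theorem eq_zero_of_freq_eq_zero {t : NZ q → ℝ} (h : ∀ k : NZ q, freq t k.1 = 0) : t = 0 := by
  have hF : ∀ j : ZMod q, formValue (fun k => freq t k.1) j = 0 := fun j => by
    simp [formValue, h]
  have h0 : freq t 0 = 0 := by simpa [formValue_freq] using hF 0
  ext j
  have := hF j.1
  rw [formValue_freq, dif_neg j.2, h0, sub_zero] at this
  exact_mod_cast this

/-- Parseval's identity, pairing the frequencies of `t` with the character sums of `x`. -/
theorem sum_freq_mul_charSum (t x : NZ q → ℝ) :
    ∑ k : NZ q, freq t k.1 * charSum (extend x) k.1 = ∑ j : NZ q, (t j : ℂ) * (x j : ℂ) := by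
  rw [← sum_mul_formValue (extend x) fun k => freq t k.1]
  simp only [formValue_freq, mul_sub]
  rw [Finset.sum_sub_distrib, ← Finset.sum_mul]
  have h0 : ∑ j, ((extend x j : ℝ) : ℂ) = 0 := by exact_mod_cast sum_extend x
  rw [h0, zero_mul, sub_zero]
  have h := sum_nonzero fun j : ZMod q =>
    ((extend x j : ℝ) : ℂ) * (if h : j = 0 then 0 else (t ⟨j, h⟩ : ℂ))
  simp only [dite_true, mul_zero, sub_zero] at h
  rw [← h]
  refine Finset.sum_congr rfl fun k _ => ?_
  rw [dif_neg k.2, extend_coe, mul_comm]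

/-- The real matrix of the quadratic form `∑_k c_k |τ_k(t)|²`, where `τ = freq t`.
Taking real parts only symmetrizes the matrix and does not affect the form at real vectors. -/
noncomputable def covMatrix (c : NZ q → ℝ) : Matrix (NZ q) (NZ q) ℝ :=
  Matrix.of fun i j => ((((q : ℂ) ^ 2)⁻¹ * ∑ k : NZ q, (c k : ℂ) * theta q k.1 (i.1 - j.1))).re

theorem dotProduct_covMatrix (c t : NZ q → ℝ) :
    t ⬝ᵥ (covMatrix c *ᵥ t) = ∑ k : NZ q, c k * ‖freq t k.1‖ ^ 2 := by
  have h1 : ∀ k : NZ q, ((c k * ‖freq t k.1‖ ^ 2 : ℝ) : ℂ)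
      = ∑ i : NZ q, ∑ j : NZ q, (t i : ℂ) *
        (((q : ℂ) ^ 2)⁻¹ * ((c k : ℂ) * theta q k.1 (i.1 - j.1))) * (t j : ℂ) := by
    intro k
    have h2 : ((‖freq t k.1‖ ^ 2 : ℝ) : ℂ) = (starRingEnd ℂ) (freq t k.1) * freq t k.1 := by
      rw [Complex.conj_mul']
      push_cast
      rfl
    rw [Complex.ofReal_mul, h2, conj_freq, freq]
    simp only [Finset.mul_sum, Finset.sum_mul]
    rw [Finset.sum_comm]
    refine Finset.sum_congr rfl fun i _ => Finset.sum_congr rfl fun j _ => ?_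
    rw [sub_eq_add_neg, theta_add_right, theta_neg_right, theta_neg_left]
    ring
  have h3 : ((t ⬝ᵥ (covMatrix c *ᵥ t) : ℝ)) = (∑ i : NZ q, ∑ j : NZ q, (t i : ℂ) *
      (((q : ℂ) ^ 2)⁻¹ * ∑ k : NZ q, (c k : ℂ) * theta q k.1 (i.1 - j.1)) * (t j : ℂ)).re := by
    simp only [dotProduct, mulVec, covMatrix, Matrix.of_apply, Complex.re_sum]
    refine Finset.sum_congr rfl fun i _ => ?_
    rw [Finset.mul_sum]
    refine Finset.sum_congr rfl fun j _ => ?_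
    rw [Complex.re_mul_ofReal, Complex.re_ofReal_mul]
    ring
  rw [h3, ← Complex.ofReal_re (∑ k : NZ q, c k * ‖freq t k.1‖ ^ 2), Complex.ofReal_sum]
  simp only [h1]
  congr 1
  symm
  rw [Finset.sum_comm]
  refine Finset.sum_congr rfl fun i _ => ?_
  rw [Finset.sum_comm]
  refine Finset.sum_congr rfl fun j _ => ?_
  simp only [Finset.mul_sum, Finset.sum_mul]

theorem quadForm_covMatrix (c t : NZ q → ℝ) :
    quadForm (covMatrix c) (toComplex t) = ((∑ k : NZ q, c k * ‖freq t k.1‖ ^ 2 : ℝ) : ℂ) := by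
  rw [quadForm_toComplex, dotProduct_covMatrix]

theorem posDef_covMatrix {c : NZ q → ℝ} (hc : ∀ k, 0 < c k) : (covMatrix c).PosDef := by
  refine Matrix.PosDef.of_dotProduct_mulVec_pos ?_ ?_
  · ext i j
    simp only [covMatrix, conjTranspose_apply, Matrix.of_apply, star_trivial]
    rw [← Complex.conj_re]
    congr 1
    simp only [map_mul, map_sum, map_inv₀, map_pow, map_natCast, Complex.conj_ofReal,
      ← theta_neg_right, neg_sub]
  · intro t ht
    rw [star_trivial, dotProduct_covMatrix]
    have hne : ∃ k : NZ q, freq t k.1 ≠ 0 := by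
      by_contra! h
      exact ht (eq_zero_of_freq_eq_zero h)
    obtain ⟨k, hk⟩ := hne
    refine Finset.sum_pos' (fun k _ => mul_nonneg (hc k).le (sq_nonneg _)) ⟨k, Finset.mem_univ k, ?_⟩
    have := norm_pos_iff.mpr hk
    have := hc k
    positivity

/-- A Gaussian in the frequencies is integrable even against exponential weights. -/
theorem integrable_exp_freq {c : NZ q → ℝ} (hc : ∀ k, 0 < c k) (b : NZ q → ℝ) :
    Integrable fun t : NZ q → ℝ =>
      Real.exp (-(1 / 2) * ∑ k : NZ q, c k * ‖freq t k.1‖ ^ 2 + ∑ k : NZ q, b k * ‖freq t k.1‖) := by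
  have h := (gaussian_integral (posDef_covMatrix (c := fun k => c k / 2)
    fun k => half_pos (hc k)) 0).1.norm.const_mul (Real.exp (∑ k : NZ q, b k ^ 2 / c k))
  refine h.mono' ?_ (Eventually.of_forall fun t => ?_)
  · refine Continuous.aestronglyMeasurable (Real.continuous_exp.comp ?_)
    have hf := fun k : NZ q => (continuous_freq (q := q) k.1).norm
    exact (continuous_const.mul (continuous_finsetSum _ fun k _ =>
      continuous_const.mul ((hf k).pow 2))).add (continuous_finsetSum _ fun k _ =>
      continuous_const.mul (hf k))
  · rw [Real.norm_of_nonneg (Real.exp_pos _).le, quadForm_covMatrix, zero_dotProduct, add_zero]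
    have h1 : (-(1 / 2) * ((∑ k : NZ q, c k / 2 * ‖freq t k.1‖ ^ 2 : ℝ) : ℂ))
        = ((-(1 / 2) * ∑ k : NZ q, c k / 2 * ‖freq t k.1‖ ^ 2 : ℝ) : ℂ) := by
      push_cast
      ring
    rw [h1, Complex.norm_exp_ofReal, ← Real.exp_add, Real.exp_le_exp, Finset.mul_sum,
      Finset.mul_sum, ← Finset.sum_add_distrib, ← Finset.sum_add_distrib]
    refine Finset.sum_le_sum fun k _ => ?_
    -- `b s ≤ b²/c + c s²/4`
    have hck := hc k
    have h2 : 0 ≤ (b k - c k * ‖freq t k.1‖ / 2) ^ 2 / c k := by positivity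
    have h3 : (b k - c k * ‖freq t k.1‖ / 2) ^ 2 / c k
        = b k ^ 2 / c k - b k * ‖freq t k.1‖ + c k * ‖freq t k.1‖ ^ 2 / 4 := by
      field_simp
      ring
    linarith

/-- The inverse `q (I + J)` of the covariance matrix of the stationary law. -/
noncomputable def precisionMatrix (q : ℕ) [NeZero q] : Matrix (NZ q) (NZ q) ℝ :=
  Matrix.of fun i j => (q : ℝ) * ((if i = j then 1 else 0) + 1)

theorem card_NZ : ((Fintype.card (NZ q) : ℕ) : ℝ) = (q : ℝ) - 1 := by
  have h := sum_nonzero fun _ : ZMod q => (1 : ℝ)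
  simpa [ZMod.card] using h

theorem covMatrix_one_apply (i j : NZ q) :
    covMatrix (fun _ => 1) i j = ((q : ℝ) ^ 2)⁻¹ * ((if i = j then (q : ℝ) else 0) - 1) := by
  have h := sum_nonzero fun k : ZMod q => theta q k (i.1 - j.1)
  rw [sum_theta_right, theta_zero_left] at h
  have h1 : ((((q : ℂ) ^ 2)⁻¹ * ((if i.1 - j.1 = 0 then (q : ℂ) else 0) - 1)))
      = (((((q : ℝ) ^ 2)⁻¹ * ((if i = j then (q : ℝ) else 0) - 1) : ℝ)) : ℂ) := by
    simp only [sub_eq_zero, Subtype.ext_iff]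
    split_ifs <;> push_cast <;> rfl
  simp only [covMatrix, Matrix.of_apply, Complex.ofReal_one, one_mul, h]
  rw [h1, Complex.ofReal_re]

theorem covMatrix_one_mul_precisionMatrix :
    covMatrix (fun _ => 1) * precisionMatrix q = 1 := by
  have hq : (q : ℝ) ≠ 0 := by exact_mod_cast NeZero.ne q
  ext i j
  rw [Matrix.mul_apply]
  simp only [covMatrix_one_apply, precisionMatrix, Matrix.of_apply, Matrix.one_apply]
  have h1 : ∀ k : NZ q, ((q : ℝ) ^ 2)⁻¹ * ((if i = k then (q : ℝ) else 0) - 1) *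
      ((q : ℝ) * ((if k = j then 1 else 0) + 1))
      = (q : ℝ)⁻¹ * ((if i = k then (q : ℝ) * ((if k = j then 1 else 0) + 1) else 0)
        - (if k = j then 1 else 0) - 1) := by
    intro k
    split_ifs <;> field_simp <;> ring
  simp only [h1]
  rw [← Finset.mul_sum, Finset.sum_sub_distrib, Finset.sum_sub_distrib]
  simp only [Finset.sum_ite_eq, Finset.sum_ite_eq', Finset.mem_univ, if_true, Finset.sum_const,
    Finset.card_univ, nsmul_eq_mul, mul_one]
  rw [card_NZ]
  split_ifs <;> field_simp <;> ring

theorem inv_covMatrix_one : (covMatrix (q := q) fun _ => 1)⁻¹ = precisionMatrix q :=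
  Matrix.inv_eq_right_inv covMatrix_one_mul_precisionMatrix

theorem det_precisionMatrix : (precisionMatrix q).det = (q : ℝ) ^ q := by
  have hq : (q : ℝ) ≠ 0 := by exact_mod_cast NeZero.ne q
  have h1 : precisionMatrix q
      = (q : ℝ) • ((1 : Matrix (NZ q) (NZ q) ℝ) + replicateCol Unit (fun _ : NZ q => (1 : ℝ)) *
        replicateRow Unit fun _ : NZ q => (1 : ℝ)) := by
    ext i j
    simp [precisionMatrix, Matrix.one_apply, Matrix.mul_apply]
  rw [h1, det_smul, det_one_add_replicateCol_mul_replicateRow]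
  have h2 : (fun _ : NZ q => (1 : ℝ)) ⬝ᵥ (fun _ => 1) = (q : ℝ) - 1 := by
    rw [← card_NZ]
    simp [dotProduct]
  have h3 : q = Fintype.card (NZ q) + 1 := by
    have := card_NZ (q := q)
    have h4 : ((Fintype.card (NZ q) + 1 : ℕ) : ℝ) = q := by
      push_cast
      linarith
    exact_mod_cast h4.symm
  rw [h2, add_sub_cancel]
  conv_rhs => rw [h3]
  rw [pow_succ, ← h3]

theorem det_covMatrix_one : (covMatrix (q := q) fun _ => 1).det = ((q : ℝ) ^ q)⁻¹ := by
  have h := congrArg Matrix.det (covMatrix_one_mul_precisionMatrix (q := q))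
  rw [det_mul, det_precisionMatrix, det_one] at h
  exact eq_inv_of_mul_eq_one_left h

theorem quadForm_precisionMatrix (u : NZ q → ℂ) :
    quadForm (precisionMatrix q) u = q * (∑ j, u j ^ 2 + (∑ j, u j) ^ 2) := by
  simp only [quadForm, dotProduct, mulVec, Matrix.map_apply, precisionMatrix, Matrix.of_apply]
  have h1 : ∀ i : NZ q, u i * ∑ j : NZ q,
      (((q : ℝ) * ((if i = j then 1 else 0) + 1) : ℝ) : ℂ) * u j
      = q * (u i ^ 2 + u i * ∑ j, u j) := by
    intro i
    have h2 : ∀ j : NZ q, (((q : ℝ) * ((if i = j then 1 else 0) + 1) : ℝ) : ℂ) * u j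
        = q * ((if i = j then u j else 0) + u j) := by
      intro j
      split_ifs <;> push_cast <;> ring
    simp only [h2]
    rw [← Finset.mul_sum, Finset.sum_add_distrib, Finset.sum_ite_eq, if_pos (Finset.mem_univ i)]
    ring
  simp only [h1]
  rw [← Finset.mul_sum, Finset.sum_add_distrib, ← Finset.sum_mul]
  ring

/-- The stationary density is the normal density with covariance form `∑_k |τ_k|²`. -/
theorem gaussPdf_covMatrix_one (y : NZ q → ℝ) :
    gaussPdf (covMatrix fun _ => 1) y = gaussianDensity y := by
  have hq : (0 : ℝ) < q := by exact_mod_cast NeZero.pos q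
  have hpi := Real.pi_pos
  have h1 : y ⬝ᵥ (precisionMatrix q *ᵥ y)
      = q * ∑ a : NZ q, ∑ b : NZ q, ((if a = b then 1 else 0) + 1) * y a * y b := by
    simp only [dotProduct, mulVec, precisionMatrix, Matrix.of_apply, Finset.mul_sum]
    refine Finset.sum_congr rfl fun i _ => Finset.sum_congr rfl fun j _ => ?_
    ring
  rw [gaussPdf, inv_covMatrix_one, h1, det_covMatrix_one, gaussianDensity]
  congr 1
  · rw [← Real.rpow_natCast (2 * Real.pi), card_NZ, Real.sqrt_mul (by positivity), Real.sqrt_inv,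
      Real.sqrt_eq_rpow, Real.sqrt_eq_rpow, ← Real.rpow_mul (by positivity),
      ← Real.rpow_natCast (q : ℝ) q, ← Real.rpow_mul hq.le, mul_inv, inv_inv, mul_comm,
      ← div_eq_mul_inv]
    congr 2 <;> ring
  · congr 1
    ring

end Covariance

/-! ### Termwise integration -/

section Termwise

/-- Termwise integration of a series dominated by an integrable function. -/
theorem hasSum_integral_of_tsum_norm_le {α ι : Type*} [Countable ι] [MeasurableSpace α]
    {μ : Measure α} {F : ι → α → ℂ} {S : α → ℝ} (hF : ∀ i, AEStronglyMeasurable (F i) μ)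
    (hS : Integrable S μ) (hsum : ∀ a, Summable fun i => ‖F i a‖)
    (hle : ∀ a, ∑' i, ‖F i a‖ ≤ S a) :
    (Summable fun i => ‖∫ a, F i a ∂μ‖) ∧
      HasSum (fun i => ∫ a, F i a ∂μ) (∫ a, ∑' i, F i a ∂μ) := by
  have hint : ∀ i, Integrable (F i) μ := fun i =>
    hS.mono' (hF i) (Eventually.of_forall fun a =>
      ((hsum a).le_tsum i fun _ _ => norm_nonneg _).trans (hle a))
  have h1 : Summable fun i => ∫ a, ‖F i a‖ ∂μ := by
    refine summable_of_sum_le (c := ∫ a, S a ∂μ)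
      (fun i => integral_nonneg fun a => norm_nonneg _) fun u => ?_
    rw [← integral_finsetSum u fun i _ => (hint i).norm]
    refine integral_mono (integrable_finsetSum u fun i _ => (hint i).norm) hS fun a => ?_
    exact ((hsum a).sum_le_tsum u fun _ _ => norm_nonneg _).trans (hle a)
  exact ⟨h1.of_nonneg_of_le (fun _ => norm_nonneg _) fun i => norm_integral_le_integral_norm _,
    hasSum_integral_of_summable_integral_norm hint h1⟩

theorem tsum_norm_exp_linear {ι : Type*} [Fintype ι] (c : ι → ℂ) :
    ∑' l : ι →₀ ℕ, ‖∏ k, c k ^ l k / ((l k).factorial : ℂ)‖ = Real.exp (∑ k, ‖c k‖) := by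
  have h := hasSum_exp_linear (fun k => (‖c k‖ : ℂ)) fun _ : ι => (1 : ℂ)
  simp only [one_pow, Finset.prod_const_one, mul_one, one_mul] at h
  rw [← Complex.ofReal_sum, ← Complex.ofReal_exp] at h
  refine ((Complex.hasSum_ofReal.mp (h.congr_fun fun l => ?_)).tsum_eq)
  rw [norm_prod, Complex.ofReal_prod]
  refine Finset.prod_congr rfl fun k _ => ?_
  simp

end Termwise

/-! ### Mehler's formula -/

section Mehler

open Matrix

variable {q : ℕ} [NeZero q]

/-- The integrand `exp (-½ ∑_k |τ_k|² - i t·y)` whose integral over `t` is, up to a constant,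
the stationary density at `y`. -/
noncomputable def fourierKernel (y t : NZ q → ℝ) : ℂ :=
  Complex.exp (-(1 / 2) * quadForm (covMatrix fun _ => 1) (toComplex t)
    + (Complex.I • toComplex (-y)) ⬝ᵥ toComplex t)

theorem continuous_fourierKernel (y : NZ q → ℝ) : Continuous (fourierKernel y) := by
  unfold fourierKernel quadForm toComplex
  simp only [dotProduct, mulVec]
  fun_prop

theorem norm_fourierKernel (y t : NZ q → ℝ) :
    ‖fourierKernel y t‖ = Real.exp (-(1 / 2) * ∑ k : NZ q, 1 * ‖freq t k.1‖ ^ 2) := by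
  rw [fourierKernel, Complex.norm_exp, quadForm_covMatrix]
  congr 1
  have h : ((Complex.I • toComplex (-y)) ⬝ᵥ toComplex t).re = 0 := by
    simp [dotProduct, toComplex]
  rw [Complex.add_re, h, add_zero]
  have h2 : (-(1 / 2) : ℂ) = ((-(1 / 2) : ℝ) : ℂ) := by norm_num
  rw [h2, Complex.re_ofReal_mul, Complex.ofReal_re]

theorem sum_mul_freq (w : NZ q → ℂ) (t : NZ q → ℝ) :
    ∑ k : NZ q, w k * freq t k.1 = ∑ j : NZ q, formValue w (-j.1) / q * (t j : ℂ) := by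
  simp only [freq, formValue, Finset.mul_sum, Finset.sum_div, Finset.sum_mul]
  rw [Finset.sum_comm]
  refine Finset.sum_congr rfl fun j _ => Finset.sum_congr rfl fun k _ => ?_
  rw [theta_neg_left, theta_neg_right]
  ring

/-- Completing the square in the Gaussian integral behind the generating function. -/
theorem quadForm_precisionMatrix_shift (w : NZ q → ℂ) (y : NZ q → ℝ) :
    quadForm (precisionMatrix q) (Complex.I • fun j => formValue w (-j.1) / q - (y j : ℂ))
      = -q * ∑ j, ((extend y j : ℝ) : ℂ) ^ 2 - ∑ k : NZ q, w k * w (negNZ k)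
        + 2 * ∑ k : NZ q, w k * charSum (extend y) (-k.1) := by
  have hq : (q : ℂ) ≠ 0 := by exact_mod_cast NeZero.ne q
  set u : ZMod q → ℂ := fun j => formValue w (-j) / q - (extend y j : ℂ) with hu
  have hsum : ∀ f : ZMod q → ℂ, ∑ j, f (-j) = ∑ j, f j := fun f =>
    Equiv.sum_comp (Equiv.neg (ZMod q)) f
  have h0 : ∑ j, u j = 0 := by
    rw [hu, Finset.sum_sub_distrib, ← Finset.sum_div, hsum (formValue w), sum_formValue, zero_div,
      zero_sub, neg_eq_zero]
    exact_mod_cast sum_extend y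
  have h1 : (fun j : NZ q => formValue w (-j.1) / q - (y j : ℂ)) = fun j => u j.1 := by
    ext j
    simp only [hu, extend_coe]
  have h2 : ∑ j : NZ q, u j.1 ^ 2 + (∑ j : NZ q, u j.1) ^ 2 = ∑ j, u j ^ 2 := by
    rw [sum_nonzero fun j => u j ^ 2, sum_nonzero u, h0]
    ring
  have h3 : ∑ j, formValue w (-j) ^ 2 = q * ∑ k : NZ q, w k * w (negNZ k) := by
    rw [hsum fun j => formValue w j ^ 2, sum_formValue_sq]
  have h4 : ∑ j, ((extend y j : ℝ) : ℂ) * formValue w (-j)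
      = ∑ k : NZ q, w k * charSum (extend y) (-k.1) := by
    simp only [formValue, charSum, Finset.mul_sum]
    rw [Finset.sum_comm]
    refine Finset.sum_congr rfl fun k _ => Finset.sum_congr rfl fun j _ => ?_
    rw [theta_neg_left, theta_neg_right]
    ring
  have h5 : ∑ j, u j ^ 2 = ((q : ℂ) ^ 2)⁻¹ * ∑ j, formValue w (-j) ^ 2
      - 2 / q * ∑ j, ((extend y j : ℝ) : ℂ) * formValue w (-j)
      + ∑ j, ((extend y j : ℝ) : ℂ) ^ 2 := by
    rw [Finset.mul_sum, Finset.mul_sum, ← Finset.sum_sub_distrib, ← Finset.sum_add_distrib]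
    refine Finset.sum_congr rfl fun j _ => ?_
    rw [hu]
    field_simp
    ring
  rw [quadForm_smul, h1, quadForm_precisionMatrix, h2, h5, h3, h4, Complex.I_sq]
  field_simp
  ring

/-- `(2π)^{q-1}` times the stationary density, the normalization of the Fourier integrals. -/
noncomputable def scaledDensity (y : NZ q → ℝ) : ℂ :=
  (((2 * Real.pi) ^ Fintype.card (NZ q) * gaussianDensity y : ℝ) : ℂ)

theorem integral_fourierKernel (y : NZ q → ℝ) : ∫ t, fourierKernel y t = scaledDensity y := by
  simp only [fourierKernel]
  rw [integral_gaussian_fourier (posDef_covMatrix fun _ => one_pos), gaussPdf_neg,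
    gaussPdf_covMatrix_one, scaledDensity]

/-- The Fourier representation of the generating function of the limit polynomials. -/
theorem integral_fourierKernel_mul_exp (y : NZ q → ℝ) (w : NZ q → ℂ) :
    ∫ t, fourierKernel y t * Complex.exp (∑ k : NZ q, w k * (Complex.I * freq t k.1))
      = scaledDensity y * (starRingEnd ℂ)
          (limitGenValue (extend y) fun k => (starRingEnd ℂ) (w k)) := by
  obtain ⟨K, hK⟩ : ∃ K : ℂ, ∀ w : NZ q → ℂ,
      ∫ t, fourierKernel y t * Complex.exp (∑ k : NZ q, w k * (Complex.I * freq t k.1))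
        = K * Complex.exp (1 / 2 * quadForm (precisionMatrix q)
          (Complex.I • fun j => formValue w (-j.1) / q - (y j : ℂ))) := by
    refine ⟨((Real.sqrt ((2 * Real.pi) ^ Fintype.card (NZ q)) /
      Real.sqrt (covMatrix (q := q) fun _ => 1).det : ℝ) : ℂ), fun w => ?_⟩
    rw [← inv_covMatrix_one, ← (gaussian_integral (posDef_covMatrix (q := q) fun _ => one_pos)
      (Complex.I • fun j => formValue w (-j.1) / q - (y j : ℂ))).2]
    congr 1
    ext t
    rw [fourierKernel, ← Complex.exp_add, add_assoc]
    congr 2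
    have h := sum_mul_freq w t
    have h1 : ∑ k : NZ q, w k * (Complex.I * freq t k.1)
        = Complex.I * ∑ k : NZ q, w k * freq t k.1 := by
      rw [Finset.mul_sum]
      exact Finset.sum_congr rfl fun k _ => by ring
    rw [h1, h]
    simp only [dotProduct, toComplex, Pi.smul_apply, smul_eq_mul, Finset.mul_sum, Pi.neg_apply]
    rw [← Finset.sum_add_distrib]
    refine Finset.sum_congr rfl fun j _ => ?_
    push_cast
    ring
  have h0 := hK 0
  simp only [Pi.zero_apply, zero_mul, Finset.sum_const_zero, Complex.exp_zero, mul_one] at h0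
  rw [integral_fourierKernel] at h0
  rw [hK w, h0, quadForm_precisionMatrix_shift, mul_assoc]
  have h6 := quadForm_precisionMatrix_shift (0 : NZ q → ℂ) y
  simp only [Pi.zero_apply, zero_mul, Finset.sum_const_zero, mul_zero, add_zero, sub_zero] at h6
  rw [h6, limitGenValue, ← Complex.exp_conj, ← Complex.exp_add]
  congr 2
  simp only [map_add, map_mul, map_neg, map_sum, Complex.conj_conj, ← charSum_neg, map_div₀,
    map_one, map_ofNat]
  ring

/-- The limit polynomials weighted by the stationary density are Fourier transforms of monomials
in the frequencies times a Gaussian. -/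
theorem integral_fourierKernel_mul_prod (y : NZ q → ℝ) (l : NZ q →₀ ℕ) :
    ∫ t, fourierKernel y t * ∏ k : NZ q, (Complex.I * freq t k.1) ^ l k / ((l k).factorial : ℂ)
      = scaledDensity y * (starRingEnd ℂ) (limitQ l (extend y)) := by
  have key : ∀ w : NZ q → ℂ, (∀ k, ‖w k‖ = 1) →
      (Summable fun l : NZ q →₀ ℕ => ‖∫ t, fourierKernel y t *
        ∏ k : NZ q, (w k * (Complex.I * freq t k.1)) ^ l k / ((l k).factorial : ℂ)‖) ∧
      HasSum (fun l : NZ q →₀ ℕ => ∫ t, fourierKernel y t *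
        ∏ k : NZ q, (w k * (Complex.I * freq t k.1)) ^ l k / ((l k).factorial : ℂ))
        (scaledDensity y * (starRingEnd ℂ)
          (limitGenValue (extend y) fun k => (starRingEnd ℂ) (w k))) := by
    intro w hw
    rw [← integral_fourierKernel_mul_exp]
    have hlin : ∀ t : NZ q → ℝ, HasSum (fun l : NZ q →₀ ℕ => fourierKernel y t *
        ∏ k : NZ q, (w k * (Complex.I * freq t k.1)) ^ l k / ((l k).factorial : ℂ))
        (fourierKernel y t * Complex.exp (∑ k : NZ q, w k * (Complex.I * freq t k.1))) := by
      intro t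
      have h := hasSum_exp_linear (fun k : NZ q => w k * (Complex.I * freq t k.1)) fun _ => 1
      simp only [one_pow, Finset.prod_const_one, mul_one, one_mul] at h
      exact h.mul_left _
    have h := hasSum_integral_of_tsum_norm_le (μ := (volume : Measure (NZ q → ℝ)))
      (F := fun (l : NZ q →₀ ℕ) (t : NZ q → ℝ) => fourierKernel y t *
        ∏ k : NZ q, (w k * (Complex.I * freq t k.1)) ^ l k / ((l k).factorial : ℂ))
      (fun l => ?_) (integrable_exp_freq (c := fun _ => 1) (fun _ => one_pos) fun _ => 1)
      (fun t => ?_) (fun t => ?_)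
    · refine ⟨h.1, ?_⟩
      convert h.2 using 2
      ext t
      exact (hlin t).tsum_eq.symm
    · refine ((continuous_fourierKernel y).mul (continuous_finsetProd _ fun k _ => ?_)).aestronglyMeasurable
      exact ((continuous_const.mul (continuous_const.mul (continuous_freq k.1))).pow _).div_const _
    · simp only [norm_mul (fourierKernel y t)]
      exact (summable_exp_linear _).mul_left _
    · simp only [norm_mul (fourierKernel y t)]
      rw [tsum_mul_left, tsum_norm_exp_linear, norm_fourierKernel, ← Real.exp_add]
      simp [hw]
  have h1 := key (fun _ => 1) fun _ => norm_one
  simp only [one_mul] at h1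
  refine congrFun (coeff_unique (F := fun w => scaledDensity y * (starRingEnd ℂ)
    (limitGenValue (extend y) fun k => (starRingEnd ℂ) (w k)))
    (b := fun l => scaledDensity y * (starRingEnd ℂ) (limitQ l (extend y))) h1.1 ?_
    (fun w hw => ?_) fun w hw => ?_) l
  · have h := (summable_norm_limitQ (extend y) (r := fun _ => 1) fun _ => zero_le_one).mul_left
      ‖scaledDensity y‖
    simpa using h
  · refine (key w hw).2.congr_fun fun l => ?_
    rw [← integral_mul_const]
    congr 1
    ext t
    rw [mul_assoc, ← Finset.prod_mul_distrib]
    congr 1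
    refine Finset.prod_congr rfl fun k _ => ?_
    rw [mul_pow]
    ring
  · have h := (Complex.hasSum_conj'.mpr
      (hasSum_limitQ (extend y) fun k => (starRingEnd ℂ) (w k)))
    refine (h.mul_left (scaledDensity y)).congr_fun fun l => ?_
    simp [mul_assoc]

/-- The mean of the limit transition density started at `x`. -/
noncomputable def meanVec (v : ZMod q → ℝ) (x : NZ q → ℝ) : NZ q → ℝ := fun j =>
  ((q : ℂ)⁻¹ * ∑ k : NZ q, limitEigen v k * charSum (extend x) k.1 * theta q (-k.1) j.1).re

theorem continuous_meanVec (v : ZMod q → ℝ) : Continuous (meanVec v) := by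
  refine continuous_pi fun j => Complex.continuous_re.comp (continuous_const.mul
    (continuous_finsetSum _ fun k _ => ?_))
  exact (continuous_const.mul ((continuous_charSum k.1).comp continuous_extend)).mul
    continuous_const

theorem limitEigen_negNZ (v : ZMod q → ℝ) (k : NZ q) :
    limitEigen v (negNZ k) = (starRingEnd ℂ) (limitEigen v k) := by
  simp [limitEigen, theta_negNZ]

/-- The mean is real because conjugation permutes the nontrivial characters. -/
theorem ofReal_meanVec (v : ZMod q → ℝ) (x : NZ q → ℝ) (j : NZ q) :
    (meanVec v x j : ℂ)
      = (q : ℂ)⁻¹ * ∑ k : NZ q, limitEigen v k * charSum (extend x) k.1 * theta q (-k.1) j.1 := by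
  refine Complex.conj_eq_iff_re.mp ?_
  simp only [map_mul, map_inv₀, map_natCast, map_sum]
  rw [← Equiv.sum_comp negEquiv]
  congr 1
  refine Finset.sum_congr rfl fun k _ => ?_
  have h : (negEquiv k : NZ q) = negNZ k := rfl
  have h2 : (negNZ k : NZ q).1 = -k.1 := rfl
  rw [h, limitEigen_negNZ, h2, charSum_neg, Complex.conj_conj, Complex.conj_conj, neg_neg,
    theta_neg_left]

theorem sum_limitEigen_mul_freq (v : ZMod q → ℝ) (x t : NZ q → ℝ) :
    ∑ k : NZ q, limitEigen v k * freq t k.1 * charSum (extend x) k.1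
      = toComplex (meanVec v x) ⬝ᵥ toComplex t := by
  simp only [dotProduct, toComplex, ofReal_meanVec, freq, Finset.mul_sum, Finset.sum_mul]
  rw [Finset.sum_comm]
  exact Finset.sum_congr rfl fun j _ => Finset.sum_congr rfl fun k _ => by ring

theorem limitEigen_freq_mul_neg (v : ZMod q → ℝ) (t : NZ q → ℝ) (k : NZ q) :
    limitEigen v k * freq t k.1 * (limitEigen v (negNZ k) * freq t (negNZ k).1)
      = ((‖limitEigen v k‖ ^ 2 * ‖freq t k.1‖ ^ 2 : ℝ) : ℂ) := by
  have h2 : (negNZ k : NZ q).1 = -k.1 := rfl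
  rw [limitEigen_negNZ, h2, freq_neg]
  push_cast
  rw [← Complex.mul_conj', ← Complex.mul_conj']
  ring

/-- The matrix of the covariance form `∑_k (1 - |λ_k|²) |τ_k|²` of the limit transition density. -/
noncomputable def transitionCov (v : ZMod q → ℝ) : Matrix (NZ q) (NZ q) ℝ :=
  covMatrix fun k => 1 - ‖limitEigen v k‖ ^ 2

theorem posDef_transitionCov {v : ZMod q → ℝ} (h : ∀ k : NZ q, ‖limitEigen v k‖ < 1) :
    (transitionCov v).PosDef :=
  posDef_covMatrix fun k => by nlinarith [h k, norm_nonneg (limitEigen v k)]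

/-- At purely imaginary multiples of the contracted frequencies, the generating function is a
Gaussian growing in the frequencies, times an oscillation. -/
theorem limitGenValue_freq (v : ZMod q → ℝ) (x t : NZ q → ℝ) :
    limitGenValue (extend x) (fun k => Complex.I * (limitEigen v k * freq t k.1))
      = Complex.exp (1 / 2 * ((∑ k : NZ q, ‖limitEigen v k‖ ^ 2 * ‖freq t k.1‖ ^ 2 : ℝ) : ℂ)
          + Complex.I * (toComplex (meanVec v x) ⬝ᵥ toComplex t)) := by
  rw [limitGenValue, ← sum_limitEigen_mul_freq]
  push_cast
  congr 2
  · rw [Finset.mul_sum, Finset.mul_sum]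
    refine Finset.sum_congr rfl fun k _ => ?_
    have h := limitEigen_freq_mul_neg v t k
    push_cast at h
    rw [← h]
    linear_combination (-(1 / 2) * (limitEigen v k * freq t k.1 *
      (limitEigen v (negNZ k) * freq t (negNZ k).1))) * Complex.I_sq
  · rw [Finset.mul_sum]
    exact Finset.sum_congr rfl fun k _ => by ring

theorem quadForm_transitionCov (v : ZMod q → ℝ) (t : NZ q → ℝ) :
    quadForm (transitionCov v) (toComplex t)
      = ((∑ k : NZ q, ‖freq t k.1‖ ^ 2 : ℝ) : ℂ)
        - ((∑ k : NZ q, ‖limitEigen v k‖ ^ 2 * ‖freq t k.1‖ ^ 2 : ℝ) : ℂ) := by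
  rw [transitionCov, quadForm_covMatrix, ← Complex.ofReal_sub, ← Finset.sum_sub_distrib]
  congr 1
  exact Finset.sum_congr rfl fun k _ => by ring

theorem fourierKernel_mul_limitGenValue (v : ZMod q → ℝ) (x y t : NZ q → ℝ) :
    fourierKernel y t *
        limitGenValue (extend x) (fun k => Complex.I * (limitEigen v k * freq t k.1))
      = Complex.exp (-(1 / 2) * quadForm (transitionCov v) (toComplex t)
        + (Complex.I • toComplex (meanVec v x - y)) ⬝ᵥ toComplex t) := by
  have h1 : (Complex.I • toComplex (meanVec v x - y)) ⬝ᵥ toComplex t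
      = (Complex.I • toComplex (-y)) ⬝ᵥ toComplex t
        + Complex.I * (toComplex (meanVec v x) ⬝ᵥ toComplex t) := by
    rw [smul_dotProduct, smul_dotProduct, smul_eq_mul, smul_eq_mul, ← mul_add, ← add_dotProduct]
    congr 2
    ext j
    simp [toComplex]
    ring
  rw [limitGenValue_freq, fourierKernel, ← Complex.exp_add, h1, quadForm_transitionCov,
    quadForm_covMatrix]
  simp only [one_mul]
  congr 1
  ring

/-- Termwise integration in the Fourier representation: the series of the limit transition density
is the Fourier integral of a Gaussian. -/
theorem hasSum_scaledDensity_mul_limitTerm {v : ZMod q → ℝ}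
    (h : ∀ k : NZ q, ‖limitEigen v k‖ < 1) (x y : NZ q → ℝ) :
    HasSum (fun l => scaledDensity y * limitTerm v x y l)
      (((2 * Real.pi) ^ Fintype.card (NZ q) *
        gaussPdf (transitionCov v) (y - meanVec v x) : ℝ) : ℂ) := by
  have hr : ∀ (t : NZ q → ℝ) (k : NZ q), 0 ≤ ‖limitEigen v k * freq t k.1‖ := fun _ _ =>
    norm_nonneg _
  have hnorm : ∀ (t : NZ q → ℝ) (l : NZ q →₀ ℕ), ‖fourierKernel y t * (limitQ l (extend x) *
      ∏ k : NZ q, (Complex.I * (limitEigen v k * freq t k.1)) ^ l k)‖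
      = ‖fourierKernel y t‖ * (‖limitQ l (extend x)‖ *
        ∏ k : NZ q, ‖limitEigen v k * freq t k.1‖ ^ l k) := by
    intro t l
    rw [norm_mul, norm_mul, norm_prod]
    simp only [norm_pow, norm_mul Complex.I, Complex.norm_I, one_mul]
  have hmain := hasSum_integral_of_tsum_norm_le (μ := (volume : Measure (NZ q → ℝ)))
    (F := fun (l : NZ q →₀ ℕ) (t : NZ q → ℝ) => fourierKernel y t * (limitQ l (extend x) *
      ∏ k : NZ q, (Complex.I * (limitEigen v k * freq t k.1)) ^ l k))
    (fun l => ?_)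
    (integrable_exp_freq (c := fun k : NZ q => 1 - ‖limitEigen v k‖ ^ 2)
      (fun k => by nlinarith [h k, norm_nonneg (limitEigen v k)])
      fun k => ‖charSum (extend x) k.1‖ * ‖limitEigen v k‖)
    (fun t => ?_) (fun t => ?_)
  · have hsum : ∀ t : NZ q → ℝ, ∑' l : NZ q →₀ ℕ, fourierKernel y t * (limitQ l (extend x) *
        ∏ k : NZ q, (Complex.I * (limitEigen v k * freq t k.1)) ^ l k)
        = Complex.exp (-(1 / 2) * quadForm (transitionCov v) (toComplex t)
          + (Complex.I • toComplex (meanVec v x - y)) ⬝ᵥ toComplex t) := fun t => by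
      rw [← fourierKernel_mul_limitGenValue]
      exact ((hasSum_limitQ (extend x) _).mul_left _).tsum_eq
    have h2 := hmain.2
    simp only [hsum] at h2
    rw [integral_gaussian_fourier (posDef_transitionCov h), ← neg_sub y, gaussPdf_neg] at h2
    refine h2.congr_fun fun l => ?_
    have h3 := congrArg (fun z => limitQ l (extend x) * (∏ k : NZ q, limitEigen v k ^ l k) *
      (∏ k : NZ q, ((l k).factorial : ℂ)) * z) (integral_fourierKernel_mul_prod y l)
    simp only [← integral_const_mul] at h3
    rw [limitTerm]
    refine Eq.trans ?_ (h3.symm.trans ?_)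
    · ring
    · congr 1
      ext t
      rw [Finset.prod_div_distrib]
      have h4 : (∏ k : NZ q, ((l k).factorial : ℂ)) ≠ 0 :=
        Finset.prod_ne_zero_iff.mpr fun k _ => by exact_mod_cast (l k).factorial_ne_zero
      have h5 : ∏ k : NZ q, (Complex.I * (limitEigen v k * freq t k.1)) ^ l k
          = (∏ k : NZ q, limitEigen v k ^ l k) * ∏ k : NZ q, (Complex.I * freq t k.1) ^ l k := by
        rw [← Finset.prod_mul_distrib]
        exact Finset.prod_congr rfl fun k _ => by ring
      rw [h5]
      field_simp
  · refine ((continuous_fourierKernel y).mul (continuous_const.mul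
      (continuous_finsetProd _ fun k _ => ?_))).aestronglyMeasurable
    exact (continuous_const.mul (continuous_const.mul (continuous_freq k.1))).pow _
  · simp only [hnorm]
    exact (summable_norm_limitQ (extend x) (hr t)).mul_left _
  · simp only [hnorm]
    rw [tsum_mul_left, norm_fourierKernel]
    refine (mul_le_mul_of_nonneg_left (tsum_norm_limitQ_le (extend x) (hr t))
      (Real.exp_pos _).le).trans (le_of_eq ?_)
    rw [← Real.exp_add]
    congr 1
    have h6 : ∀ k : NZ q, ‖limitEigen v (negNZ k) * freq t (negNZ k).1‖
        = ‖limitEigen v k * freq t k.1‖ := fun k => by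
      have h2 : (negNZ k : NZ q).1 = -k.1 := rfl
      rw [limitEigen_negNZ, h2, freq_neg, ← map_mul, RCLike.norm_conj]
    simp only [h6, norm_mul, Finset.mul_sum]
    rw [← Finset.sum_add_distrib, ← Finset.sum_add_distrib, ← Finset.sum_add_distrib]
    exact Finset.sum_congr rfl fun k _ => by ring

/-- A Mehler formula: the series `φ(y) ∑_l limitTerm` sums to a normal density. -/
theorem hasSum_limitTerm {v : ZMod q → ℝ} (h : ∀ k : NZ q, ‖limitEigen v k‖ < 1)
    (x y : NZ q → ℝ) :
    HasSum (limitTerm v x y) ((gaussPdf (transitionCov v) (y - meanVec v x) : ℂ)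
      / gaussianDensity y) := by
  have hpi := Real.pi_pos
  have hφ : (gaussianDensity y : ℂ) ≠ 0 := by exact_mod_cast (gaussianDensity_pos y).ne'
  have hN : (((2 * Real.pi) ^ Fintype.card (NZ q) : ℝ) : ℂ) ≠ 0 := by
    exact_mod_cast (by positivity : (0 : ℝ) < (2 * Real.pi) ^ Fintype.card (NZ q)).ne'
  have hs := (hasSum_scaledDensity_mul_limitTerm h x y).mul_left (scaledDensity y)⁻¹
  have hne : scaledDensity y ≠ 0 := by
    rw [scaledDensity, Complex.ofReal_mul]
    exact mul_ne_zero hN hφ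
  simp only [inv_mul_cancel_left₀ hne] at hs
  have hval : (scaledDensity y)⁻¹ * (((2 * Real.pi) ^ Fintype.card (NZ q) *
      gaussPdf (transitionCov v) (y - meanVec v x) : ℝ) : ℂ)
      = (gaussPdf (transitionCov v) (y - meanVec v x) : ℂ) / gaussianDensity y := by
    rw [scaledDensity, Complex.ofReal_mul, Complex.ofReal_mul]
    field_simp
  rwa [hval] at hs

theorem limitQ_zero (x : ZMod q → ℝ) : limitQ 0 x = 1 := by
  have h1 := hasSum_limitQ x fun _ => 0
  have h2 := hasSum_single (f := fun l : NZ q →₀ ℕ => limitQ l x * ∏ k, (0 : ℂ) ^ l k) 0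
    fun l hl => by
      obtain ⟨k, hk⟩ := Finsupp.ne_iff.mp hl
      rw [Finset.prod_eq_zero (Finset.mem_univ k) (zero_pow hk), mul_zero]
  have h3 := h2.unique h1
  simpa [limitGenValue] using h3

theorem limitDensity_eq {v : ZMod q → ℝ} (h : ∀ k : NZ q, ‖limitEigen v k‖ < 1)
    (x y : NZ q → ℝ) :
    limitDensity v x y = (gaussPdf (transitionCov v) (y - meanVec v x) : ℂ) := by
  have hφ : (gaussianDensity y : ℂ) ≠ 0 := by exact_mod_cast (gaussianDensity_pos y).ne'
  have hs := hasSum_limitTerm h x y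
  have h0 : limitTerm v x y 0 = 1 := by simp [limitTerm, limitQ_zero]
  have h1 : 1 + ∑' l : {l : NZ q →₀ ℕ // l ≠ 0}, limitTerm v x y l.1
      = ∑' l, limitTerm v x y l := by
    rw [← h0, ← hs.summable.sum_add_tsum_compl (s := {0}), Finset.sum_singleton]
    congr 1
    have : ((({0} : Finset (NZ q →₀ ℕ)) : Set (NZ q →₀ ℕ))ᶜ) = {l | l ≠ 0} := by
      ext l
      simp
    rw [this]
    rfl
  rw [limitDensity, h1, hs.tsum_eq, mul_div_cancel₀ _ hφ]

end Mehler

/-! ### Characteristic functions of the transition functions -/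

section MeanWalk

variable {q : ℕ} [NeZero q] {Ω : Type*} [MeasurableSpace Ω] {P : Measure Ω}
  {V : ℕ → Ω → ZMod q → ℕ}

/-- The transition probability of the grouped walk: the average over the law of `V` of the
transition probability with given increment counts. -/
noncomputable def meanWalkProb (P : Measure Ω) (d : ℕ) (V : Ω → ZMod q → ℕ) (m n : ZMod q → ℕ) :
    ℝ :=
  ∫ ω, walkProb d (V ω) m n ∂P

theorem meanWalkProb_nonneg (d : ℕ) (V : Ω → ZMod q → ℕ) (m n : ZMod q → ℕ) :
    0 ≤ meanWalkProb P d V m n :=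
  integral_nonneg fun _ => walkProb_nonneg _ _ _ _

theorem ofReal_meanWalkProb (d : ℕ) (V : Ω → ZMod q → ℕ) (m n : ZMod q → ℕ) :
    (meanWalkProb P d V m n : ℂ) = ∫ ω, (walkProb d (V ω) m n : ℂ) ∂P :=
  integral_ofReal.symm

/-- The spectral expansion of the transition probabilities of the grouped walk. -/
theorem groupedTransition_eq (hVsum : ∀ d ω, ∑ j, V d ω j = d) {d : ℕ} {m n : ZMod q → ℕ}
    (hm : ∑ j, m j = d) (hn : ∑ j, n j = d) :
    groupedTransition P d (V d) m n = (meanWalkProb P d (V d) m n : ℂ) := by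
  rw [groupedTransition, ofReal_meanWalkProb, ← integral_const_mul]
  congr 1
  ext ω
  rw [walkProb_eq (hVsum d ω) hm hn, Finset.sum_range_eq_add_Ico _ (Nat.succ_pos d)]
  congr 2
  · have h0 : krawtchouk (0 : NZ q →₀ ℕ) = fun _ => 1 := by
      ext m
      rw [krawtchouk, ← MvPolynomial.constantCoeff_eq]
      simp [krawtchoukGen, linForm]
    have hd : (d.factorial : ℂ) ≠ 0 := by exact_mod_cast d.factorial_ne_zero
    simp [spectralTerm, h0, hNorm, hd]

variable [IsProbabilityMeasure P]

theorem sum_meanWalkProb_mul (hVmeas : ∀ d, Measurable (V d))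
    (hVsum : ∀ d ω, ∑ j, V d ω j = d) (d : ℕ) (m : ZMod q → ℕ) (g : (ZMod q → ℕ) → ℂ) :
    ∑ n ∈ Finset.piAntidiag Finset.univ d, (meanWalkProb P d (V d) m n : ℂ) * g n
      = ∫ ω, ∑ n ∈ Finset.piAntidiag Finset.univ d, (walkProb d (V d ω) m n : ℂ) * g n ∂P := by
  rw [integral_finsetSum _ fun n _ => integrable_comp_counts hVmeas hVsum d
    (g := fun v => (walkProb d v m n : ℂ) * g n)]
  refine Finset.sum_congr rfl fun n _ => ?_
  rw [integral_mul_const, ofReal_meanWalkProb]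

theorem sum_meanWalkProb (hVmeas : ∀ d, Measurable (V d)) (hVsum : ∀ d ω, ∑ j, V d ω j = d)
    (d : ℕ) (m : ZMod q → ℕ) :
    ∑ n ∈ Finset.piAntidiag Finset.univ d, meanWalkProb P d (V d) m n = 1 := by
  have h := sum_meanWalkProb_mul (P := P) hVmeas hVsum d m fun _ => 1
  have h1 : ∀ ω, ∑ n ∈ Finset.piAntidiag Finset.univ d, (walkProb d (V d ω) m n : ℂ) = 1 :=
    fun ω => by exact_mod_cast sum_walkProb d (V d ω) m
  simp only [mul_one, h1] at h
  simp only [integral_const, probReal_univ, one_smul] at h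
  exact_mod_cast h

end MeanWalk

section CharFun

open Matrix

variable {q : ℕ} [NeZero q]

theorem tendsto_sq_mul_exp_sub (z : ℂ) :
    Tendsto (fun d : ℕ => (d : ℂ) * (Complex.exp (z / (Real.sqrt d : ℝ)) - 1
      - z / (Real.sqrt d : ℝ))) atTop (𝓝 (z ^ 2 / 2)) := by
  have hs := tendsto_sqrt_natCast
  have hsmall : Tendsto (fun d : ℕ => ‖z‖ ^ 3 * (2 / 9) * (Real.sqrt d)⁻¹) atTop (𝓝 0) := by
    simpa using (tendsto_inv_atTop_zero.comp hs).const_mul (‖z‖ ^ 3 * (2 / 9))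
  rw [tendsto_iff_norm_sub_tendsto_zero]
  refine squeeze_zero' (Eventually.of_forall fun _ => norm_nonneg _) ?_ hsmall
  filter_upwards [hs.eventually_gt_atTop 0, hs.eventually_ge_atTop ‖z‖] with d hd hz
  have hd' : ((Real.sqrt d : ℝ) : ℂ) ≠ 0 := by exact_mod_cast hd.ne'
  have hsq : (d : ℂ) = ((Real.sqrt d : ℝ) : ℂ) ^ 2 := by
    rw [← Complex.ofReal_pow, Real.sq_sqrt (Nat.cast_nonneg d), Complex.ofReal_natCast]
  set s := Real.sqrt d with hsdef
  have hnz : ‖z / (s : ℂ)‖ = ‖z‖ / s := by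
    rw [norm_div, Complex.norm_real, Real.norm_of_nonneg hd.le]
  have hb := Complex.exp_bound (x := z / (s : ℂ)) (by rw [hnz]; exact (div_le_one hd).mpr hz)
    (n := 3) (by norm_num)
  have heq : (d : ℂ) * (Complex.exp (z / (s : ℂ)) - 1 - z / (s : ℂ)) - z ^ 2 / 2
      = (s : ℂ) ^ 2 * (Complex.exp (z / (s : ℂ))
        - ∑ m ∈ Finset.range 3, (z / (s : ℂ)) ^ m / m.factorial) := by
    rw [hsq]
    simp only [Finset.sum_range_succ, Finset.sum_range_zero, Nat.factorial]
    field_simp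
    push_cast
    ring
  rw [heq, norm_mul, norm_pow, Complex.norm_real, Real.norm_of_nonneg hd.le]
  refine (mul_le_mul_of_nonneg_left hb (by positivity)).trans (le_of_eq ?_)
  rw [hnz]
  simp only [Nat.factorial]
  field_simp
  push_cast
  ring

theorem tendsto_sqrt_mul_exp_sub_one (z : ℂ) :
    Tendsto (fun d : ℕ => ((Real.sqrt d : ℝ) : ℂ) * (Complex.exp (z / (Real.sqrt d : ℝ)) - 1))
      atTop (𝓝 z) := by
  have hinv : Tendsto (fun d : ℕ => (((Real.sqrt d)⁻¹ : ℝ) : ℂ)) atTop (𝓝 0) := by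
    simpa [Function.comp_def] using (Complex.continuous_ofReal.tendsto 0).comp
      (tendsto_inv_atTop_zero.comp tendsto_sqrt_natCast)
  have h := (hinv.mul (tendsto_sq_mul_exp_sub z)).add_const z
  rw [zero_mul, zero_add] at h
  refine h.congr' ?_
  filter_upwards [tendsto_sqrt_natCast.eventually_gt_atTop 0] with d hd
  have hd' : ((Real.sqrt d : ℝ) : ℂ) ≠ 0 := by exact_mod_cast hd.ne'
  have hsq : (d : ℂ) = ((Real.sqrt d : ℝ) : ℂ) ^ 2 := by
    rw [← Complex.ofReal_pow, Real.sq_sqrt (Nat.cast_nonneg d), Complex.ofReal_natCast]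
  rw [hsq]
  push_cast
  field_simp
  ring

/-- The factor `exp (i t_j / √d)` by which the exponential of the scaled counts changes with each
coordinate in state `j`, where `t_j` is centred by removing its mean. -/
noncomputable def phase (t : NZ q → ℝ) (d : ℕ) (j : ZMod q) : ℂ :=
  Complex.exp (Complex.I * formValue (fun k => freq t k.1) j / (Real.sqrt d : ℝ))

/-- The mean over `j` of the phases. -/
noncomputable def phaseMean (t : NZ q → ℝ) (d : ℕ) : ℂ := (q : ℂ)⁻¹ * ∑ j, phase t d j

/-- The Fourier coefficients of the phases, relative to their mean. -/
noncomputable def phaseCoeff (t : NZ q → ℝ) (d : ℕ) (k : NZ q) : ℂ :=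
  (phaseMean t d)⁻¹ * ((q : ℂ)⁻¹ * ∑ j, phase t d j * theta q (-k.1) j)

theorem phaseMean_mul_one_add {t : NZ q → ℝ} {d : ℕ} (hc : phaseMean t d ≠ 0) (j : ZMod q) :
    phaseMean t d * (1 + formValue (phaseCoeff t d) j) = phase t d j := by
  have hq : (q : ℂ) ≠ 0 := by exact_mod_cast NeZero.ne q
  have h1 : phaseMean t d * formValue (phaseCoeff t d) j
      = ∑ k : NZ q, (q : ℂ)⁻¹ * ∑ i, phase t d i * theta q k.1 (j - i) := by
    rw [formValue, Finset.mul_sum]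
    refine Finset.sum_congr rfl fun k _ => ?_
    have h2 : ∑ i, phase t d i * theta q k.1 (j - i)
        = theta q k.1 j * ∑ i, phase t d i * theta q (-k.1) i := by
      rw [Finset.mul_sum]
      refine Finset.sum_congr rfl fun i _ => ?_
      rw [sub_eq_add_neg, theta_add_right, theta_neg_left, theta_neg_right]
      ring
    rw [h2, phaseCoeff]
    field_simp
  have h3 := sum_nonzero fun k : ZMod q => (q : ℂ)⁻¹ * ∑ i, phase t d i * theta q k (j - i)
  rw [mul_add, mul_one, h1, h3, ← Finset.mul_sum, Finset.sum_comm]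
  simp only [← Finset.mul_sum, sum_theta_right, sub_eq_zero, theta_zero_left, mul_one]
  rw [Finset.sum_eq_single j (fun i _ hi => by rw [if_neg hi.symm, mul_zero]) (by simp),
    if_pos rfl, phaseMean]
  field_simp
  ring

/-- The mean of the phases is `1 - ∑ |τ_k|² / 2d` to leading order: the first-order terms cancel
because the `t_j` are centred. -/
theorem tendsto_mul_phaseMean_sub_one (t : NZ q → ℝ) :
    Tendsto (fun d : ℕ => (d : ℂ) * (phaseMean t d - 1)) atTop
      (𝓝 (-(1 / 2) * ((∑ k : NZ q, ‖freq t k.1‖ ^ 2 : ℝ) : ℂ))) := by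
  have hq : (q : ℂ) ≠ 0 := by exact_mod_cast NeZero.ne q
  set F : ZMod q → ℂ := formValue fun k => freq t k.1 with hF
  have h := (tendsto_finsetSum Finset.univ fun j _ =>
    tendsto_sq_mul_exp_sub (Complex.I * F j)).const_mul (q : ℂ)⁻¹
  have hlim : (q : ℂ)⁻¹ * ∑ j : ZMod q, (Complex.I * F j) ^ 2 / 2
      = -(1 / 2) * ((∑ k : NZ q, ‖freq t k.1‖ ^ 2 : ℝ) : ℂ) := by
    have h1 : ∀ j : ZMod q, (Complex.I * F j) ^ 2 / 2 = -(1 / 2) * F j ^ 2 := fun j => by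
      rw [mul_pow, Complex.I_sq]
      ring
    simp only [h1]
    rw [← Finset.mul_sum, hF, sum_formValue_sq]
    have h2 : ∀ k : NZ q, freq t k.1 * freq t (negNZ k).1 = ((‖freq t k.1‖ ^ 2 : ℝ) : ℂ) := by
      intro k
      have h3 : (negNZ k : NZ q).1 = -k.1 := rfl
      rw [h3, freq_neg, Complex.mul_conj']
      push_cast
      rfl
    simp only [h2]
    push_cast
    field_simp
  rw [hlim] at h
  refine h.congr fun d => ?_
  have h4 : ∑ j : ZMod q, F j = 0 := sum_formValue _
  rw [← Finset.mul_sum, Finset.sum_sub_distrib, Finset.sum_sub_distrib, ← Finset.sum_div,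
    ← Finset.mul_sum, h4, phaseMean]
  simp only [Finset.sum_const, Finset.card_univ, ZMod.card, nsmul_eq_mul, phase]
  field_simp
  ring

theorem tendsto_phaseMean_pow (t : NZ q → ℝ) :
    Tendsto (fun d : ℕ => phaseMean t d ^ d) atTop
      (𝓝 (Complex.exp (-(1 / 2) * ((∑ k : NZ q, ‖freq t k.1‖ ^ 2 : ℝ) : ℂ)))) := by
  have h := Complex.tendsto_one_add_pow_exp_of_tendsto (tendsto_mul_phaseMean_sub_one t)
  simpa using h

theorem tendsto_phaseMean (t : NZ q → ℝ) : Tendsto (phaseMean t) atTop (𝓝 1) := by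
  have hinv : Tendsto (fun d : ℕ => ((d : ℂ))⁻¹) atTop (𝓝 0) := tendsto_inv_atTop_nhds_zero_nat
  have h := (hinv.mul (tendsto_mul_phaseMean_sub_one t)).add_const 1
  rw [zero_mul, zero_add] at h
  refine h.congr' ?_
  filter_upwards [eventually_gt_atTop 0] with d hd
  have hd' : (d : ℂ) ≠ 0 := by exact_mod_cast hd.ne'
  field_simp
  ring

/-- To leading order the Fourier coefficients of the phases are the frequencies `i τ_k / √d`. -/
theorem tendsto_sqrt_mul_phaseCoeff (t : NZ q → ℝ) (k : NZ q) :
    Tendsto (fun d : ℕ => ((Real.sqrt d : ℝ) : ℂ) * phaseCoeff t d k) atTop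
      (𝓝 (Complex.I * freq t k.1)) := by
  have hq : (q : ℂ) ≠ 0 := by exact_mod_cast NeZero.ne q
  set F : ZMod q → ℂ := formValue fun k => freq t k.1 with hF
  have hk0 : ∑ j, theta q (-k.1) j = 0 := by rw [sum_theta, if_neg (neg_ne_zero.mpr k.2)]
  have h := ((tendsto_phaseMean t).inv₀ one_ne_zero).mul
    ((tendsto_finsetSum Finset.univ fun j _ =>
      (tendsto_sqrt_mul_exp_sub_one (Complex.I * F j)).mul_const (theta q (-k.1) j)).const_mul
        (q : ℂ)⁻¹)
  have hlim : (1 : ℂ)⁻¹ * ((q : ℂ)⁻¹ * ∑ j, Complex.I * F j * theta q (-k.1) j)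
      = Complex.I * freq t k.1 := by
    have h1 := sum_nonzero fun j : ZMod q =>
      (if h : j = 0 then 0 else (t ⟨j, h⟩ : ℂ)) * theta q (-k.1) j
    simp only [dite_true, zero_mul, sub_zero] at h1
    have h2 : ∑ j, F j * theta q (-k.1) j = ∑ j : NZ q, (t j : ℂ) * theta q (-k.1) j.1 := by
      simp only [hF, formValue_freq, sub_mul]
      rw [Finset.sum_sub_distrib, ← Finset.mul_sum, hk0, mul_zero, sub_zero, ← h1]
      refine Finset.sum_congr rfl fun j _ => ?_
      rw [dif_neg j.2]
    simp only [mul_assoc]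
    rw [← Finset.mul_sum, h2, freq, inv_one]
    ring
  rw [hlim] at h
  refine h.congr fun d => ?_
  rw [phaseCoeff]
  simp only [phase, mul_sub, sub_mul, mul_one]
  rw [Finset.sum_sub_distrib, ← Finset.mul_sum, hk0]
  simp only [mul_assoc, ← Finset.mul_sum]
  ring

theorem exp_dotProduct_scaledCounts (t : NZ q → ℝ) {d : ℕ} {n : ZMod q → ℕ} (hn : ∑ j, n j = d) :
    Complex.exp (Complex.I * (toComplex t ⬝ᵥ toComplex (scaledCounts d n)))
      = ∏ j, phase t d j ^ n j := by
  have h1 : toComplex t ⬝ᵥ toComplex (scaledCounts d n)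
      = ∑ j, (n j : ℂ) * (formValue (fun k => freq t k.1) j / (Real.sqrt d : ℝ)) := by
    rw [sum_count_mul_formValue hn, sum_freq_mul_charSum]
    rfl
  simp only [phase, ← Complex.exp_nat_mul]
  rw [h1, ← Complex.exp_sum, Finset.mul_sum]
  congr 1
  exact Finset.sum_congr rfl fun j _ => by ring

/-- The exponential of the scaled counts is a multiple of the Krawtchouk generating function at
`phaseCoeff`, so its mean after one step of the walk is found from the eigenvalues. -/
theorem sum_walkProb_mul_exp {t : NZ q → ℝ} {d : ℕ} (hc : phaseMean t d ≠ 0)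
    {v m : ZMod q → ℕ} (hv : ∑ j, v j = d) (hm : ∑ j, m j = d) :
    ∑ n ∈ Finset.piAntidiag Finset.univ d, (walkProb d v m n : ℂ) *
        Complex.exp (Complex.I * (toComplex t ⬝ᵥ toComplex (scaledCounts d n)))
      = ∑ l ∈ (krawtchoukGen m).support, phaseMean t d ^ d *
        ((hNorm d l : ℂ) * krawtchouk l v * (krawtchouk l m * ∏ k, phaseCoeff t d k ^ l k)) := by
  have h1 : ∀ n ∈ Finset.piAntidiag (Finset.univ : Finset (ZMod q)) d,
      HasSum (fun l => (walkProb d v m n : ℂ) * (phaseMean t d ^ d *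
        (krawtchouk l n * ∏ k, phaseCoeff t d k ^ l k)))
        ((walkProb d v m n : ℂ) *
          Complex.exp (Complex.I * (toComplex t ⬝ᵥ toComplex (scaledCounts d n)))) := by
    intro n hn
    have hn' : ∑ j, n j = d := (Finset.mem_piAntidiag.mp hn).1
    refine HasSum.mul_left _ ?_
    have h2 := (hasSum_krawtchouk_div 1 (phaseCoeff t d) n).mul_left (phaseMean t d ^ d)
    simp only [Complex.ofReal_one, one_pow, div_one] at h2
    convert h2 using 1
    rw [exp_dotProduct_scaledCounts t hn']
    have hpow : phaseMean t d ^ d = ∏ j, phaseMean t d ^ n j := by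
      rw [Finset.prod_pow_eq_pow_sum, hn']
    rw [hpow, ← Finset.prod_mul_distrib]
    refine Finset.prod_congr rfl fun j _ => ?_
    rw [← mul_pow, phaseMean_mul_one_add hc]
  have h3 := hasSum_sum h1
  refine h3.unique ((hasSum_sum_of_ne_finset_zero fun l hl => ?_).congr_fun fun l => ?_)
  · rw [krawtchouk.eq_def l m, MvPolynomial.notMem_support_iff.mp hl]
    simp
  · have h4 := sum_walkProb_mul_krawtchouk hv hm l
    calc _ = (∑ n ∈ Finset.piAntidiag Finset.univ d, (walkProb d v m n : ℂ) * krawtchouk l n) *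
          (phaseMean t d ^ d * ∏ k, phaseCoeff t d k ^ l k) := by
          rw [Finset.sum_mul]
          exact Finset.sum_congr rfl fun n _ => by ring
      _ = _ := by
          rw [h4]
          ring

variable {Ω : Type*} [MeasurableSpace Ω] {P : Measure Ω} [IsProbabilityMeasure P]
  {V : ℕ → Ω → ZMod q → ℕ}

/-- The characteristic function of the transition probabilities, as a series in the scaled
Krawtchouk polynomials. -/
theorem charFun_meanWalkProb (hVmeas : ∀ d, Measurable (V d)) (hVsum : ∀ d ω, ∑ j, V d ω j = d)
    {t : NZ q → ℝ} {d : ℕ} (hd : 0 < d) (hc : phaseMean t d ≠ 0) {m : ZMod q → ℕ}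
    (hm : ∑ j, m j = d) :
    ∑ n ∈ Finset.piAntidiag Finset.univ d, (meanWalkProb P d (V d) m n : ℂ) *
        Complex.exp (Complex.I * (toComplex t ⬝ᵥ toComplex (scaledCounts d n)))
      = phaseMean t d ^ d * ∑' l : NZ q →₀ ℕ, meanEigen P d (V d) l *
        (krawtchouk l m / ((Real.sqrt d : ℝ) : ℂ) ^ l.degree *
          ∏ k, (((Real.sqrt d : ℝ) : ℂ) * phaseCoeff t d k) ^ l k) := by
  have hs : ((Real.sqrt d : ℝ) : ℂ) ≠ 0 := by
    exact_mod_cast (Real.sqrt_pos.mpr (by exact_mod_cast hd)).ne'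
  have hscale : ∀ l : NZ q →₀ ℕ, krawtchouk l m / ((Real.sqrt d : ℝ) : ℂ) ^ l.degree *
      ∏ k, (((Real.sqrt d : ℝ) : ℂ) * phaseCoeff t d k) ^ l k
      = krawtchouk l m * ∏ k, phaseCoeff t d k ^ l k := by
    intro l
    simp only [mul_pow, Finset.prod_mul_distrib]
    rw [Finset.prod_pow_eq_pow_sum, ← Finsupp.degree_eq_sum]
    field_simp
  simp only [hscale]
  rw [sum_meanWalkProb_mul hVmeas hVsum, tsum_eq_sum (s := (krawtchoukGen m).support)
    fun l hl => by rw [krawtchouk, MvPolynomial.notMem_support_iff.mp hl]; simp]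
  simp only [fun ω => sum_walkProb_mul_exp hc (hVsum d ω) hm]
  rw [integral_finsetSum _ fun l _ => integrable_comp_counts hVmeas hVsum d
    (g := fun v => phaseMean t d ^ d * ((hNorm d l : ℂ) * krawtchouk l v *
      (krawtchouk l m * ∏ k, phaseCoeff t d k ^ l k))), Finset.mul_sum]
  refine Finset.sum_congr rfl fun l _ => ?_
  rw [integral_const_mul, integral_mul_const, meanEigen]

/-- The characteristic functions of the transition probabilities converge to that of the normal
law with the mean and the covariance matrix of the limit density. -/
theorem tendsto_charFun_meanWalkProb (hVmeas : ∀ d, Measurable (V d))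
    (hVsum : ∀ d ω, ∑ j, V d ω j = d) {v : ZMod q → ℝ} (hv : v ∈ stdSimplex ℝ (ZMod q))
    (hV : TendstoInMeasure P (fun (d : ℕ) ω (j : ZMod q) => (V d ω j : ℝ) / d) atTop
      (fun _ => v)) {x : NZ q → ℝ} {m : ℕ → ZMod q → ℕ} (hm : ∀ d, ∑ j, m d j = d)
    (hx : Tendsto (fun d => scaledCounts d (m d)) atTop (𝓝 x)) (t : NZ q → ℝ) :
    Tendsto (fun d : ℕ => ∑ n ∈ Finset.piAntidiag Finset.univ d,
      (meanWalkProb P d (V d) (m d) n : ℂ) *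
        Complex.exp (Complex.I * (toComplex t ⬝ᵥ toComplex (scaledCounts d n)))) atTop
      (𝓝 (Complex.exp (Complex.I * (toComplex t ⬝ᵥ toComplex (meanVec v x))
        - 1 / 2 * quadForm (transitionCov v) (toComplex t)))) := by
  -- Uniform bound `R` on the scaled Fourier coefficients; the series is then dominated by a
  -- geometric one, on comparing with the decay of the polynomials at radius `2 R`.
  set R : ℝ := ∑ k : NZ q, (‖Complex.I * freq t k.1‖ + 1) + 1 with hR
  have hR0 : 0 < R := by positivity
  obtain ⟨C, hC⟩ := exists_bound_krawtchouk hm hx (ρ := 2 * R) (by positivity)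
  have hcoeff : ∀ᶠ d : ℕ in atTop, ∀ k : NZ q,
      ‖((Real.sqrt d : ℝ) : ℂ) * phaseCoeff t d k‖ ≤ R := by
    refine eventually_all.mpr fun k => ?_
    filter_upwards [(tendsto_sqrt_mul_phaseCoeff t k).norm.eventually_le_const
      (lt_add_one _)] with d hd
    have := Finset.single_le_sum (f := fun k : NZ q => ‖Complex.I * freq t k.1‖ + 1)
      (fun k _ => by positivity) (Finset.mem_univ k)
    exact hd.trans (this.trans (by rw [hR]; linarith))
  have hseries : Tendsto (fun d : ℕ => ∑' l : NZ q →₀ ℕ, meanEigen P d (V d) l *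
      (krawtchouk l (m d) / ((Real.sqrt d : ℝ) : ℂ) ^ l.degree *
        ∏ k, (((Real.sqrt d : ℝ) : ℂ) * phaseCoeff t d k) ^ l k)) atTop
      (𝓝 (∑' l : NZ q →₀ ℕ, (∏ k, limitEigen v k ^ l k) * (limitQ l (extend x) *
        ∏ k : NZ q, (Complex.I * freq t k.1) ^ l k))) := by
    refine tendsto_tsum_of_dominated_convergence
      (bound := fun l : NZ q →₀ ℕ => C * (1 / 2 : ℝ) ^ l.degree)
      ((summable_geometric_degree (by norm_num) (by norm_num)).mul_left C) (fun l => ?_) ?_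
    · exact (tendsto_meanEigen hVmeas hVsum hv hV l).mul ((tendsto_krawtchouk hm hx l).mul
        (tendsto_finsetProd _ fun k _ => (tendsto_sqrt_mul_phaseCoeff t k).pow _))
    · filter_upwards [hC, hcoeff] with d hd hk l
      have h1 : ‖∏ k, (((Real.sqrt d : ℝ) : ℂ) * phaseCoeff t d k) ^ l k‖ ≤ R ^ l.degree := by
        rw [norm_prod, Finsupp.degree_eq_sum, ← Finset.prod_pow_eq_pow_sum]
        refine Finset.prod_le_prod (fun _ _ => norm_nonneg _) fun k _ => ?_
        rw [norm_pow]
        exact pow_le_pow_left₀ (norm_nonneg _) (hk k) _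
      have h2 := hd l
      rw [norm_mul, norm_mul]
      calc _ ≤ 1 * (‖krawtchouk l (m d) / ((Real.sqrt d : ℝ) : ℂ) ^ l.degree‖ * R ^ l.degree) := by
            gcongr
            exact norm_meanEigen_le hVsum d l
        _ = ‖krawtchouk l (m d) / ((Real.sqrt d : ℝ) : ℂ) ^ l.degree‖ * (2 * R) ^ l.degree *
              (1 / 2) ^ l.degree := by
            rw [one_mul, mul_assoc, ← mul_pow]
            congr 2
            ring
        _ ≤ _ := by gcongr
  have hval : ∑' l : NZ q →₀ ℕ, (∏ k, limitEigen v k ^ l k) * (limitQ l (extend x) *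
      ∏ k : NZ q, (Complex.I * freq t k.1) ^ l k)
      = limitGenValue (extend x) fun k => Complex.I * (limitEigen v k * freq t k.1) := by
    rw [← (hasSum_limitQ (extend x) _).tsum_eq]
    refine tsum_congr fun l => ?_
    rw [mul_left_comm, ← Finset.prod_mul_distrib]
    congr 1
    exact Finset.prod_congr rfl fun k _ => by ring
  rw [hval, limitGenValue_freq] at hseries
  have hfin := (tendsto_phaseMean_pow t).mul hseries
  rw [← Complex.exp_add] at hfin
  have hexp : -(1 / 2) * ((∑ k : NZ q, ‖freq t k.1‖ ^ 2 : ℝ) : ℂ)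
      + (1 / 2 * ((∑ k : NZ q, ‖limitEigen v k‖ ^ 2 * ‖freq t k.1‖ ^ 2 : ℝ) : ℂ)
        + Complex.I * (toComplex (meanVec v x) ⬝ᵥ toComplex t))
      = Complex.I * (toComplex t ⬝ᵥ toComplex (meanVec v x))
        - 1 / 2 * quadForm (transitionCov v) (toComplex t) := by
    rw [quadForm_transitionCov, dotProduct_comm (toComplex t)]
    ring
  rw [hexp] at hfin
  refine hfin.congr' ?_
  filter_upwards [eventually_gt_atTop 0, (tendsto_phaseMean t).eventually_ne one_ne_zero]
    with d hd hc
  exact (charFun_meanWalkProb hVmeas hVsum hd hc (hm d)).symm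

end CharFun

/-! ### Weak convergence -/

section Weak

open Matrix

variable {ι β : Type*}

/-- The measure on Euclidean space with finitely many atoms `s n` of masses `p n`. -/
noncomputable def atomicMeasure (S : Finset β) (p : β → ℝ) (s : β → ι → ℝ) :
    Measure (EuclideanSpace ℝ ι) :=
  ∑ n ∈ S, ENNReal.ofReal (p n) • Measure.dirac (WithLp.toLp 2 (s n))

theorem isProbabilityMeasure_atomicMeasure {S : Finset β} {p : β → ℝ} (hp : ∀ n, 0 ≤ p n)
    (h1 : ∑ n ∈ S, p n = 1) (s : β → ι → ℝ) : IsProbabilityMeasure (atomicMeasure S p s) := by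
  refine ⟨?_⟩
  simp only [atomicMeasure, Measure.finsetSum_apply, Measure.smul_apply, measure_univ,
    smul_eq_mul, mul_one]
  rw [← ENNReal.ofReal_sum_of_nonneg fun n _ => hp n, h1, ENNReal.ofReal_one]

variable [Fintype ι]

theorem integral_atomicMeasure {S : Finset β} {p : β → ℝ} (hp : ∀ n, 0 ≤ p n) (s : β → ι → ℝ)
    {E : Type*} [NormedAddCommGroup E] [NormedSpace ℝ E] [CompleteSpace E]
    (g : EuclideanSpace ℝ ι → E) :
    ∫ z, g z ∂(atomicMeasure S p s) = ∑ n ∈ S, p n • g (WithLp.toLp 2 (s n)) := by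
  rw [atomicMeasure, integral_finsetSum_measure fun n _ =>
    (integrable_dirac (by finiteness)).smul_measure ENNReal.ofReal_ne_top]
  refine Finset.sum_congr rfl fun n _ => ?_
  rw [integral_smul_measure, integral_dirac, ENNReal.toReal_ofReal (hp n)]

/-- The measure on Euclidean space with a density given in coordinates. -/
noncomputable def densityMeasure (ρ : (ι → ℝ) → ℝ) : Measure (EuclideanSpace ℝ ι) :=
  (volume.withDensity fun y => ENNReal.ofReal (ρ y)).map (WithLp.toLp 2)

theorem integral_densityMeasure {ρ : (ι → ℝ) → ℝ} (hρ : Measurable ρ) (h0 : ∀ y, 0 ≤ ρ y)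
    {E : Type*} [NormedAddCommGroup E] [NormedSpace ℝ E] (g : EuclideanSpace ℝ ι → E) :
    ∫ z, g z ∂(densityMeasure ρ) = ∫ y, ρ y • g (WithLp.toLp 2 y) := by
  have h := (MeasurableEquiv.toLp 2 (ι → ℝ)).measurableEmbedding.integral_map
    (μ := volume.withDensity fun y => ENNReal.ofReal (ρ y)) g
  rw [densityMeasure]
  refine h.trans ?_
  rw [integral_withDensity_eq_integral_toReal_smul hρ.ennreal_ofReal
    (Eventually.of_forall fun _ => ENNReal.ofReal_lt_top)]
  congr 1
  ext y
  rw [ENNReal.toReal_ofReal (h0 y)]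
  rfl

theorem isProbabilityMeasure_densityMeasure {ρ : (ι → ℝ) → ℝ}
    (h0 : ∀ y, 0 ≤ ρ y) (hint : Integrable ρ) (h1 : ∫ y, ρ y = 1) :
    IsProbabilityMeasure (densityMeasure ρ) := by
  have : IsProbabilityMeasure ((volume : Measure (ι → ℝ)).withDensity
      fun y => ENNReal.ofReal (ρ y)) := by
    refine ⟨?_⟩
    rw [withDensity_apply _ MeasurableSet.univ, Measure.restrict_univ,
      ← ofReal_integral_eq_lintegral_ofReal hint (Eventually.of_forall h0), h1, ENNReal.ofReal_one]
  exact Measure.isProbabilityMeasure_map (MeasurableEquiv.toLp 2 (ι → ℝ)).measurable.aemeasurable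

theorem inner_toLp_mul_I (s : ι → ℝ) (t : EuclideanSpace ℝ ι) :
    ((inner ℝ (WithLp.toLp 2 s) t : ℝ) : ℂ) * Complex.I
      = Complex.I * (toComplex (WithLp.ofLp t) ⬝ᵥ toComplex s) := by
  rw [mul_comm, PiLp.inner_apply]
  simp [toComplex, dotProduct, mul_comm]

/-- Lévy's continuity theorem, for finitely supported laws and a limit law with a density. -/
theorem tendsto_sum_of_tendsto_charFun {S : ℕ → Finset β} {p : ℕ → β → ℝ}
    (hp : ∀ d n, 0 ≤ p d n) (hp1 : ∀ d, ∑ n ∈ S d, p d n = 1) (s : ℕ → β → ι → ℝ)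
    {ρ : (ι → ℝ) → ℝ} (hρ : Measurable ρ) (h0 : ∀ y, 0 ≤ ρ y) (hint : Integrable ρ)
    (h1 : ∫ y, ρ y = 1)
    (hchar : ∀ t : ι → ℝ, Tendsto (fun d => ∑ n ∈ S d, (p d n : ℂ) *
        Complex.exp (Complex.I * (toComplex t ⬝ᵥ toComplex (s d n)))) atTop
      (𝓝 (∫ y, (ρ y : ℂ) * Complex.exp (Complex.I * (toComplex t ⬝ᵥ toComplex y)))))
    (f : BoundedContinuousFunction (ι → ℝ) ℝ) :
    Tendsto (fun d => ∑ n ∈ S d, p d n * f (s d n)) atTop (𝓝 (∫ y, ρ y * f y)) := by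
  let μ : ℕ → ProbabilityMeasure (EuclideanSpace ℝ ι) := fun d =>
    ⟨atomicMeasure (S d) (p d) (s d), isProbabilityMeasure_atomicMeasure (hp d) (hp1 d) (s d)⟩
  let μ₀ : ProbabilityMeasure (EuclideanSpace ℝ ι) :=
    ⟨densityMeasure ρ, isProbabilityMeasure_densityMeasure h0 hint h1⟩
  have hμ : Tendsto μ atTop (𝓝 μ₀) := by
    refine ProbabilityMeasure.tendsto_of_tendsto_charFun fun t => ?_
    have h2 : ∀ d, charFun (μ d : Measure (EuclideanSpace ℝ ι)) t = ∑ n ∈ S d, (p d n : ℂ) *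
        Complex.exp (Complex.I * (toComplex (WithLp.ofLp t) ⬝ᵥ toComplex (s d n))) := fun d => by
      rw [charFun_apply]
      refine (integral_atomicMeasure (hp d) (s d) _).trans (Finset.sum_congr rfl fun n _ => ?_)
      rw [inner_toLp_mul_I, Complex.real_smul]
    have h3 : charFun (μ₀ : Measure (EuclideanSpace ℝ ι)) t = ∫ y, (ρ y : ℂ) *
        Complex.exp (Complex.I * (toComplex (WithLp.ofLp t) ⬝ᵥ toComplex y)) := by
      rw [charFun_apply]
      refine (integral_densityMeasure hρ h0 _).trans ?_
      congr 1
      ext y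
      rw [inner_toLp_mul_I, Complex.real_smul]
    simp only [h2, h3]
    exact hchar (WithLp.ofLp t)
  have h4 := ProbabilityMeasure.tendsto_iff_forall_integral_tendsto.mp hμ
    (f.compContinuous ⟨WithLp.ofLp, PiLp.continuous_ofLp 2 _⟩)
  have h5 : ∀ d, ∫ z, (f.compContinuous ⟨WithLp.ofLp, PiLp.continuous_ofLp 2 _⟩) z
      ∂(μ d : Measure (EuclideanSpace ℝ ι)) = ∑ n ∈ S d, p d n * f (s d n) := fun d =>
    integral_atomicMeasure (hp d) (s d) _
  have h6 : ∫ z, (f.compContinuous ⟨WithLp.ofLp, PiLp.continuous_ofLp 2 _⟩) z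
      ∂(μ₀ : Measure (EuclideanSpace ℝ ι)) = ∫ y, ρ y * f y :=
    integral_densityMeasure hρ h0 _
  simp only [h5, h6] at h4
  exact h4

end Weak

/-! ### The limit transition density -/

section LimitDensity

open Matrix

variable {q : ℕ} [NeZero q] {v : ZMod q → ℝ}

theorem integrable_gaussPdf_sub {ι : Type*} [Fintype ι] [DecidableEq ι] {A : Matrix ι ι ℝ}
    (hA : A.PosDef) (μ : ι → ℝ) :
    Integrable (fun y => gaussPdf A (y - μ)) ∧ ∫ y, gaussPdf A (y - μ) = 1 := by
  have h := charFun_gaussPdf hA μ 0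
  have h0 : ∀ z : ι → ℂ, toComplex (0 : ι → ℝ) ⬝ᵥ z = 0 := fun z => by
    simp [toComplex, dotProduct]
  have h1 : quadForm A (toComplex 0) = 0 := h0 _
  simp only [h0, h1, mul_zero, sub_zero, Complex.exp_zero, mul_one] at h
  refine ⟨by simpa using h.1.re, ?_⟩
  have h2 := h.2
  rw [integral_complex_ofReal] at h2
  exact_mod_cast h2

theorem measurable_limitDensity (h : ∀ k : NZ q, ‖limitEigen v k‖ < 1) :
    Measurable (Function.uncurry (limitDensity v)) := by
  have h1 : Function.uncurry (limitDensity v) = fun z : (NZ q → ℝ) × (NZ q → ℝ) =>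
      (gaussPdf (transitionCov v) (z.2 - meanVec v z.1) : ℂ) := by
    ext z
    exact limitDensity_eq h z.1 z.2
  rw [h1]
  exact (Complex.continuous_ofReal.comp ((continuous_gaussPdf _).comp
    (continuous_snd.sub ((continuous_meanVec v).comp continuous_fst)))).measurable

theorem integrable_limitDensity (h : ∀ k : NZ q, ‖limitEigen v k‖ < 1) (x : NZ q → ℝ) :
    Integrable (limitDensity v x) ∧ ∫ y, limitDensity v x y = 1 := by
  have h1 : limitDensity v x = fun y => (gaussPdf (transitionCov v) (y - meanVec v x) : ℂ) :=
    funext (limitDensity_eq h x)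
  have h2 := integrable_gaussPdf_sub (posDef_transitionCov h) (meanVec v x)
  simp only [h1]
  refine ⟨h2.1.ofReal, ?_⟩
  rw [integral_complex_ofReal, h2.2, Complex.ofReal_one]

/-- The transition functions of the grouped walk converge weakly to the limit density. -/
theorem tendsto_sum_groupedTransition {Ω : Type*} [MeasurableSpace Ω] {P : Measure Ω}
    [IsProbabilityMeasure P] {V : ℕ → Ω → ZMod q → ℕ} (hVmeas : ∀ d, Measurable (V d))
    (hVsum : ∀ d ω, ∑ j, V d ω j = d) (hv : v ∈ stdSimplex ℝ (ZMod q))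
    (hV : TendstoInMeasure P (fun (d : ℕ) ω (j : ZMod q) => (V d ω j : ℝ) / d) atTop
      (fun _ => v)) (h : ∀ k : NZ q, ‖limitEigen v k‖ < 1) {x : NZ q → ℝ}
    {m : ℕ → ZMod q → ℕ} (hm : ∀ d, ∑ j, m d j = d)
    (hx : Tendsto (fun d => scaledCounts d (m d)) atTop (𝓝 x))
    (f : BoundedContinuousFunction (NZ q → ℝ) ℝ) :
    Tendsto (fun d : ℕ => ∑ n ∈ Finset.piAntidiag (Finset.univ : Finset (ZMod q)) d,
        (f (scaledCounts d n) : ℂ) * groupedTransition P d (V d) (m d) n) atTop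
      (𝓝 (∫ y, (f y : ℂ) * limitDensity v x y)) := by
  have hA := posDef_transitionCov h
  have hpdf := integrable_gaussPdf_sub hA (meanVec v x)
  have hreal := tendsto_sum_of_tendsto_charFun
    (S := fun d => Finset.piAntidiag (Finset.univ : Finset (ZMod q)) d)
    (p := fun d n => meanWalkProb P d (V d) (m d) n) (fun d n => meanWalkProb_nonneg _ _ _ _)
    (fun d => sum_meanWalkProb hVmeas hVsum d (m d)) (fun d n => scaledCounts d n)
    (ρ := fun y => gaussPdf (transitionCov v) (y - meanVec v x))
    ((continuous_gaussPdf _).comp (continuous_id.sub continuous_const)).measurable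
    (fun y => gaussPdf_nonneg _ _) hpdf.1 hpdf.2
    (fun t => by
      rw [(charFun_gaussPdf hA (meanVec v x) t).2]
      exact tendsto_charFun_meanWalkProb hVmeas hVsum hv hV hm hx t) f
  have hlim : ∫ y, (f y : ℂ) * limitDensity v x y
      = ((∫ y, gaussPdf (transitionCov v) (y - meanVec v x) * f y : ℝ) : ℂ) := by
    rw [← integral_complex_ofReal]
    congr 1
    ext y
    rw [limitDensity_eq h, mul_comm]
    exact (Complex.ofReal_mul _ _).symm
  rw [hlim]
  refine ((Complex.continuous_ofReal.tendsto _).comp hreal).congr fun d => ?_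
  rw [Function.comp_apply, Complex.ofReal_sum]
  refine Finset.sum_congr rfl fun n hn => ?_
  rw [groupedTransition_eq hVsum (hm d) (Finset.mem_piAntidiag.mp hn).1, Complex.ofReal_mul,
    mul_comm]

end LimitDensity

end GroupedWalk

theorem mainTheorem6 (q : ℕ) [NeZero q]
    {Ω : Type*} [MeasurableSpace Ω] (P : Measure Ω) [IsProbabilityMeasure P]
    -- the random increment counts, one random vector for every dimension `d`
    (V : ℕ → Ω → ZMod q → ℕ) (hVmeas : ∀ d, Measurable (V d))
    (hVsum : ∀ d ω, ∑ j, V d ω j = d)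
    (v : ZMod q → ℝ) (hv : v ∈ stdSimplex ℝ (ZMod q))
    (hV : TendstoInMeasure P (fun (d : ℕ) ω (j : ZMod q) => (V d ω j : ℝ) / d) atTop
      (fun _ => v)) :
    -- `Q_l(𝔪; ∞)` is the limit of the scaled Krawtchouk polynomials
    (∀ (x : GroupedWalk.NZ q → ℝ) (m : ℕ → ZMod q → ℕ), (∀ d, ∑ j, m d j = d) →
      Tendsto (fun d => GroupedWalk.scaledCounts d (m d)) atTop (𝓝 x) →
      ∀ l : GroupedWalk.NZ q →₀ ℕ,
        Tendsto (fun d : ℕ =>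
            GroupedWalk.krawtchouk l (m d) / ((Real.sqrt d : ℝ) : ℂ) ^ l.degree) atTop
          (𝓝 (GroupedWalk.limitQ l (GroupedWalk.extend x)))) ∧
    -- the factor in front and every term of the expansion converge
    (∀ (x y : GroupedWalk.NZ q → ℝ) (m n : ℕ → ZMod q → ℕ),
      (∀ d, ∑ j, m d j = d) → (∀ d, ∑ j, n d j = d) →
      Tendsto (fun d => GroupedWalk.scaledCounts d (m d)) atTop (𝓝 x) →
      Tendsto (fun d => GroupedWalk.scaledCounts d (n d)) atTop (𝓝 y) →
      Tendsto (fun d : ℕ =>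
          (d : ℝ) ^ (((q : ℝ) - 1) / 2) * GroupedWalk.multinomialProb d (n d)) atTop
        (𝓝 (GroupedWalk.gaussianDensity y)) ∧
      ∀ l : GroupedWalk.NZ q →₀ ℕ,
        Tendsto (fun d : ℕ =>
            ∫ ω, GroupedWalk.spectralTerm d (V d ω) (m d) (n d) l ∂P) atTop
          (𝓝 (GroupedWalk.limitTerm v x y l))) ∧
    -- the series is a transition density, and the transition functions converge weakly to it
    ((∀ k : GroupedWalk.NZ q, ‖GroupedWalk.limitEigen v k‖ < 1) →
      (∀ x y : GroupedWalk.NZ q → ℝ, Summable (GroupedWalk.limitTerm v x y)) ∧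
      (∀ x y : GroupedWalk.NZ q → ℝ, (GroupedWalk.limitDensity v x y).im = 0 ∧
        0 ≤ (GroupedWalk.limitDensity v x y).re) ∧
      Measurable (Function.uncurry (GroupedWalk.limitDensity v)) ∧
      (∀ x : GroupedWalk.NZ q → ℝ, Integrable (GroupedWalk.limitDensity v x) ∧
        ∫ y, GroupedWalk.limitDensity v x y = 1) ∧
      ∀ (x : GroupedWalk.NZ q → ℝ) (m : ℕ → ZMod q → ℕ), (∀ d, ∑ j, m d j = d) →
        Tendsto (fun d => GroupedWalk.scaledCounts d (m d)) atTop (𝓝 x) →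
        ∀ f : BoundedContinuousFunction (GroupedWalk.NZ q → ℝ) ℝ,
          Tendsto (fun d : ℕ =>
              ∑ n ∈ Finset.piAntidiag (Finset.univ : Finset (ZMod q)) d,
                (f (GroupedWalk.scaledCounts d n) : ℂ)
                  * GroupedWalk.groupedTransition P d (V d) (m d) n) atTop
            (𝓝 (∫ y, (f y : ℂ) * GroupedWalk.limitDensity v x y))) := by
  refine ⟨fun x m hm hx l => GroupedWalk.tendsto_krawtchouk hm hx l,
    fun x y m n hm hn hx hy => ⟨GroupedWalk.tendsto_multinomialProb hn hy, fun l =>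
      GroupedWalk.tendsto_integral_spectralTerm hVmeas hVsum hv hV hm hn hx hy l⟩,
    fun h => ⟨fun x y => (GroupedWalk.hasSum_limitTerm h x y).summable, fun x y => ?_,
      GroupedWalk.measurable_limitDensity h, GroupedWalk.integrable_limitDensity h,
      fun x m hm hx f =>
        GroupedWalk.tendsto_sum_groupedTransition hVmeas hVsum hv hV h hm hx f⟩⟩
  rw [GroupedWalk.limitDensity_eq h]
  exact ⟨Complex.ofReal_im _, GroupedWalk.gaussPdf_nonneg _ _⟩
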